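/- **Model.** Let $\mathcal V$ be a finite set of nodes forming, with a gateway $\mathrm{gw}$, a tree rooted at $\mathrm{gw}$. Each node belongs to exactly one workflow $\mathbf w\in\mathcal W$ ($\mathcal W$ finite), and for every $\mathbf w$ the set $\{\mathrm{gw}\}\cup\mathcal V_{\mathbf w}$ is a subtree containing the root, where $\mathcal V_{\mathbf w}$ is the set of nodes of $\mathbf w$. Let $\mathcal Z$ (zones), $\mathcal A_{\mathrm D}^{(V)}$, $\mathcal A_{\mathrm A}^{(V)}$ (local defender and attacker actions, each with a null action $\bot$) and $\mathcal O^{(V)}$ (local observations, linearly ordered) be finite. Node $i$ has a zone $z_i\in\mathcal Z$, seen by the defender, and an attacker state $s_i=(v^{(R)}_i,v^{(I)}_i)\in\{0,1\}^2$ (discovered, compromised), seen by the attacker. In state $s_i$ the attacker may use on node $i$ the actions in a set $\mathcal A_i(s_i)\ni\bot$. Given the states and actions of all nodes, the nodes move independently, $z_i'\sim f_{\mathrm D,i}(\cdot\mid z_i,a^{\mathrm D}_i)$ and $s_i'\sim f_{\mathrm A,i}(\cdot\mid s_i,a^{\mathrm A}_i,a^{\mathrm D}_i)$, and emit independent public observations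 $o_i\sim Z_i(\cdot\mid z_i,s_i)$. A defensive action $a^{\mathrm D}_i\ne\bot$ sets $s_i'=(0,0)$; an undiscovered, uncompromised node cannot become compromised in the next step; under $a_i^{\mathrm D}=\bot$ a discovered node stays discovered and, if it is compromised, stays compromised. Node $i$ is active or not depending on its zone; $\alpha_i(z_i)\in\{0,1\}$ is the indicator. The stage utility of the defender is $$u=\sum_{i\in\mathcal V}\Big(\eta\,\kappa\,\#\{\text{active nodes in the subtree rooted at } i\}-v^{(I)}_i-c(a^{\mathrm D}_i)\Big),\qquad \eta,\kappa\ge 0,\ c\ge 0,$$ and $J=\sum_{t\ge1}\gamma^{t-1}u_t$ with $\gamma\in[0,1)$. Initially the zones are given and all $s_i=(0,0)$. At each time a player knows its own past and present states, its own past actions and all observations; a strategy maps each such history to a distribution on the player's (available) actions. The defender maximizes and the attacker minimizes $\mathbb E[J]$. This is the game $\Gamma$. The workflow subgame $\Gamma^{(\mathbf w)}$ is the same game on the nodes $\mathcal V_{\mathbf w}$. The node subgame $\Gamma^{(i)}$ is the game with zone, attacker state, actions, observations and dynamics of node $i$ alone and stage utility $\eta\kappa\,|\mathrm{an}(i)|\,\alpha_i(z_i)-v_i^{(I)}-c(a_i^{\mathrm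 D})$, where $\mathrm{an}(i)\subseteq\mathcal V$ consists of $i$ and its ancestors other than $\mathrm{gw}$. A family of subgames of a game $G$, whose spaces multiply to those of $G$, is called *observation-independent* if the observation function of $G$ is the product of those of the subgames; *transition-independent* if the transition functions, the initial distributions and the sets of available actions of $G$ are the products of those of the subgames; *utility-independent* if the utility of $G$ is the sum of the utilities of the subgames, with the same discount factor. It has *optimal substructure* if in each subgame both players have best responses against every strategy of the opponent, and, for each player, whenever the opponent plays independently in the subgames (in each subgame by a strategy based on the history of that subgame), playing independently $\pi_k$ in each subgame $k$ is a best response in $G$, among all strategies of $G$, if and only if each $\pi_k$ is a best response in subgame $k$. **Theorem.** (A) The workflow subgames $(\Gamma^{(\mathbf w)})_{\mathbf w\in\mathcal W}$ of $\Gamma$ are observation-, transition- and utility-independent and have optimal substructure. (B) For each $\mathbf w\in\mathcal W$, the node subgames $(\Gamma^{(i)})_{i\in\mathcal V_{\mathbf w}}$ of $\Gamma^{(\mathbf w)}$ are observation-, transition- and utility-independent and have optimal substructure. The number of entries of the tables that specify $\Gamma^{(i)}$ depends only on $|\mathcal Z|,|\mathcal A_{\mathrm D}^{(V)}|,|\mathcal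 A_{\mathrm A}^{(V)}|,|\mathcal O^{(V)}|$, not on $|\mathcal V|$; it is $$4|\mathcal A_{\mathrm A}^{(V)}|+|\mathcal Z|^2|\mathcal A_{\mathrm D}^{(V)}|+16|\mathcal A_{\mathrm A}^{(V)}||\mathcal A_{\mathrm D}^{(V)}|+4|\mathcal Z||\mathcal O^{(V)}|+4|\mathcal Z||\mathcal A_{\mathrm D}^{(V)}|+|\mathcal Z|+5 .$$ (C) Let $i\in\mathcal V$ be such that, for every zone $z$, the matrix $\big(Z_i(o\mid z,s)\big)_{s,o}$ with $s$ running through $(0,0),(1,0),(1,1)$ in this order is totally positive of order 2 (all second-order minors are nonnegative). Let the attacker play in $\Gamma^{(i)}$ a stationary strategy, which depends only on the current attacker state $s_i$. Let $\mathbf b_t$ be the defender's belief at time $t$, that is, the conditional distribution of $s_{i,t}$ given the defender's history, a point of the simplex $\mathcal B$ with vertices $\mathbf e_1,\mathbf e_2,\mathbf e_3$ corresponding to $(0,0),(1,0),(1,1)$. Then there are, for each zone $z$, a stopping set $\mathscr S_z\subseteq\mathcal B$ and an action $a_z$, with $a_z\neq\bot$ if $\mathscr S_z\ne\emptyset$,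 such that the rule "take $a_{z_t}$ if $\mathbf b_t\in\mathscr S_{z_t}$, and $\bot$ otherwise" is a best response of the defender in $\Gamma^{(i)}$ among all strategies; with the same $\mathscr S_z$ and $a_z$ it is also one when $\Gamma^{(i)}$ is started from any zone and any distribution of $s_i$ on $\{(0,0),(1,0),(1,1)\}$. Each $\mathscr S_z$ is bounded by a switching curve: there is $\lambda_z:[0,1]\to\mathbb R$, continuous on $\{x:\lambda_z(x)\le 1\}$, such that for all $x,\varepsilon\in[0,1]$ the point $(1-\varepsilon)\mathbf e_1+\varepsilon\big((1-x)\mathbf e_2+x\mathbf e_3\big)$ lies in $\mathscr S_z$ if and only if $\varepsilon\ge\lambda_z(x)$; and each of $\mathscr S_z$ and $\mathcal B\setminus\mathscr S_z$ is empty or connected. -/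

import Mathlib

noncomputable section

namespace IntrusionResponse

/-- Probability distributions on a finite type. -/
abbrev FinDist (α : Type) [Fintype α] : Type := stdSimplex ℝ α

/-- The product of the distributions `p k`, carried to a type `α` that is identified with the
product of the types `β k`. -/
def FinDist.prod {K : Type} [Fintype K] [DecidableEq K] {α : Type} [Fintype α]
    {β : K → Type} [∀ k, Fintype (β k)] (e : α ≃ ∀ k, β k) (p : ∀ k, FinDist (β k)) : FinDist α :=
  ⟨fun a => ∏ k, p k (e a k), fun _ => Finset.prod_nonneg fun k _ => (p k).2.1 _, by
    have h : ∑ f : (∀ k, β k), ∏ k, p k (f k) = 1 := by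
      rw [← Fintype.prod_sum fun k b => p k b]
      exact Finset.prod_eq_one fun k _ => (p k).2.2
    rw [← h]
    exact Fintype.sum_equiv e _ _ fun _ => rfl⟩

/-! ### Histories -/

/-- Histories `(s₁, o₁, a₁, s₂, o₂, …, aₙ, sₙ₊₁, oₙ₊₁)`, indexed by the number `n` of actions
taken so far. -/
def Hist (S A O : Type) : ℕ → Type
  | 0 => S × O
  | n + 1 => Hist S A O n × A × S × O

namespace Hist

instance instFintype {S A O : Type} [Fintype S] [Fintype A] [Fintype O] :
    ∀ n, Fintype (Hist S A O n)
  | 0 => inferInstanceAs (Fintype (S × O))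
  | n + 1 =>
    haveI := instFintype (S := S) (A := A) (O := O) n
    inferInstanceAs (Fintype (Hist S A O n × A × S × O))

/-- The current state. -/
def last {S A O : Type} : ∀ {n : ℕ}, Hist S A O n → S
  | 0, (s, _) => s
  | _ + 1, (_, _, s, _) => s

/-- Apply maps to all states, all actions and all observations of a history. -/
def map {S A O S' A' O' : Type} (f : S → S') (g : A → A') (k : O → O') :
    ∀ {n : ℕ}, Hist S A O n → Hist S' A' O' n
  | 0, (s, o) => (f s, k o)
  | _ + 1, (h, a, s, o) => (map f g k h, g a, f s, k o)

end Hist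

/-- A behaviour strategy of a player with private states `S`, actions `A` and public
observations `O`. -/
abbrev Strategy (S A O : Type) [Fintype A] : Type := ∀ n : ℕ, Hist S A O n → FinDist A

/-! ### Partially observed stochastic games with public observations -/

/-- A finite stationary two-player zero-sum partially observed stochastic game with public
observations. `D` is the defender (who maximizes), `A` is the attacker (who minimizes). Player
`D` sees the states in `SD`, player `A` sees the states in `SA`, and both see the observations
in `O`. -/
structure Game (SD SA AD AA O : Type)
    [Fintype SD] [Fintype SA] [Fintype AD] [Fintype AA] [Fintype O] where
  /-- the actions available to the attacker in a given attacker state -/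
  adm : SA → Set AA
  adm_nonempty : ∀ s, (adm s).Nonempty
  /-- defender transition function -/
  fD : SD → AD → FinDist SD
  /-- attacker transition function -/
  fA : SA → AA → AD → FinDist SA
  /-- observation function -/
  Z : SD → SA → FinDist O
  /-- utility of the defender -/
  u : SD → SA → AD → ℝ
  /-- discount factor -/
  γ : ℝ
  γ_nonneg : 0 ≤ γ
  γ_lt_one : γ < 1
  /-- distribution of the initial defender state -/
  initD : FinDist SD
  /-- distribution of the initial attacker state -/
  initA : FinDist SA

namespace Game

section

variable {SD SA AD AA O : Type}
  [Fintype SD] [Fintype SA] [Fintype AD] [Fintype AA] [Fintype O]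

/-- The number of real entries in the tables that specify the game. -/
def spaceComplexity (_ : Game SD SA AD AA O) : ℕ :=
  Fintype.card SA * Fintype.card AA
    + Fintype.card SD * Fintype.card AD * Fintype.card SD
    + Fintype.card SA * Fintype.card AA * Fintype.card AD * Fintype.card SA
    + Fintype.card SD * Fintype.card SA * Fintype.card O
    + Fintype.card SD * Fintype.card SA * Fintype.card AD
    + 1 + Fintype.card SD + Fintype.card SA

/-- Plays: sequences of joint states, joint actions and observations. -/
abbrev Play (SD SA AD AA O : Type) (n : ℕ) : Type := Hist (SD × SA) (AD × AA) O n

/-- The probability of a play under a strategy profile. -/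
def prob (G : Game SD SA AD AA O) (πD : Strategy SD AD O) (πA : Strategy SA AA O) :
    ∀ {n : ℕ}, Play SD SA AD AA O n → ℝ
  | 0, (s, o) => G.initD s.1 * G.initA s.2 * G.Z s.1 s.2 o
  | n + 1, (p, a, s, o) =>
      prob G πD πA p
        * πD n (Hist.map Prod.fst Prod.fst id p) a.1
        * πA n (Hist.map Prod.snd Prod.snd id p) a.2
        * G.fD (Hist.last (n := n) p).1 a.1 s.1
        * G.fA (Hist.last (n := n) p).2 a.2 a.1 s.2
        * G.Z s.1 s.2 o

/-- Expected utility of the defender in stage `n` (the first stage is stage `0`). -/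
def stageUtility (G : Game SD SA AD AA O) (πD : Strategy SD AD O) (πA : Strategy SA AA O)
    (n : ℕ) : ℝ :=
  ∑ p : Play SD SA AD AA O n, ∑ a : AD,
    G.prob πD πA p * πD n (Hist.map Prod.fst Prod.fst id p) a * G.u p.last.1 p.last.2 a

/-- Expected discounted utility `𝔼[J]` of the defender. -/
def payoff (G : Game SD SA AD AA O) (πD : Strategy SD AD O) (πA : Strategy SA AA O) : ℝ :=
  ∑' n : ℕ, G.γ ^ n * G.stageUtility πD πA n

/-- Attacker strategies that only use available actions. -/
def Admissible (G : Game SD SA AD AA O) (πA : Strategy SA AA O) : Prop :=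
  ∀ n (h : Hist SA AA O n) (a : AA), πA n h a ≠ 0 → a ∈ G.adm h.last

/-- `πD` is a best response of the defender against `πA`. -/
def IsBestResponseD (G : Game SD SA AD AA O) (πA : Strategy SA AA O)
    (πD : Strategy SD AD O) : Prop :=
  ∀ πD' : Strategy SD AD O, G.payoff πD' πA ≤ G.payoff πD πA

/-- `πA` is a best response of the attacker against `πD`. -/
def IsBestResponseA (G : Game SD SA AD AA O) (πD : Strategy SD AD O)
    (πA : Strategy SA AA O) : Prop :=
  G.Admissible πA ∧
    ∀ πA' : Strategy SA AA O, G.Admissible πA' → G.payoff πD πA ≤ G.payoff πD πA'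

end

end Game

/-! ### Decomposition of a game into subgames -/

/-- An identification of the state, action and observation spaces of a game with the products of
the corresponding spaces of a family of subgames. -/
structure Split (SD SA AD AA O : Type) {K : Type} (SD' SA' AD' AA' O' : K → Type) where
  sD : SD ≃ ∀ k, SD' k
  sA : SA ≃ ∀ k, SA' k
  aD : AD ≃ ∀ k, AD' k
  aA : AA ≃ ∀ k, AA' k
  o : O ≃ ∀ k, O' k

namespace Split

variable {SD SA AD AA O : Type}
  [Fintype SD] [Fintype SA] [Fintype AD] [Fintype AA] [Fintype O]
  {K : Type} [Fintype K] [DecidableEq K] {SD' SA' AD' AA' O' : K → Type}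
  [∀ k, Fintype (SD' k)] [∀ k, Fintype (SA' k)] [∀ k, Fintype (AD' k)]
  [∀ k, Fintype (AA' k)] [∀ k, Fintype (O' k)]

/-- The defender plays `π k` in subgame `k`, on the history of subgame `k`, independently. -/
def combineD (e : Split SD SA AD AA O SD' SA' AD' AA' O')
    (π : ∀ k, Strategy (SD' k) (AD' k) (O' k)) : Strategy SD AD O := fun n h =>
  FinDist.prod e.aD fun k =>
    π k n (h.map (fun s => e.sD s k) (fun a => e.aD a k) (fun o => e.o o k))

/-- The attacker plays `π k` in subgame `k`, on the history of subgame `k`, independently. -/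
def combineA (e : Split SD SA AD AA O SD' SA' AD' AA' O')
    (π : ∀ k, Strategy (SA' k) (AA' k) (O' k)) : Strategy SA AA O := fun n h =>
  FinDist.prod e.aA fun k =>
    π k n (h.map (fun s => e.sA s k) (fun a => e.aA a k) (fun o => e.o o k))

/-- Given the states, the observations of the subgames are independent, and those of subgame `k`
depend only on the states of subgame `k`. -/
def ObservationIndependent (e : Split SD SA AD AA O SD' SA' AD' AA' O')
    (G : Game SD SA AD AA O)
    (G' : ∀ k, Game (SD' k) (SA' k) (AD' k) (AA' k) (O' k)) : Prop :=
  ∀ sD sA o, G.Z sD sA o = ∏ k, (G' k).Z (e.sD sD k) (e.sA sA k) (e.o o k)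

/-- The states of the subgames start and move independently, those of subgame `k` depend only on
the states and actions of subgame `k`, and so do the actions available to the attacker. -/
def TransitionIndependent (e : Split SD SA AD AA O SD' SA' AD' AA' O')
    (G : Game SD SA AD AA O)
    (G' : ∀ k, Game (SD' k) (SA' k) (AD' k) (AA' k) (O' k)) : Prop :=
  (∀ s a s', G.fD s a s' = ∏ k, (G' k).fD (e.sD s k) (e.aD a k) (e.sD s' k)) ∧
  (∀ s a d s', G.fA s a d s' =
    ∏ k, (G' k).fA (e.sA s k) (e.aA a k) (e.aD d k) (e.sA s' k)) ∧
  (∀ s, G.initD s = ∏ k, (G' k).initD (e.sD s k)) ∧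
  (∀ s, G.initA s = ∏ k, (G' k).initA (e.sA s k)) ∧
  (∀ s a, a ∈ G.adm s ↔ ∀ k, e.aA a k ∈ (G' k).adm (e.sA s k))

/-- The utility is the sum of utilities of the subgames, each of which depends only on the states
and actions of that subgame. -/
def UtilityIndependent (e : Split SD SA AD AA O SD' SA' AD' AA' O')
    (G : Game SD SA AD AA O)
    (G' : ∀ k, Game (SD' k) (SA' k) (AD' k) (AA' k) (O' k)) : Prop :=
  (∀ sD sA a, G.u sD sA a = ∑ k, (G' k).u (e.sD sD k) (e.sA sA k) (e.aD a k)) ∧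
  ∀ k, (G' k).γ = G.γ

/-- Optimal substructure: both players have best responses in the subgames against everything that
the opponent can play there, and playing `π k` in each subgame `k` is a best response in `G`, among
all strategies of `G`, if and only if `π k` is a best response in subgame `k` for each `k`. -/
def OptimalSubstructure (e : Split SD SA AD AA O SD' SA' AD' AA' O')
    (G : Game SD SA AD AA O)
    (G' : ∀ k, Game (SD' k) (SA' k) (AD' k) (AA' k) (O' k)) : Prop :=
  (∀ k πA, (G' k).Admissible πA → ∃ πD, (G' k).IsBestResponseD πA πD) ∧
  (∀ k πD, ∃ πA, (G' k).IsBestResponseA πD πA) ∧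
  ∀ (πD : ∀ k, Strategy (SD' k) (AD' k) (O' k)) (πA : ∀ k, Strategy (SA' k) (AA' k) (O' k)),
    (∀ k, (G' k).Admissible (πA k)) →
      G.Admissible (e.combineA πA) ∧
      (G.IsBestResponseD (e.combineA πA) (e.combineD πD) ↔
        ∀ k, (G' k).IsBestResponseD (πA k) (πD k)) ∧
      (G.IsBestResponseA (e.combineD πD) (e.combineA πA) ↔
        ∀ k, (G' k).IsBestResponseA (πD k) (πA k))

end Split

/-! ### The intrusion response model -/

/-- Attacker state of a node: the pair (reconnaissance state, intrusion state). -/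
abbrev NodeAttState : Type := Bool × Bool

/-- The three attacker states of a node in which only a discovered node can be compromised:
`0` is undiscovered, `1` is discovered, `2` is discovered and compromised. -/
def level : Fin 3 → NodeAttState := ![(false, false), (true, false), (true, true)]

/-- The intrusion response model with nodes `V`, workflows `W`, network zones `Zn`, and local
defender actions `AD`, attacker actions `AA` and observations `O` per node. -/
structure Model (V W Zn AD AA O : Type) [Fintype V] [Fintype W] [Fintype Zn] [Fintype AD]
    [Fintype AA] [Fintype O] where
  /-- The tree rooted at the gateway: `none` means that the parent is the gateway. -/
  parent : V → Option V
  /-- Every node is connected to the gateway. -/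
  rooted : ∀ i, ∃ r, Relation.ReflTransGen (fun a b => parent a = some b) i r ∧ parent r = none
  /-- The unique workflow of a node. -/
  wf : V → W
  /-- Together with the gateway, the nodes of a workflow form a subtree. -/
  wf_parent : ∀ i j, parent i = some j → wf j = wf i
  /-- The null action of the defender. -/
  nullD : AD
  /-- The null action of the attacker. -/
  nullA : AA
  /-- Whether node `i` is active when it resides in a given zone. -/
  active : V → Zn → Bool
  /-- Zone dynamics of a node. -/
  fD : V → Zn → AD → FinDist Zn
  /-- Dynamics of the attacker state of a node. -/
  fA : V → NodeAttState → AA → AD → FinDist NodeAttState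
  /-- Observation distributions of a node. -/
  Z : V → Zn → NodeAttState → FinDist O
  /-- Attacker actions available on a node. -/
  adm : V → NodeAttState → Set AA
  nullA_mem : ∀ i s, nullA ∈ adm i s
  /-- Every defensive action resets the attacker state of the node. -/
  reset : ∀ i s a d, d ≠ nullD → fA i s a d (false, false) = 1
  /-- A node can only be compromised if it is discovered. -/
  discover_first : ∀ i a d s', a ∈ adm i (false, false) →
    fA i (false, false) a d s' ≠ 0 → s'.2 = false
  /-- Without a defensive action, a discovered node stays discovered and a compromised node stays
  compromised. -/
  persist : ∀ i s a s', s.1 = true → a ∈ adm i s → fA i s a nullD s' ≠ 0 →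
    s'.1 = true ∧ (s.2 = true → s'.2 = true)
  /-- Cost of the local defender actions. -/
  cost : AD → ℝ
  cost_nonneg : ∀ a, 0 ≤ cost a
  /-- Weight of the workflow utility. -/
  η : ℝ
  η_nonneg : 0 ≤ η
  /-- Proportionality constant of the workflow utility. -/
  κ : ℝ
  κ_nonneg : 0 ≤ κ
  γ : ℝ
  γ_nonneg : 0 ≤ γ
  γ_lt_one : γ < 1
  /-- Initial zones of the nodes. -/
  zone₁ : V → Zn

namespace Model

variable {V W Zn AD AA O : Type} [Fintype V] [DecidableEq V] [Fintype W] [DecidableEq W]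
  [Fintype Zn] [DecidableEq Zn] [Fintype AD] [DecidableEq AD] [Fintype AA] [Fintype O]

/-- `M.IsAncestor j i`: node `j` is `i` or an ancestor of `i`; equivalently, `i` lies in the subtree
rooted at `j`. -/
def IsAncestor (M : Model V W Zn AD AA O) (j i : V) : Prop :=
  Relation.ReflTransGen (fun a b => M.parent a = some b) i j

/-- Intrusion cost of a node. -/
def intrusionCost (M : Model V W Zn AD AA O) (s : NodeAttState) (a : AD) : ℝ :=
  (if s.2 = true then 1 else 0) + M.cost a

/-- The game on the nodes `ι i`, `i : I`. The workflow utility of a node is proportional to the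
number of active nodes in the subtree rooted at the node. Initially no node is discovered or
compromised. -/
def gameOn (M : Model V W Zn AD AA O) {I : Type} [Fintype I] [DecidableEq I] (ι : I → V) :
    Game (I → Zn) (I → NodeAttState) (I → AD) (I → AA) (I → O) where
  adm s := {a | ∀ i, a i ∈ M.adm (ι i) (s i)}
  adm_nonempty s := ⟨fun _ => M.nullA, fun i => M.nullA_mem (ι i) (s i)⟩
  fD z d := FinDist.prod (Equiv.refl _) fun i => M.fD (ι i) (z i) (d i)
  fA s a d := FinDist.prod (Equiv.refl _) fun i => M.fA (ι i) (s i) (a i) (d i)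
  Z z s := FinDist.prod (Equiv.refl _) fun i => M.Z (ι i) (z i) (s i)
  u z s d := ∑ i, (M.η * (M.κ *
      (Set.ncard {j : I | M.IsAncestor (ι i) (ι j) ∧ M.active (ι j) (z j) = true} : ℝ))
    - M.intrusionCost (s i) (d i))
  γ := M.γ
  γ_nonneg := M.γ_nonneg
  γ_lt_one := M.γ_lt_one
  initD := stdSimplex.vertex fun i => M.zone₁ (ι i)
  initA := stdSimplex.vertex fun _ => (false, false)

/-- The intrusion response game `Γ`. -/
def game (M : Model V W Zn AD AA O) :
    Game (V → Zn) (V → NodeAttState) (V → AD) (V → AA) (V → O) :=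
  M.gameOn id

/-- The nodes of workflow `w`. -/
abbrev WNode (M : Model V W Zn AD AA O) (w : W) : Type := {i : V // M.wf i = w}

/-- The workflow subgame. -/
def workflowGame (M : Model V W Zn AD AA O) (w : W) :
    Game (M.WNode w → Zn) (M.WNode w → NodeAttState) (M.WNode w → AD) (M.WNode w → AA)
      (M.WNode w → O) :=
  M.gameOn Subtype.val

/-- The game on the single node `i`, started with zone `z` and with attacker state distributed
according to `μ`. The node is credited with its own contribution to the workflow utilities of itself
and of its ancestors. -/
def nodeGameFrom (M : Model V W Zn AD AA O) (i : V) (z : Zn) (μ : FinDist NodeAttState) :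
    Game Zn NodeAttState AD AA O where
  adm := M.adm i
  adm_nonempty s := ⟨M.nullA, M.nullA_mem i s⟩
  fD := M.fD i
  fA := M.fA i
  Z := M.Z i
  u z s d := M.η * (M.κ * ((Set.ncard {j : V | M.IsAncestor j i} : ℝ) *
      (if M.active i z = true then 1 else 0)))
    - M.intrusionCost s d
  γ := M.γ
  γ_nonneg := M.γ_nonneg
  γ_lt_one := M.γ_lt_one
  initD := stdSimplex.vertex z
  initA := μ

/-- The node subgame. -/
def nodeGame (M : Model V W Zn AD AA O) (i : V) : Game Zn NodeAttState AD AA O :=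
  M.nodeGameFrom i (M.zone₁ i) (stdSimplex.vertex (false, false))

/-- Functions on the nodes are families of functions on the nodes of the workflows. -/
def fiberEquiv (M : Model V W Zn AD AA O) (X : Type) :
    (V → X) ≃ ∀ w : W, M.WNode w → X where
  toFun f _ i := f i.1
  invFun g i := g (M.wf i) ⟨i, rfl⟩
  left_inv _ := rfl
  right_inv g := by
    funext w ⟨i, hi⟩
    subst hi
    rfl

/-- `Γ` splits into the workflow subgames. -/
def workflowSplit (M : Model V W Zn AD AA O) :
    Split (V → Zn) (V → NodeAttState) (V → AD) (V → AA) (V → O)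
      (fun w => M.WNode w → Zn) (fun w => M.WNode w → NodeAttState) (fun w => M.WNode w → AD)
      (fun w => M.WNode w → AA) (fun w => M.WNode w → O) where
  sD := M.fiberEquiv Zn
  sA := M.fiberEquiv NodeAttState
  aD := M.fiberEquiv AD
  aA := M.fiberEquiv AA
  o := M.fiberEquiv O

/-- A workflow subgame splits into node subgames. -/
def nodeSplit (M : Model V W Zn AD AA O) (w : W) :
    Split (M.WNode w → Zn) (M.WNode w → NodeAttState) (M.WNode w → AD) (M.WNode w → AA)
      (M.WNode w → O) (fun _ : M.WNode w => Zn) (fun _ => NodeAttState) (fun _ => AD)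
      (fun _ => AA) (fun _ => O) where
  sD := Equiv.refl _
  sA := Equiv.refl _
  aD := Equiv.refl _
  aA := Equiv.refl _
  o := Equiv.refl _

/-! ### Beliefs and switching curves -/

/-- The observation distributions of node `i` are totally positive of order 2 in the attacker
state and the observation. -/
def TP2 [LinearOrder O] (M : Model V W Zn AD AA O) (i : V) : Prop :=
  ∀ (z : Zn) (k l : Fin 3) (o o' : O), k ≤ l → o ≤ o' →
    M.Z i z (level k) o' * M.Z i z (level l) o ≤ M.Z i z (level k) o * M.Z i z (level l) o'

/-- Stationary attacker strategies, which depend only on the attacker state of the node. -/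
def stationary (σ : NodeAttState → FinDist AA) : Strategy NodeAttState AA O :=
  fun _ h => σ h.last

/-- The defender's unnormalized posterior of the attacker state of node `i`, for the prior `μ` and
the stationary attacker strategy `σ`. -/
def filter (M : Model V W Zn AD AA O) (i : V) (σ : NodeAttState → FinDist AA)
    (μ : FinDist NodeAttState) : ∀ {n : ℕ}, Hist Zn AD O n → NodeAttState → ℝ
  | 0, (z, o) => fun s => μ s * M.Z i z s o
  | _ + 1, (h, d, z, o) => fun s' =>
      (∑ s, ∑ a, filter M i σ μ h s * σ s a * M.fA i s a d s') * M.Z i z s' o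

/-- The defender's belief about the attacker state of node `i`, as a vector of probabilities of the
three levels. -/
def belief (M : Model V W Zn AD AA O) (i : V) (σ : NodeAttState → FinDist AA)
    (μ : FinDist NodeAttState) {n : ℕ} (h : Hist Zn AD O n) : Fin 3 → ℝ :=
  fun k => M.filter i σ μ h (level k) / ∑ s, M.filter i σ μ h s

open Classical in
/-- Stopping rule: whenever the belief lies in the stopping set of the current zone, take the
defensive action `act` of the current zone; otherwise take the null action. -/
def stoppingStrategy (M : Model V W Zn AD AA O) (i : V) (σ : NodeAttState → FinDist AA)
    (μ : FinDist NodeAttState) (act : Zn → AD) (stopSet : Zn → Set (Fin 3 → ℝ)) : Strategy Zn AD O :=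
  fun _ h => if M.belief i σ μ h ∈ stopSet h.last
    then stdSimplex.vertex (act h.last) else stdSimplex.vertex M.nullD

end Model

/-- The point at `ε` on the line segment in the belief simplex from `e₁ = (1, 0, 0)` to the point
`(0, 1 - x, x)` of the opposite side. -/
def ray (x ε : ℝ) : Fin 3 → ℝ := ![1 - ε, ε * (1 - x), ε * x]

/-- The set `S` is bounded in the belief simplex by the switching curve `x ↦ ray x (c x)`: each line
segment from `e₁` to the opposite side enters `S` at the curve and stays in `S` from there on (`c x`
is greater than `1` if the segment misses `S`), the curve is continuous, and both `S` and its
complement are connected. -/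
def HasSwitchingCurve (S : Set (Fin 3 → ℝ)) (c : ℝ → ℝ) : Prop :=
  S ⊆ stdSimplex ℝ (Fin 3) ∧
  (∀ x ∈ Set.Icc (0 : ℝ) 1, ∀ ε ∈ Set.Icc (0 : ℝ) 1, ray x ε ∈ S ↔ c x ≤ ε) ∧
  ContinuousOn c {x | x ∈ Set.Icc (0 : ℝ) 1 ∧ c x ≤ 1} ∧
  IsPreconnected S ∧ IsPreconnected (stdSimplex ℝ (Fin 3) \ S)

end IntrusionResponse

end

open IntrusionResponse

noncomputable section

namespace IntrusionResponse

open Finset Filter Topology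

/-! ### One-player control problems on histories -/

/-! Against a fixed strategy of the opponent, a player faces a control problem on its own histories:
`prob_eq` writes the probability of a play as the weights of the two players' actions times a chance
factor, and summing over what the player does not see gives each history a mass and an expected
reward. Behaviour strategies form a compact product of simplices on which the discounted value is
continuous, so best responses exist.

For (A) and (B), suppose that the game splits and the opponent plays independently. Chance and the
opponent's weight then factor, and the control problem is a product (`isProduct_defenderProblem`,
`isProduct_attackerProblem`). A strategy of the product may correlate the components, but for
component `k` the histories of the others are mere private randomization: the conditional
distribution of action `k` given history `k` earns the same in component `k` (`stage_marginal`).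
Every value in the product is thus a sum of values in the components, and best responses solve a
separable optimization problem. In the intrusion game, transitions and observations are products
over nodes by construction. The utility needs an argument: counting the pairs of an active node and
one of its ancestors in two ways turns subtree sizes into numbers of ancestors.

For (C), the attacker state is a hidden Markov chain on three levels, and values are functions of
the unnormalized posterior `m`. They are sublinear, Lipschitz and, per unit of mass, decreasing in
the monotone likelihood ratio order (`IsValueLike`). The Bellman operator preserves this: the
transition matrix of the null action is totally positive, and so are the observations by hypothesis
(`mlr_transition`, `comp_observation`). A defensive action erases the posterior, so the ranking of
defensive actions depends on the zone only (`actionValue_reset`), and the gain of the null action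
over the best of them is again value-like (`exists_isValueLike_gain`).

The stopping set consists of the beliefs with nonpositive gain. Sublinearity makes it convex; since
beliefs increase in the order along segments from `e₁`, a segment that has entered the set stays
there. This yields the curve, its continuity and the connectedness of both sides
(`hasSwitchingCurve`). Optimality among all strategies follows from the verification theorem
`value_le_of_bellman`, with the value of the posterior as Bellman function. -/

open Classical in
/-- The indicator of a proposition. -/
def ind (p : Prop) : ℝ := if p then 1 else 0

theorem ind_pos {p : Prop} (h : p) : ind p = 1 := if_pos h

theorem ind_neg {p : Prop} (h : ¬p) : ind p = 0 := if_neg h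

theorem ind_nonneg (p : Prop) : 0 ≤ ind p := by
  by_cases h : p
  · simp [ind_pos h]
  · simp [ind_neg h]

theorem ind_and (p q : Prop) : ind (p ∧ q) = ind p * ind q := by
  by_cases h : p <;> by_cases h' : q <;> simp [ind, h, h']

theorem ind_forall {K : Type} [Fintype K] (p : K → Prop) : ind (∀ k, p k) = ∏ k, ind (p k) := by
  by_cases h : ∀ k, p k
  · rw [ind_pos h, prod_eq_one fun k _ => ind_pos (h k)]
  · rw [ind_neg h]
    push Not at h
    obtain ⟨k, hk⟩ := h
    exact (prod_eq_zero (mem_univ k) (ind_neg hk)).symm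

theorem sum_ind_mul {α : Type} [Fintype α] (a : α) (f : α → ℝ) :
    ∑ b, ind (a = b) * f b = f a := by
  rw [sum_eq_single a (fun b _ hb => by rw [ind_neg hb.symm, zero_mul]) (by simp), ind_pos rfl,
    one_mul]

theorem sum_ind {α : Type} [Fintype α] (a : α) : ∑ b, ind (a = b) = 1 := by
  simpa using sum_ind_mul a fun _ => 1

theorem sum_ind_symm {α : Type} [Fintype α] (a : α) : ∑ b, ind (b = a) = 1 := by
  simpa only [eq_comm] using sum_ind a

namespace Hist

/-- Append an action, a state and an observation to a history. -/
def snoc {S A O : Type} {n : ℕ} (h : Hist S A O n) (a : A) (s : S) (o : O) : Hist S A O (n + 1) :=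
  (h, a, s, o)

theorem exists_eq_snoc {S A O : Type} {n : ℕ} (h : Hist S A O (n + 1)) :
    ∃ (h' : Hist S A O n) (a : A) (s : S) (o : O), h = h'.snoc a s o :=
  match h with
  | (h', a, s, o) => ⟨h', a, s, o, rfl⟩

theorem snoc_inj {S A O : Type} {n : ℕ} {h h' : Hist S A O n} {a a' : A} {s s' : S} {o o' : O} :
    h.snoc a s o = h'.snoc a' s' o' ↔ h = h' ∧ a = a' ∧ s = s' ∧ o = o' :=
  Prod.ext_iff.trans (and_congr_right fun _ => Prod.ext_iff.trans
    (and_congr_right fun _ => Prod.ext_iff))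

theorem last_snoc {S A O : Type} {n : ℕ} (h : Hist S A O n) (a : A) (s : S) (o : O) :
    (h.snoc a s o).last = s := rfl

/-- The history that consists of a state and an observation. -/
def single {S A O : Type} (s : S) (o : O) : Hist S A O 0 := (s, o)

theorem exists_eq_single {S A O : Type} (h : Hist S A O 0) : ∃ s o, h = single s o :=
  match h with
  | (s, o) => ⟨s, o, rfl⟩

theorem single_inj {S A O : Type} {s s' : S} {o o' : O} :
    (single s o : Hist S A O 0) = single s' o' ↔ s = s' ∧ o = o' := Prod.ext_iff

theorem last_single {S A O : Type} (s : S) (o : O) : (single s o : Hist S A O 0).last = s := rfl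

theorem map_single {S A O S' A' O' : Type} (f : S → S') (g : A → A') (k : O → O') (s : S) (o : O) :
    (single s o : Hist S A O 0).map f g k = single (f s) (k o) := rfl

variable {S A O : Type} [Fintype S] [Fintype A] [Fintype O]

theorem sum_zero (f : Hist S A O 0 → ℝ) : ∑ h, f h = ∑ s, ∑ o, f (single s o) :=
  Fintype.sum_prod_type (f := fun x : S × O => f x)

theorem sum_succ {n : ℕ} (f : Hist S A O (n + 1) → ℝ) :
    ∑ h, f h = ∑ h : Hist S A O n, ∑ a, ∑ s, ∑ o, f (h.snoc a s o) := by
  have h1 : ∑ h, f h = ∑ h : Hist S A O n, ∑ x : A × S × O, f (h, x) :=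
    Fintype.sum_prod_type (f := fun x : Hist S A O n × A × S × O => f x)
  rw [h1]
  refine sum_congr rfl fun h _ => ?_
  rw [Fintype.sum_prod_type]
  refine sum_congr rfl fun a _ => ?_
  rw [Fintype.sum_prod_type]
  rfl

end Hist

theorem FinDist.sum_eq_one {α : Type} [Fintype α] (p : FinDist α) : ∑ a, p a = 1 := p.2.2

theorem FinDist.nonneg {α : Type} [Fintype α] (p : FinDist α) (a : α) : 0 ≤ p a := p.2.1 a

/-! ### The compact space of behaviour strategies -/

namespace Strategy

variable {S A O : Type} [Fintype A]

/-- The contribution of a strategy to the probability of a history: the product of the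
probabilities of the actions taken. -/
def weight (π : Strategy S A O) : ∀ {n : ℕ}, Hist S A O n → ℝ
  | 0, _ => 1
  | n + 1, (h, a, _, _) => weight π (n := n) h * π n h a

theorem weight_zero (π : Strategy S A O) (h : Hist S A O 0) : weight π h = 1 := rfl

theorem weight_succ (π : Strategy S A O) {n : ℕ} (h : Hist S A O n) (a : A) (s : S) (o : O) :
    weight π (h.snoc a s o) = weight π h * π n h a := rfl

theorem weight_nonneg (π : Strategy S A O) : ∀ {n : ℕ} (h : Hist S A O n), 0 ≤ weight π h
  | 0, _ => zero_le_one
  | _ + 1, (h, a, _, _) => mul_nonneg (weight_nonneg π h) (FinDist.nonneg _ a)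

theorem continuous_apply (n : ℕ) (h : Hist S A O n) (a : A) :
    Continuous fun π : Strategy S A O => π n h a := by
  have h1 : Continuous fun π : Strategy S A O => π n h := by fun_prop
  exact (_root_.continuous_apply a).comp (continuous_subtype_val.comp h1)

theorem continuous_weight : ∀ {n : ℕ} (h : Hist S A O n),
    Continuous fun π : Strategy S A O => weight π h
  | 0, _ => continuous_const
  | n + 1, (h, a, _, _) => (continuous_weight h).mul (continuous_apply n h a)

/-- The strategies that only use actions in `C s` in state `s`. -/
def Uses (C : S → Set A) (π : Strategy S A O) : Prop :=
  ∀ n (h : Hist S A O n) (a : A), π n h a ≠ 0 → a ∈ C h.last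

theorem uses_iff (C : S → Set A) (π : Strategy S A O) :
    Uses C π ↔ ∀ n (h : Hist S A O n) (a : A), a ∉ C h.last → π n h a = 0 :=
  forall_congr' fun _ => forall_congr' fun _ => forall_congr' fun _ => by
    rw [not_imp_comm]

/-- All strategies form a product of simplices, compact by Tychonoff, and each forbidden action at
each history imposes a closed condition. -/
theorem isCompact_uses (C : S → Set A) : IsCompact {π : Strategy S A O | Uses C π} := by
  apply IsClosed.isCompact
  have : {π : Strategy S A O | Uses C π} =
      ⋂ (n : ℕ) (h : Hist S A O n) (a : A) (_ : a ∉ C h.last), {π | π n h a = 0} := by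
    ext π
    simp only [Set.mem_ofPred_eq, uses_iff, Set.mem_iInter]
  rw [this]
  refine isClosed_iInter fun n => isClosed_iInter fun h => isClosed_iInter fun a =>
    isClosed_iInter fun _ => ?_
  exact isClosed_singleton.preimage (continuous_apply n h a)

open Classical in
/-- A strategy that plays a fixed action in each state. -/
def const (f : S → A) : Strategy S A O := fun _ h => stdSimplex.vertex (f h.last)

theorem uses_const (C : S → Set A) {f : S → A} (hf : ∀ s, f s ∈ C s) :
    Uses C (const f : Strategy S A O) := by
  classical
  intro n h a ha
  have : a = f h.last := by
    by_contra hne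
    exact ha (by simp [const, stdSimplex.vertex, hne])
  exact this ▸ hf _

end Strategy

open Strategy

/-- A control problem of one player who sees states in `S` and observations in `O`, in terms of
histories. `mass n h` is the probability that the states and observations of `h` occur if the
actions of `h` are taken, and `reward n h a` is the expected reward in stage `n` for the action `a`,
multiplied by `mass n h`. -/
structure ControlProblem (S A O : Type) [Fintype S] [Fintype A] [Fintype O] where
  mass : ∀ n, Hist S A O n → ℝ
  mass_nonneg : ∀ n h, 0 ≤ mass n h
  sum_mass_zero : ∑ h, mass 0 h = 1
  sum_mass_succ : ∀ n h a, ∑ s, ∑ o, mass (n + 1) (h.snoc a s o) = mass n h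
  reward : ∀ n, Hist S A O n → A → ℝ
  bound : ℝ
  abs_reward_le : ∀ n h a, |reward n h a| ≤ bound * mass n h
  γ : ℝ
  γ_nonneg : 0 ≤ γ
  γ_lt_one : γ < 1

namespace ControlProblem

variable {S A O : Type} [Fintype S] [Fintype A] [Fintype O]

/-- Expected reward in stage `n`. -/
def stage (P : ControlProblem S A O) (π : Strategy S A O) (n : ℕ) : ℝ :=
  ∑ h : Hist S A O n, ∑ a, weight π h * π n h a * P.reward n h a

/-- Expected discounted reward. -/
def value (P : ControlProblem S A O) (π : Strategy S A O) : ℝ :=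
  ∑' n, P.γ ^ n * P.stage π n

/-- Weight times mass is the probability of a history. This normalization bounds the stage rewards
and later lets the other components of a product be summed out. -/
theorem sum_weight_mul_mass (P : ControlProblem S A O) (π : Strategy S A O) (n : ℕ) :
    ∑ h : Hist S A O n, weight π h * P.mass n h = 1 := by
  induction n with
  | zero => simp only [weight_zero, one_mul, P.sum_mass_zero]
  | succ n ih =>
    rw [← ih, Hist.sum_succ]
    refine sum_congr rfl fun h _ => ?_
    simp only [weight_succ, ← mul_sum, P.sum_mass_succ]
    rw [← sum_mul, ← mul_sum, FinDist.sum_eq_one, mul_one]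

theorem abs_stage_le (P : ControlProblem S A O) (π : Strategy S A O) (n : ℕ) :
    |P.stage π n| ≤ P.bound := by
  calc |P.stage π n|
      ≤ ∑ h : Hist S A O n, ∑ a, weight π h * π n h a * (P.bound * P.mass n h) := by
        refine (abs_sum_le_sum_abs _ _).trans (sum_le_sum fun h _ => ?_)
        refine (abs_sum_le_sum_abs _ _).trans (sum_le_sum fun a _ => ?_)
        have h0 : 0 ≤ weight π h * π n h a := mul_nonneg (weight_nonneg π h) (FinDist.nonneg _ _)
        rw [abs_mul, abs_of_nonneg h0]
        exact mul_le_mul_of_nonneg_left (P.abs_reward_le n h a) h0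
    _ = P.bound * ∑ h : Hist S A O n, weight π h * P.mass n h := by
        rw [mul_sum]
        refine sum_congr rfl fun h _ => ?_
        rw [← sum_mul, ← mul_sum, FinDist.sum_eq_one]
        ring
    _ = P.bound := by rw [P.sum_weight_mul_mass, mul_one]

theorem abs_discounted_stage_le (P : ControlProblem S A O) (π : Strategy S A O) (n : ℕ) :
    ‖P.γ ^ n * P.stage π n‖ ≤ P.γ ^ n * P.bound := by
  rw [Real.norm_eq_abs, abs_mul, abs_of_nonneg (pow_nonneg P.γ_nonneg n)]
  exact mul_le_mul_of_nonneg_left (P.abs_stage_le π n) (pow_nonneg P.γ_nonneg n)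

theorem summable_bound (P : ControlProblem S A O) : Summable fun n => P.γ ^ n * P.bound :=
  (summable_geometric_of_lt_one P.γ_nonneg P.γ_lt_one).mul_right _

theorem summable_stage (P : ControlProblem S A O) (π : Strategy S A O) :
    Summable fun n => P.γ ^ n * P.stage π n :=
  P.summable_bound.of_norm_bounded (P.abs_discounted_stage_le π)

/-- Each stage is a polynomial in finitely many action probabilities, and the geometric bound on the
stages is uniform in the strategy. -/
theorem continuous_value (P : ControlProblem S A O) : Continuous P.value := by
  refine continuous_tsum (fun n => ?_) P.summable_bound fun n π => P.abs_discounted_stage_le π n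
  refine continuous_const.mul ?_
  refine continuous_finsetSum _ fun h _ => continuous_finsetSum _ fun a _ => ?_
  exact ((continuous_weight h).mul (Strategy.continuous_apply n h a)).mul continuous_const

theorem exists_maximizer (P : ControlProblem S A O) {C : S → Set A} (hC : ∀ s, (C s).Nonempty) :
    ∃ π, Uses C π ∧ ∀ π', Uses C π' → P.value π' ≤ P.value π := by
  choose f hf using hC
  exact (isCompact_uses C).exists_isMaxOn ⟨_, uses_const C hf⟩ P.continuous_value.continuousOn

theorem exists_minimizer (P : ControlProblem S A O) {C : S → Set A} (hC : ∀ s, (C s).Nonempty) :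
    ∃ π, Uses C π ∧ ∀ π', Uses C π' → P.value π ≤ P.value π' := by
  choose f hf using hC
  exact (isCompact_uses C).exists_isMinOn ⟨_, uses_const C hf⟩ P.continuous_value.continuousOn

/-! ### The Bellman verification argument -/

/-- If `J` satisfies the Bellman inequality, it bounds the partial sums of the value. -/
theorem partial_sum_le (P : ControlProblem S A O) {J : ∀ n, Hist S A O n → ℝ}
    (hJ : ∀ n h a, P.reward n h a + P.γ * ∑ s, ∑ o, J (n + 1) (h.snoc a s o) ≤ J n h)
    (π : Strategy S A O) (N : ℕ) :
    ∑ n ∈ range N, P.γ ^ n * P.stage π n + P.γ ^ N * ∑ h : Hist S A O N, weight π h * J N h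
      ≤ ∑ h, J 0 h := by
  induction N with
  | zero => simp [weight_zero]
  | succ N ih =>
    refine le_trans ?_ ih
    -- What remains compares consecutive horizons: stage `N` plus the discounted `J (N + 1)` against
    -- `J N`. It is the Bellman inequality averaged over histories and actions.
    rw [sum_range_succ, add_assoc]
    gcongr
    rw [pow_succ, mul_assoc, ← mul_add]
    refine mul_le_mul_of_nonneg_left ?_ (pow_nonneg P.γ_nonneg N)
    rw [Hist.sum_succ, stage, mul_sum, ← sum_add_distrib]
    refine sum_le_sum fun h _ => ?_
    calc _ = ∑ a, weight π h * π N h a *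
          (P.reward N h a + P.γ * ∑ s, ∑ o, J (N + 1) (h.snoc a s o)) := by
          rw [mul_sum, ← sum_add_distrib]
          refine sum_congr rfl fun a _ => ?_
          simp only [weight_succ, ← mul_sum]
          ring
      _ ≤ ∑ a, weight π h * π N h a * J N h :=
          sum_le_sum fun a _ => mul_le_mul_of_nonneg_left (hJ N h a)
            (mul_nonneg (weight_nonneg π h) (FinDist.nonneg _ _))
      _ = _ := by rw [← sum_mul, ← mul_sum, FinDist.sum_eq_one, mul_one]

/-- If the strategy `π` attains equality in the Bellman equation, the partial sums of its value are
known. -/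
theorem partial_sum_eq (P : ControlProblem S A O) {J : ∀ n, Hist S A O n → ℝ}
    {π : Strategy S A O}
    (hJ : ∀ n h a, π n h a ≠ 0 →
      P.reward n h a + P.γ * ∑ s, ∑ o, J (n + 1) (h.snoc a s o) = J n h) (N : ℕ) :
    ∑ n ∈ range N, P.γ ^ n * P.stage π n + P.γ ^ N * ∑ h : Hist S A O N, weight π h * J N h
      = ∑ h, J 0 h := by
  induction N with
  | zero => simp [weight_zero]
  | succ N ih =>
    rw [← ih, sum_range_succ, add_assoc]
    congr 1
    rw [pow_succ, mul_assoc, ← mul_add]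
    congr 1
    rw [Hist.sum_succ, stage, mul_sum, ← sum_add_distrib]
    refine sum_congr rfl fun h _ => ?_
    calc _ = ∑ a, weight π h * π N h a *
          (P.reward N h a + P.γ * ∑ s, ∑ o, J (N + 1) (h.snoc a s o)) := by
          rw [mul_sum, ← sum_add_distrib]
          refine sum_congr rfl fun a _ => ?_
          simp only [weight_succ, ← mul_sum]
          ring
      _ = ∑ a, weight π h * π N h a * J N h := by
          refine sum_congr rfl fun a _ => ?_
          by_cases ha : π N h a = 0
          · simp [ha]
          · rw [hJ N h a ha]
      _ = _ := by rw [← sum_mul, ← mul_sum, FinDist.sum_eq_one, mul_one]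

/-- Domination by the mass makes the average of `J N` at most `B` in absolute value, so the discount
factor kills the terminal term. -/
theorem tendsto_partial_sum (P : ControlProblem S A O) {J : ∀ n, Hist S A O n → ℝ} {B : ℝ}
    (hB : ∀ n h, |J n h| ≤ B * P.mass n h) (π : Strategy S A O) :
    Tendsto (fun N => ∑ n ∈ range N, P.γ ^ n * P.stage π n
      + P.γ ^ N * ∑ h : Hist S A O N, weight π h * J N h) atTop (𝓝 (P.value π)) := by
  have h1 := (P.summable_stage π).hasSum.tendsto_sum_nat
  have h2 : Tendsto (fun N => P.γ ^ N * ∑ h : Hist S A O N, weight π h * J N h) atTop (𝓝 0) := by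
    have h3 : Tendsto (fun N => P.γ ^ N * B) atTop (𝓝 0) := by
      simpa using (tendsto_pow_atTop_nhds_zero_of_lt_one P.γ_nonneg P.γ_lt_one).mul_const B
    refine squeeze_zero_norm (fun N => ?_) h3
    rw [Real.norm_eq_abs, abs_mul, abs_of_nonneg (pow_nonneg P.γ_nonneg N)]
    refine mul_le_mul_of_nonneg_left ?_ (pow_nonneg P.γ_nonneg N)
    calc |∑ h : Hist S A O N, weight π h * J N h|
        ≤ ∑ h : Hist S A O N, weight π h * (B * P.mass N h) := by
          refine (abs_sum_le_sum_abs _ _).trans (sum_le_sum fun h _ => ?_)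
          rw [abs_mul, abs_of_nonneg (weight_nonneg π h)]
          exact mul_le_mul_of_nonneg_left (hB N h) (weight_nonneg π h)
      _ = B * ∑ h : Hist S A O N, weight π h * P.mass N h := by
          rw [mul_sum]
          exact sum_congr rfl fun h _ => by ring
      _ = B := by rw [P.sum_weight_mul_mass, mul_one]
  simpa [value] using h1.add h2

/-- Verification theorem: a strategy that uses only maximizers of the Bellman equation is
optimal. -/
theorem value_le_of_bellman (P : ControlProblem S A O) {J : ∀ n, Hist S A O n → ℝ} {B : ℝ}
    (hB : ∀ n h, |J n h| ≤ B * P.mass n h)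
    (hJ : ∀ n h a, P.reward n h a + P.γ * ∑ s, ∑ o, J (n + 1) (h.snoc a s o) ≤ J n h)
    {π : Strategy S A O}
    (hπ : ∀ n h a, π n h a ≠ 0 →
      P.reward n h a + P.γ * ∑ s, ∑ o, J (n + 1) (h.snoc a s o) = J n h)
    (π' : Strategy S A O) : P.value π' ≤ P.value π := by
  have h1 : P.value π' ≤ ∑ h, J 0 h :=
    le_of_tendsto' (P.tendsto_partial_sum hB π') (P.partial_sum_le hJ π')
  have h2 : P.value π = ∑ h, J 0 h := by
    refine tendsto_nhds_unique (P.tendsto_partial_sum hB π) ?_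
    simp only [P.partial_sum_eq hπ]
    exact tendsto_const_nhds
  rw [h2]
  exact h1

end ControlProblem

end IntrusionResponse

end

noncomputable section

namespace IntrusionResponse

open Finset Filter Topology Strategy

/-! ### Products of control problems -/

namespace Hist

theorem map_map {S A O S' A' O' S'' A'' O'' : Type} (f : S → S') (g : A → A') (k : O → O')
    (f' : S' → S'') (g' : A' → A'') (k' : O' → O'') : ∀ {n : ℕ} (h : Hist S A O n),
    (h.map f g k).map f' g' k' = h.map (f' ∘ f) (g' ∘ g) (k' ∘ k)
  | 0, _ => rfl
  | n + 1, (h, a, s, o) =>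
    congrArg (fun x : Hist S'' A'' O'' n =>
      ((x, g' (g a), f' (f s), k' (k o)) : Hist S'' A'' O'' (n + 1))) (map_map f g k f' g' k' h)

theorem last_map {S A O S' A' O' : Type} (f : S → S') (g : A → A') (k : O → O') :
    ∀ {n : ℕ} (h : Hist S A O n), (h.map f g k).last = f h.last
  | 0, _ => rfl
  | _ + 1, _ => rfl

variable {S A O : Type} {K : Type} {S' A' O' : K → Type}

/-- Assemble a history of a product from its components. -/
def unsplit (eS : S ≃ ∀ k, S' k) (eA : A ≃ ∀ k, A' k) (eO : O ≃ ∀ k, O' k) :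
    ∀ n : ℕ, (∀ k, Hist (S' k) (A' k) (O' k) n) → Hist S A O n
  | 0, g => (eS.symm fun k => (g k).1, eO.symm fun k => (g k).2)
  | n + 1, g => (unsplit eS eA eO n fun k => (g k).1,
      eA.symm fun k => (g k).2.1, eS.symm fun k => (g k).2.2.1, eO.symm fun k => (g k).2.2.2)

theorem unsplit_map (eS : S ≃ ∀ k, S' k) (eA : A ≃ ∀ k, A' k) (eO : O ≃ ∀ k, O' k) :
    ∀ (n : ℕ) (h : Hist S A O n),
      unsplit eS eA eO n (fun k => h.map (eS · k) (eA · k) (eO · k)) = h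
  | 0, _ => Prod.ext (eS.symm_apply_apply _) (eO.symm_apply_apply _)
  | n + 1, (h, _, _, _) => Prod.ext (unsplit_map eS eA eO n h)
      (Prod.ext (eA.symm_apply_apply _) (Prod.ext (eS.symm_apply_apply _) (eO.symm_apply_apply _)))

theorem map_unsplit (eS : S ≃ ∀ k, S' k) (eA : A ≃ ∀ k, A' k) (eO : O ≃ ∀ k, O' k) :
    ∀ (n : ℕ) (g : ∀ k, Hist (S' k) (A' k) (O' k) n) (k : K),
      (unsplit eS eA eO n g).map (eS · k) (eA · k) (eO · k) = g k
  | 0, g, k => Prod.ext (congrFun (eS.apply_symm_apply fun k => (g k).1) k)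
      (congrFun (eO.apply_symm_apply fun k => (g k).2) k)
  | n + 1, g, k => Prod.ext (map_unsplit eS eA eO n (fun k => (g k).1) k)
      (Prod.ext (congrFun (eA.apply_symm_apply fun k => (g k).2.1) k)
        (Prod.ext (congrFun (eS.apply_symm_apply fun k => (g k).2.2.1) k)
          (congrFun (eO.apply_symm_apply fun k => (g k).2.2.2) k)))

/-- Histories of a product are families of histories. -/
def piEquiv (eS : S ≃ ∀ k, S' k) (eA : A ≃ ∀ k, A' k) (eO : O ≃ ∀ k, O' k) (n : ℕ) :
    Hist S A O n ≃ ∀ k, Hist (S' k) (A' k) (O' k) n where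
  toFun h k := h.map (eS · k) (eA · k) (eO · k)
  invFun := unsplit eS eA eO n
  left_inv := unsplit_map eS eA eO n
  right_inv g := funext (map_unsplit eS eA eO n g)

theorem piEquiv_apply (eS : S ≃ ∀ k, S' k) (eA : A ≃ ∀ k, A' k) (eO : O ≃ ∀ k, O' k)
    {n : ℕ} (h : Hist S A O n) (k : K) :
    piEquiv eS eA eO n h k = h.map (eS · k) (eA · k) (eO · k) := rfl

theorem piEquiv_snoc (eS : S ≃ ∀ k, S' k) (eA : A ≃ ∀ k, A' k) (eO : O ≃ ∀ k, O' k)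
    {n : ℕ} (h : Hist S A O n) (a : A) (s : S) (o : O) (k : K) :
    piEquiv eS eA eO (n + 1) (h.snoc a s o) k
      = (piEquiv eS eA eO n h k).snoc (eA a k) (eS s k) (eO o k) := rfl

end Hist

/-- A sum over a product of products is a product of sums. -/
theorem sum_prod_equiv {α K : Type} [Fintype α] [Fintype K] [DecidableEq K] {β : K → Type}
    [∀ k, Fintype (β k)] (e : α ≃ ∀ k, β k) (f : ∀ k, β k → ℝ) :
    ∑ a, ∏ k, f k (e a k) = ∏ k, ∑ b, f k b := by
  rw [Fintype.prod_sum]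
  exact Fintype.sum_equiv e _ _ fun _ => rfl

/-- The sum of a function of one coordinate times a product of functions of the others. -/
theorem sum_mul_prod_erase_equiv {α K : Type} [Fintype α] [Fintype K] [DecidableEq K]
    {β : K → Type} [∀ k, Fintype (β k)] (e : α ≃ ∀ k, β k) (k : K) (φ : β k → ℝ)
    (f : ∀ k, β k → ℝ) :
    ∑ a, φ (e a k) * ∏ j ∈ univ.erase k, f j (e a j)
      = (∑ b, φ b) * ∏ j ∈ univ.erase k, ∑ b, f j b := by
  -- Putting `φ` in the place of the factor `k` makes the summand a full product over the
  -- coordinates.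
  have h1 : ∀ a, φ (e a k) * ∏ j ∈ univ.erase k, f j (e a j)
      = ∏ j, Function.update f k φ j (e a j) := by
    intro a
    rw [← mul_prod_erase univ _ (mem_univ k), Function.update_self]
    congr 1
    exact prod_congr rfl fun j hj => by rw [Function.update_of_ne (ne_of_mem_erase hj)]
  rw [sum_congr rfl fun a _ => h1 a, sum_prod_equiv e, ← mul_prod_erase univ _ (mem_univ k),
    Function.update_self]
  congr 1
  exact prod_congr rfl fun j hj => by rw [Function.update_of_ne (ne_of_mem_erase hj)]

namespace Strategy

variable {S A O : Type} [Fintype A] {K : Type} {S' A' O' : K → Type} [∀ k, Fintype (A' k)]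
  [Fintype K] [DecidableEq K]

/-- The strategy that plays independently in the components of a product. -/
def combine (eS : S ≃ ∀ k, S' k) (eA : A ≃ ∀ k, A' k) (eO : O ≃ ∀ k, O' k)
    (π : ∀ k, Strategy (S' k) (A' k) (O' k)) : Strategy S A O := fun n h =>
  FinDist.prod eA fun k => π k n (h.map (eS · k) (eA · k) (eO · k))

variable {eS : S ≃ ∀ k, S' k} {eA : A ≃ ∀ k, A' k} {eO : O ≃ ∀ k, O' k}

theorem combine_apply (π : ∀ k, Strategy (S' k) (A' k) (O' k)) {n : ℕ} (h : Hist S A O n)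
    (a : A) : combine eS eA eO π n h a = ∏ k, π k n (Hist.piEquiv eS eA eO n h k) (eA a k) := by
  rfl

theorem weight_combine (π : ∀ k, Strategy (S' k) (A' k) (O' k)) : ∀ {n : ℕ} (h : Hist S A O n),
    weight (combine eS eA eO π) h = ∏ k, weight (π k) (Hist.piEquiv eS eA eO n h k)
  | 0, h => by simp [weight_zero]
  | n + 1, h => by
    obtain ⟨h, a, s, o, rfl⟩ := h.exists_eq_snoc
    rw [weight_succ, weight_combine π h, combine_apply, ← prod_mul_distrib]
    rfl

theorem uses_combine {C : S → Set A} {C' : ∀ k, S' k → Set (A' k)}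
    (hC : ∀ s a, a ∈ C s ↔ ∀ k, eA a k ∈ C' k (eS s k))
    {π : ∀ k, Strategy (S' k) (A' k) (O' k)} (hπ : ∀ k, Uses (C' k) (π k)) :
    Uses C (combine eS eA eO π) := by
  intro n h a ha
  rw [hC]
  intro k
  rw [combine_apply, prod_ne_zero_iff] at ha
  have := hπ k n _ _ (ha k (mem_univ k))
  rwa [Hist.piEquiv_apply, Hist.last_map] at this

end Strategy

namespace ControlProblem

variable {S A O : Type} [Fintype S] [Fintype A] [Fintype O]
  {K : Type} {S' A' O' : K → Type} [∀ k, Fintype (S' k)] [∀ k, Fintype (A' k)]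
  [∀ k, Fintype (O' k)] [Fintype K] [DecidableEq K]

/-- The expected reward of component `k` in stage `n` of a product problem. -/
def componentStage (eS : S ≃ ∀ k, S' k) (eA : A ≃ ∀ k, A' k) (eO : O ≃ ∀ k, O' k)
    (P : ∀ k, ControlProblem (S' k) (A' k) (O' k)) (π : Strategy S A O) (k : K) (n : ℕ) : ℝ :=
  ∑ h : Hist S A O n, ∑ a, weight π h * π n h a *
    ((P k).reward n (Hist.piEquiv eS eA eO n h k) (eA a k) *
      ∏ j ∈ univ.erase k, (P j).mass n (Hist.piEquiv eS eA eO n h j))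

/-! ### Marginals of a strategy of a product problem -/

section Marginal

variable (eS : S ≃ ∀ k, S' k) (eA : A ≃ ∀ k, A' k) (eO : O ≃ ∀ k, O' k)
  (P : ∀ k, ControlProblem (S' k) (A' k) (O' k)) (π : Strategy S A O) (k : K)

/-- The weight that a strategy of a product problem gives to a history of component `k`. -/
def marginalWeight {n : ℕ} (h' : Hist (S' k) (A' k) (O' k) n) : ℝ :=
  ∑ h : Hist S A O n, weight π h * (ind (Hist.piEquiv eS eA eO n h k = h') *
    ∏ j ∈ univ.erase k, (P j).mass n (Hist.piEquiv eS eA eO n h j))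

/-- The weight that a strategy of a product problem gives to a history of component `k` followed by
an action. -/
def marginalActionWeight {n : ℕ} (h' : Hist (S' k) (A' k) (O' k) n) (a' : A' k) : ℝ :=
  ∑ h : Hist S A O n, ∑ a, weight π h * π n h a * (ind (eA a k = a') *
    (ind (Hist.piEquiv eS eA eO n h k = h') *
    ∏ j ∈ univ.erase k, (P j).mass n (Hist.piEquiv eS eA eO n h j)))

theorem marginalActionWeight_nonneg {n : ℕ} (h' : Hist (S' k) (A' k) (O' k) n) (a' : A' k) :
    0 ≤ marginalActionWeight eS eA eO P π k h' a' := by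
  refine sum_nonneg fun h _ => sum_nonneg fun a _ => mul_nonneg
    (mul_nonneg (weight_nonneg π h) (FinDist.nonneg _ _)) (mul_nonneg (ind_nonneg _)
      (mul_nonneg (ind_nonneg _) (prod_nonneg fun j _ => (P j).mass_nonneg n _)))

theorem sum_marginalActionWeight {n : ℕ} (h' : Hist (S' k) (A' k) (O' k) n) :
    ∑ a', marginalActionWeight eS eA eO P π k h' a' = marginalWeight eS eA eO P π k h' := by
  simp only [marginalActionWeight, marginalWeight]
  rw [sum_comm]
  refine sum_congr rfl fun h _ => ?_
  rw [sum_comm]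
  simp only [← mul_sum, ← sum_mul, sum_ind, one_mul]
  rw [FinDist.sum_eq_one, mul_one]

theorem marginalWeight_zero (h' : Hist (S' k) (A' k) (O' k) 0) :
    marginalWeight eS eA eO P π k h' = 1 := by
  simp only [marginalWeight, weight_zero, one_mul]
  rw [sum_mul_prod_erase_equiv (Hist.piEquiv eS eA eO 0) k (fun x => ind (x = h'))
    (fun j => (P j).mass 0)]
  simp [(P _).sum_mass_zero, sum_ind_symm]

/-- The next states and observations of the other components sum out, because their masses are
consistent whatever actions are taken. In component `k` the indicator selects one state and one
observation, so the result is independent of both, as the weight of a strategy must be. -/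
theorem marginalWeight_succ {n : ℕ} (h' : Hist (S' k) (A' k) (O' k) n) (a' : A' k) (s' : S' k)
    (o' : O' k) :
    marginalWeight eS eA eO P π k (h'.snoc a' s' o')
      = marginalActionWeight eS eA eO P π k h' a' := by
  rw [marginalWeight, Hist.sum_succ]
  refine sum_congr rfl fun h _ => sum_congr rfl fun a _ => ?_
  simp only [weight_succ, ← mul_sum]
  congr 1
  have h1 : ∀ s o, ind (Hist.piEquiv eS eA eO (n + 1) (h.snoc a s o) k = h'.snoc a' s' o')
      = (ind (eA a k = a') * ind (Hist.piEquiv eS eA eO n h k = h') * ind (eS s k = s')) *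
        ind (eO o k = o') := by
    intro s o
    rw [Hist.piEquiv_snoc, ← ind_and, ← ind_and, ← ind_and, Hist.snoc_inj]
    congr 1
    apply propext
    tauto
  simp only [h1]
  simp only [Hist.piEquiv_snoc]
  have h3 : ∀ s, ∑ o, (ind (eA a k = a') *
        ind (Hist.piEquiv eS eA eO n h k = h') *
        ind (eS s k = s')) * ind (eO o k = o') *
        ∏ j ∈ univ.erase k, (P j).mass (n + 1)
          ((Hist.piEquiv eS eA eO n h j).snoc (eA a j) (eS s j) (eO o j))
      = (ind (eA a k = a') *
        ind (Hist.piEquiv eS eA eO n h k = h')) *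
        (ind (eS s k = s') * ∏ j ∈ univ.erase k, ∑ o, (P j).mass (n + 1)
          ((Hist.piEquiv eS eA eO n h j).snoc (eA a j) (eS s j) o)) := by
    intro s
    have := sum_mul_prod_erase_equiv eO k (fun x => ind (x = o'))
      (fun j o => (P j).mass (n + 1) ((Hist.piEquiv eS eA eO n h j).snoc (eA a j) (eS s j) o))
    simp only [mul_assoc, ← mul_sum]
    rw [this, sum_ind_symm, one_mul]
  rw [sum_congr rfl fun s _ => h3 s, ← mul_sum]
  have := sum_mul_prod_erase_equiv eS k (fun x => ind (x = s'))
      (fun j s => ∑ o, (P j).mass (n + 1) ((Hist.piEquiv eS eA eO n h j).snoc (eA a j) s o))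
  rw [this]
  simp [(P _).sum_mass_succ, mul_assoc, sum_ind_symm]

open Classical in
/-- The strategy of component `k` that a strategy of a product problem induces, as the conditional
distribution of the action of component `k` given the history of component `k`. Where it is not
defined, the strategy `ρ` is used. -/
def marginal (ρ : Strategy (S' k) (A' k) (O' k)) : Strategy (S' k) (A' k) (O' k) := fun n h' =>
  if hw : marginalWeight eS eA eO P π k h' = 0 then ρ n h' else
    ⟨fun a' => marginalActionWeight eS eA eO P π k h' a' / marginalWeight eS eA eO P π k h',
      fun a' => div_nonneg (marginalActionWeight_nonneg eS eA eO P π k h' a') (by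
        rw [← sum_marginalActionWeight]
        exact sum_nonneg fun a' _ => marginalActionWeight_nonneg eS eA eO P π k h' a'), by
      rw [← sum_div, sum_marginalActionWeight, div_self hw]⟩

/-- Where the marginal weight vanishes, so does each of its nonnegative summands; the arbitrary
choice of `ρ` at such histories is harmless. -/
theorem marginalWeight_mul_marginal (ρ : Strategy (S' k) (A' k) (O' k)) {n : ℕ}
    (h' : Hist (S' k) (A' k) (O' k) n) (a' : A' k) :
    marginalWeight eS eA eO P π k h' * marginal eS eA eO P π k ρ n h' a'
      = marginalActionWeight eS eA eO P π k h' a' := by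
  by_cases hw : marginalWeight eS eA eO P π k h' = 0
  · rw [hw, zero_mul]
    rw [← sum_marginalActionWeight, sum_eq_zero_iff_of_nonneg fun a' _ =>
      marginalActionWeight_nonneg eS eA eO P π k h' a'] at hw
    exact (hw a' (mem_univ _)).symm
  · have : marginal eS eA eO P π k ρ n h' a'
        = marginalActionWeight eS eA eO P π k h' a' / marginalWeight eS eA eO P π k h' := by
      simp only [marginal, dif_neg hw]
      rfl
    rw [this, mul_div_cancel₀ _ hw]

theorem weight_marginal (ρ : Strategy (S' k) (A' k) (O' k)) : ∀ {n : ℕ}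
    (h' : Hist (S' k) (A' k) (O' k) n),
    weight (marginal eS eA eO P π k ρ) h' = marginalWeight eS eA eO P π k h'
  | 0, h' => (marginalWeight_zero eS eA eO P π k h').symm
  | n + 1, h' => by
    obtain ⟨h', a', s', o', rfl⟩ := h'.exists_eq_snoc
    rw [weight_succ, weight_marginal ρ h', marginalWeight_mul_marginal, marginalWeight_succ]

/-- The marginal strategy earns in component `k` what the given strategy earns there. -/
theorem stage_marginal (ρ : Strategy (S' k) (A' k) (O' k)) (n : ℕ) :
    (P k).stage (marginal eS eA eO P π k ρ) n = componentStage eS eA eO P π k n := by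
  simp only [stage, weight_marginal, marginalWeight_mul_marginal, marginalActionWeight,
    componentStage, sum_mul]
  have h1 : ∀ h' : Hist (S' k) (A' k) (O' k) n, ∀ F : A' k → Hist S A O n → A → ℝ,
      ∑ a', ∑ h, ∑ a, F a' h a = ∑ h, ∑ a, ∑ a', F a' h a := by
    intro h' F
    rw [sum_comm]
    exact sum_congr rfl fun h _ => sum_comm
  rw [sum_congr rfl fun h' _ => h1 h' _, sum_comm]
  refine sum_congr rfl fun h _ => ?_
  rw [sum_comm]
  refine sum_congr rfl fun a _ => ?_
  -- For a joint history and action, the indicators leave only the history and action of component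
  -- `k` that they project to.
  rw [sum_eq_single (Hist.piEquiv eS eA eO n h k), sum_eq_single (eA a k)]
  · rw [ind_pos rfl, ind_pos rfl]
    ring
  · intro a' _ ha
    simp [ind_neg ha.symm]
  · simp
  · intro h' _ hh
    simp [ind_neg hh.symm]
  · simp

/-- An action with nonzero conditional probability comes from some joint history and joint action to
which `π` gives nonzero weight, and the latter is allowed. Histories of marginal weight zero are
covered by `ρ`. -/
theorem uses_marginal {ρ : Strategy (S' k) (A' k) (O' k)} {C : S → Set A}
    {C' : ∀ k, S' k → Set (A' k)} (hC : ∀ s, ∀ a ∈ C s, eA a k ∈ C' k (eS s k))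
    (hρ : Uses (C' k) ρ) (hπ : Uses C π) : Uses (C' k) (marginal eS eA eO P π k ρ) := by
  intro n h' a' ha
  by_cases hw : marginalWeight eS eA eO P π k h' = 0
  · simp only [marginal, dif_pos hw] at ha
    exact hρ n h' a' ha
  · have h1 : marginalActionWeight eS eA eO P π k h' a' ≠ 0 := by
      rw [← marginalWeight_mul_marginal (ρ := ρ)]
      exact mul_ne_zero hw ha
    obtain ⟨h, _, hh⟩ := exists_ne_zero_of_sum_ne_zero h1
    obtain ⟨a, _, haa⟩ := exists_ne_zero_of_sum_ne_zero hh
    have h2 := left_ne_zero_of_mul haa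
    have h3 := right_ne_zero_of_mul haa
    have h4 : eA a k = a' := by
      by_contra h5
      simp [ind_neg h5] at h3
    have h5 : Hist.piEquiv eS eA eO n h k = h' := by
      by_contra h5
      simp [ind_neg h5] at h3
    have h6 := hC _ _ (hπ n h a (right_ne_zero_of_mul h2))
    rw [← h4, ← h5, Hist.piEquiv_apply, Hist.last_map]
    exact h6

end Marginal

variable {eS : S ≃ ∀ k, S' k} {eA : A ≃ ∀ k, A' k} {eO : O ≃ ∀ k, O' k}
  {P : ControlProblem S A O}

/-- If a strategy plays independently in the components, its rewards are those of the
components. -/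
theorem componentStage_combine (P : ∀ k, ControlProblem (S' k) (A' k) (O' k))
    (π : ∀ k, Strategy (S' k) (A' k) (O' k)) (k : K) (n : ℕ) :
    componentStage eS eA eO P (combine eS eA eO π) k n = (P k).stage (π k) n := by
  -- Joint actions are summed first: in the components other than `k` the action probabilities add
  -- up to one and leave weight times mass.
  have h1 : ∀ (h : Hist S A O n), ∑ a, weight (combine eS eA eO π) h * combine eS eA eO π n h a *
      ((P k).reward n (Hist.piEquiv eS eA eO n h k) (eA a k) *
        ∏ j ∈ univ.erase k, (P j).mass n (Hist.piEquiv eS eA eO n h j))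
      = (∑ a', weight (π k) (Hist.piEquiv eS eA eO n h k) *
          π k n (Hist.piEquiv eS eA eO n h k) a' *
          (P k).reward n (Hist.piEquiv eS eA eO n h k) a') *
        ∏ j ∈ univ.erase k, (weight (π j) (Hist.piEquiv eS eA eO n h j) *
          (P j).mass n (Hist.piEquiv eS eA eO n h j)) := by
    intro h
    have h2 := sum_mul_prod_erase_equiv eA k
      (fun a' => weight (π k) (Hist.piEquiv eS eA eO n h k) *
          π k n (Hist.piEquiv eS eA eO n h k) a' *
          (P k).reward n (Hist.piEquiv eS eA eO n h k) a')
      (fun j a' => π j n (Hist.piEquiv eS eA eO n h j) a' *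
        (weight (π j) (Hist.piEquiv eS eA eO n h j) *
          (P j).mass n (Hist.piEquiv eS eA eO n h j)))
    simp only [← sum_mul, FinDist.sum_eq_one, one_mul] at h2
    rw [← h2]
    refine sum_congr rfl fun a _ => ?_
    rw [weight_combine, combine_apply, ← mul_prod_erase univ _ (mem_univ k),
      ← mul_prod_erase univ (fun k => π k n _ _) (mem_univ k)]
    simp only [prod_mul_distrib]
    ring
  rw [componentStage, sum_congr rfl fun h _ => h1 h]
  -- Now histories are summed: each component other than `k` contributes its total probability,
  -- which is one.
  have h3 := sum_mul_prod_erase_equiv (Hist.piEquiv eS eA eO n) k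
    (fun h' => ∑ a', weight (π k) h' * π k n h' a' * (P k).reward n h' a')
    (fun j h' => weight (π j) h' * (P j).mass n h')
  rw [h3]
  simp [sum_weight_mul_mass, stage]

variable (eS eA eO)

/-- `P` is the product of the problems `P' k`: they run independently and their rewards add up. -/
structure IsProduct (P : ControlProblem S A O)
    (P' : ∀ k, ControlProblem (S' k) (A' k) (O' k)) : Prop where
  reward_eq : ∀ n h a, P.reward n h a =
    ∑ k, (P' k).reward n (Hist.piEquiv eS eA eO n h k) (eA a k) *
      ∏ j ∈ univ.erase k, (P' j).mass n (Hist.piEquiv eS eA eO n h j)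
  γ_eq : ∀ k, (P' k).γ = P.γ

variable {eS eA eO} {P' : ∀ k, ControlProblem (S' k) (A' k) (O' k)}

theorem IsProduct.stage_eq (hP : IsProduct eS eA eO P P') (π : Strategy S A O) (n : ℕ) :
    P.stage π n = ∑ k, componentStage eS eA eO P' π k n := by
  simp only [stage, hP.reward_eq, componentStage, mul_sum]
  rw [sum_comm (s := (univ : Finset K))]
  exact sum_congr rfl fun h _ => sum_comm

theorem IsProduct.value_eq (hP : IsProduct eS eA eO P P') {π : Strategy S A O}
    {π' : ∀ k, Strategy (S' k) (A' k) (O' k)}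
    (h : ∀ k n, componentStage eS eA eO P' π k n = (P' k).stage (π' k) n) :
    P.value π = ∑ k, (P' k).value (π' k) := by
  simp only [value]
  rw [← Summable.tsum_finsetSum fun k _ => (P' k).summable_stage (π' k)]
  refine tsum_congr fun n => ?_
  rw [hP.stage_eq, mul_sum]
  exact sum_congr rfl fun k _ => by rw [h, hP.γ_eq]

theorem IsProduct.value_combine (hP : IsProduct eS eA eO P P')
    (π : ∀ k, Strategy (S' k) (A' k) (O' k)) :
    P.value (combine eS eA eO π) = ∑ k, (P' k).value (π k) :=
  hP.value_eq (componentStage_combine _ π)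

/-- Whatever can be earned in a product problem can be earned in the components. -/
theorem IsProduct.exists_value_eq (hP : IsProduct eS eA eO P P') {C : S → Set A}
    {C' : ∀ k, S' k → Set (A' k)} (hC : ∀ s a, a ∈ C s ↔ ∀ k, eA a k ∈ C' k (eS s k))
    {ρ : ∀ k, Strategy (S' k) (A' k) (O' k)} (hρ : ∀ k, Uses (C' k) (ρ k))
    {π : Strategy S A O} (hπ : Uses C π) :
    ∃ π' : ∀ k, Strategy (S' k) (A' k) (O' k), (∀ k, Uses (C' k) (π' k)) ∧
      P.value π = ∑ k, (P' k).value (π' k) :=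
  ⟨fun k => marginal eS eA eO P' π k (ρ k),
    fun k => uses_marginal eS eA eO P' π k (fun s a ha => (hC s a).1 ha k) (hρ k) hπ,
    hP.value_eq fun k n => (stage_marginal eS eA eO P' π k (ρ k) n).symm⟩

end ControlProblem

/-- Maximizing a separable sum. -/
theorem forall_le_sum_iff {K X : Type} [Fintype K] [DecidableEq K] {X' : K → Type}
    {f : X → ℝ} {f' : ∀ k, X' k → ℝ} {c : (∀ k, X' k) → X} {D : X → Prop}
    {D' : ∀ k, X' k → Prop} (hc : ∀ x, (∀ k, D' k (x k)) → D (c x))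
    (hf : ∀ x, f (c x) = ∑ k, f' k (x k))
    (hf' : ∀ y, D y → ∃ x : ∀ k, X' k, (∀ k, D' k (x k)) ∧ f y = ∑ k, f' k (x k))
    {x : ∀ k, X' k} (hx : ∀ k, D' k (x k)) :
    (∀ y, D y → f y ≤ f (c x)) ↔ ∀ k y, D' k y → f' k y ≤ f' k (x k) := by
  constructor
  · intro h k y hy
    -- A deviation in the single coordinate `k` leaves all other summands unchanged.
    have h1 := h (c (Function.update x k y)) (hc _ fun j => by
      by_cases hj : j = k
      · subst hj
        simpa using hy
      · simpa [hj] using hx j)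
    rw [hf, hf, ← add_sum_erase univ _ (mem_univ k),
      ← add_sum_erase univ (fun k => f' k (x k)) (mem_univ k), Function.update_self] at h1
    have h2 : ∑ j ∈ univ.erase k, f' j (Function.update x k y j)
        = ∑ j ∈ univ.erase k, f' j (x j) :=
      sum_congr rfl fun j hj => by rw [Function.update_of_ne (ne_of_mem_erase hj)]
    linarith
  · intro h y hy
    obtain ⟨x', hx', e⟩ := hf' y hy
    rw [e, hf]
    exact sum_le_sum fun k _ => h k _ (hx' k)

end IntrusionResponse

end

noncomputable section

namespace IntrusionResponse

open Finset Filter Topology Strategy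

/-! ### Games as control problems of one player -/

theorem sum_comm₃ {α β δ : Type} [Fintype α] [Fintype β] [Fintype δ] (f : α → β → δ → ℝ) :
    ∑ a, ∑ b, ∑ c, f a b c = ∑ c, ∑ a, ∑ b, f a b c := by
  rw [sum_comm (s := (univ : Finset δ))]
  exact sum_congr rfl fun a _ => sum_comm

namespace Game

section Play

variable {SD SA AD AA O : Type}

/-- The defender's part of a play. -/
abbrev defenderHist {n : ℕ} (p : Play SD SA AD AA O n) : Hist SD AD O n :=
  Hist.map Prod.fst Prod.fst id p

/-- The attacker's part of a play. -/
abbrev attackerHist {n : ℕ} (p : Play SD SA AD AA O n) : Hist SA AA O n :=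
  Hist.map Prod.snd Prod.snd id p

theorem defenderHist_snoc {n : ℕ} (p : Play SD SA AD AA O n) (a : AD × AA) (s : SD × SA) (o : O) :
    defenderHist (Hist.snoc p a s o) = (defenderHist p).snoc a.1 s.1 o := rfl

theorem attackerHist_snoc {n : ℕ} (p : Play SD SA AD AA O n) (a : AD × AA) (s : SD × SA) (o : O) :
    attackerHist (Hist.snoc p a s o) = (attackerHist p).snoc a.2 s.2 o := rfl

end Play

variable {SD SA AD AA O : Type}
  [Fintype SD] [Fintype SA] [Fintype AD] [Fintype AA] [Fintype O]

/-- The probability of the next states and observation, given the current states and actions. -/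
def step (G : Game SD SA AD AA O) (s : SD × SA) (a : AD × AA) (s' : SD × SA) (o : O) : ℝ :=
  G.fD s.1 a.1 s'.1 * G.fA s.2 a.2 a.1 s'.2 * G.Z s'.1 s'.2 o

theorem step_nonneg (G : Game SD SA AD AA O) (s : SD × SA) (a : AD × AA) (s' : SD × SA) (o : O) :
    0 ≤ G.step s a s' o :=
  mul_nonneg (mul_nonneg (FinDist.nonneg _ _) (FinDist.nonneg _ _)) (FinDist.nonneg _ _)

theorem sum_step (G : Game SD SA AD AA O) (s : SD × SA) (a : AD × AA) :
    ∑ s', ∑ o, G.step s a s' o = 1 := by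
  simp only [step, ← mul_sum, FinDist.sum_eq_one, mul_one, Fintype.sum_prod_type]

/-- The probability that the states and observations of a play occur if its actions are taken. -/
def chance (G : Game SD SA AD AA O) : ∀ {n : ℕ}, Play SD SA AD AA O n → ℝ
  | 0, (s, o) => G.initD s.1 * G.initA s.2 * G.Z s.1 s.2 o
  | _ + 1, (p, a, s, o) => chance G p * G.step (Hist.last p) a s o

theorem chance_single (G : Game SD SA AD AA O) (s : SD × SA) (o : O) :
    G.chance (Hist.single s o : Play SD SA AD AA O 0)
      = G.initD s.1 * G.initA s.2 * G.Z s.1 s.2 o := rfl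

theorem chance_snoc (G : Game SD SA AD AA O) {n : ℕ} (p : Play SD SA AD AA O n) (a : AD × AA)
    (s : SD × SA) (o : O) :
    G.chance (Hist.snoc p a s o) = G.chance p * G.step (Hist.last p) a s o := rfl

theorem prob_snoc (G : Game SD SA AD AA O) (πD : Strategy SD AD O) (πA : Strategy SA AA O) {n : ℕ}
    (p : Play SD SA AD AA O n) (a : AD × AA) (s : SD × SA) (o : O) :
    G.prob πD πA (Hist.snoc p a s o) = G.prob πD πA p * πD n (defenderHist p) a.1
        * πA n (attackerHist p) a.2 * G.fD (Hist.last p).1 a.1 s.1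
        * G.fA (Hist.last p).2 a.2 a.1 s.2 * G.Z s.1 s.2 o := rfl

theorem chance_nonneg (G : Game SD SA AD AA O) : ∀ {n : ℕ} (p : Play SD SA AD AA O n),
    0 ≤ G.chance p
  | 0, _ => mul_nonneg (mul_nonneg (FinDist.nonneg _ _) (FinDist.nonneg _ _)) (FinDist.nonneg _ _)
  | _ + 1, (p, _, _, _) => mul_nonneg (chance_nonneg G p) (G.step_nonneg _ _ _ _)

theorem sum_chance_zero (G : Game SD SA AD AA O) : ∑ p : Play SD SA AD AA O 0, G.chance p = 1 := by
  rw [Hist.sum_zero]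
  simp only [chance_single, ← mul_sum, FinDist.sum_eq_one, mul_one, Fintype.sum_prod_type]

/-- This separates what each player controls from chance. Absorbing one player's weight into the
chance factor leaves a control problem of the other. -/
theorem prob_eq (G : Game SD SA AD AA O) (πD : Strategy SD AD O) (πA : Strategy SA AA O) :
    ∀ {n : ℕ} (p : Play SD SA AD AA O n),
      G.prob πD πA p = weight πD (defenderHist p) * weight πA (attackerHist p) * G.chance p
  | 0, p => by
    rw [weight_zero, weight_zero, one_mul, one_mul]
    rfl
  | n + 1, p => by
    obtain ⟨p, a, s, o, rfl⟩ := Hist.exists_eq_snoc p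
    rw [prob_snoc, prob_eq G πD πA p, defenderHist_snoc, attackerHist_snoc, weight_succ,
      weight_succ, chance_snoc, step]
    ring

/-- A bound of the utility. -/
def utilityBound (G : Game SD SA AD AA O) : ℝ := ∑ s, ∑ t, ∑ a, |G.u s t a|

theorem abs_u_le (G : Game SD SA AD AA O) (s : SD) (t : SA) (a : AD) :
    |G.u s t a| ≤ G.utilityBound := by
  have h1 := single_le_sum (f := fun a => |G.u s t a|) (fun _ _ => abs_nonneg _) (mem_univ a)
  have h2 := single_le_sum (f := fun t => ∑ a, |G.u s t a|)
    (fun _ _ => sum_nonneg fun _ _ => abs_nonneg _) (mem_univ t)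
  have h3 := single_le_sum (f := fun s => ∑ t, ∑ a, |G.u s t a|)
    (fun _ _ => sum_nonneg fun _ _ => sum_nonneg fun _ _ => abs_nonneg _) (mem_univ s)
  exact (h1.trans h2).trans h3

theorem abs_sum_mul_le {α : Type} [Fintype α] {f g : α → ℝ} {B : ℝ} (hf : ∀ a, 0 ≤ f a)
    (hg : ∀ a, |g a| ≤ B) : |∑ a, f a * g a| ≤ B * ∑ a, f a := by
  rw [mul_sum]
  refine (abs_sum_le_sum_abs _ _).trans (sum_le_sum fun a _ => ?_)
  rw [abs_mul, abs_of_nonneg (hf a), mul_comm]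
  exact mul_le_mul_of_nonneg_right (hg a) (hf a)

/-- The defender's control problem against a strategy of the attacker. -/
def defenderProblem (G : Game SD SA AD AA O) (πA : Strategy SA AA O) : ControlProblem SD AD O where
  mass n h := ∑ p : Play SD SA AD AA O n,
    ind (defenderHist p = h) * (weight πA (attackerHist p) * G.chance p)
  mass_nonneg n h := sum_nonneg fun p _ =>
    mul_nonneg (ind_nonneg _) (mul_nonneg (weight_nonneg _ _) (G.chance_nonneg p))
  sum_mass_zero := by
    rw [sum_comm]
    simp only [← sum_mul, sum_ind, weight_zero, one_mul, G.sum_chance_zero]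
  sum_mass_succ n h a := by
    rw [sum_comm₃, Hist.sum_succ]
    refine sum_congr rfl fun p _ => ?_
    -- For an extended play exactly one pair `s, o` matches. The attacker's action probabilities and
    -- the step probabilities are then summed to one.
    have h1 : ∀ (a' : AD × AA) s' o',
        ∑ s, ∑ o, ind (defenderHist (Hist.snoc p a' s' o') = h.snoc a s o) *
          (weight πA (attackerHist (Hist.snoc p a' s' o')) * G.chance (Hist.snoc p a' s' o'))
        = ind (defenderHist p = h) * (weight πA (attackerHist p) * G.chance p) *
          (ind (a'.1 = a) * πA n (attackerHist p) a'.2) * G.step (Hist.last p) a' s' o' := by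
      intro a' s' o'
      simp only [defenderHist_snoc, attackerHist_snoc, Hist.snoc_inj, ind_and, weight_succ,
        chance_snoc, ← sum_mul, ← mul_sum, sum_ind, mul_one]
      ring
    simp only [h1, ← mul_sum, sum_step, mul_one]
    simp only [Fintype.sum_prod_type, ← mul_sum, FinDist.sum_eq_one, sum_ind_symm, mul_one]
  reward n h a := ∑ p : Play SD SA AD AA O n,
    ind (defenderHist p = h) * (weight πA (attackerHist p) * G.chance p) *
      G.u p.last.1 p.last.2 a
  bound := G.utilityBound
  abs_reward_le n h a := abs_sum_mul_le (fun p =>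
    mul_nonneg (ind_nonneg _) (mul_nonneg (weight_nonneg _ _) (G.chance_nonneg p)))
    fun p => G.abs_u_le _ _ _
  γ := G.γ
  γ_nonneg := G.γ_nonneg
  γ_lt_one := G.γ_lt_one

/-- Plays are grouped by the defender's history: within a group the defender's weight is constant,
and the rest adds up to `reward`. -/
theorem payoff_eq_defender (G : Game SD SA AD AA O) (πD : Strategy SD AD O)
    (πA : Strategy SA AA O) : G.payoff πD πA = (G.defenderProblem πA).value πD := by
  refine tsum_congr fun n => congrArg _ ?_
  simp only [stageUtility, ControlProblem.stage, defenderProblem, mul_sum]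
  rw [sum_comm₃ (α := Hist SD AD O n)]
  refine sum_congr rfl fun p _ => ?_
  rw [sum_comm (s := (univ : Finset (Hist SD AD O n)))]
  refine sum_congr rfl fun a _ => ?_
  rw [prob_eq]
  refine Eq.trans ?_ (sum_ind_mul (defenderHist p) fun h => weight πD h * πD n h a *
    (weight πA (attackerHist p) * G.chance p * G.u p.last.1 p.last.2 a)).symm |>.trans ?_
  · ring
  · exact sum_congr rfl fun h _ => by ring

/-- The attacker's control problem against a strategy of the defender. -/
def attackerProblem (G : Game SD SA AD AA O) (πD : Strategy SD AD O) : ControlProblem SA AA O where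
  mass n h := ∑ p : Play SD SA AD AA O n,
    ind (attackerHist p = h) * (weight πD (defenderHist p) * G.chance p)
  mass_nonneg n h := sum_nonneg fun p _ =>
    mul_nonneg (ind_nonneg _) (mul_nonneg (weight_nonneg _ _) (G.chance_nonneg p))
  sum_mass_zero := by
    rw [sum_comm]
    simp only [← sum_mul, sum_ind, weight_zero, one_mul, G.sum_chance_zero]
  sum_mass_succ n h a := by
    rw [sum_comm₃, Hist.sum_succ]
    refine sum_congr rfl fun p _ => ?_
    have h1 : ∀ (a' : AD × AA) s' o',
        ∑ s, ∑ o, ind (attackerHist (Hist.snoc p a' s' o') = h.snoc a s o) *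
          (weight πD (defenderHist (Hist.snoc p a' s' o')) * G.chance (Hist.snoc p a' s' o'))
        = ind (attackerHist p = h) * (weight πD (defenderHist p) * G.chance p) *
          (πD n (defenderHist p) a'.1 * ind (a'.2 = a)) * G.step (Hist.last p) a' s' o' := by
      intro a' s' o'
      simp only [defenderHist_snoc, attackerHist_snoc, Hist.snoc_inj, ind_and, weight_succ,
        chance_snoc, ← sum_mul, ← mul_sum, sum_ind, mul_one]
      ring
    simp only [h1, ← mul_sum, sum_step, mul_one]
    simp only [Fintype.sum_prod_type, ← mul_sum, FinDist.sum_eq_one, sum_ind_symm, mul_one]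
  -- The utility involves only the defender's action, which is averaged here; the attacker's current
  -- action influences future stages only.
  reward n h _ := ∑ p : Play SD SA AD AA O n,
    ind (attackerHist p = h) * (weight πD (defenderHist p) * G.chance p) *
      ∑ d, πD n (defenderHist p) d * G.u p.last.1 p.last.2 d
  bound := G.utilityBound
  abs_reward_le n h a := abs_sum_mul_le (fun p =>
    mul_nonneg (ind_nonneg _) (mul_nonneg (weight_nonneg _ _) (G.chance_nonneg p)))
    fun p => (abs_sum_mul_le (fun _ => FinDist.nonneg _ _) fun d => G.abs_u_le _ _ d).trans_eq
      (by rw [FinDist.sum_eq_one, mul_one])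
  γ := G.γ
  γ_nonneg := G.γ_nonneg
  γ_lt_one := G.γ_lt_one

theorem payoff_eq_attacker (G : Game SD SA AD AA O) (πD : Strategy SD AD O)
    (πA : Strategy SA AA O) : G.payoff πD πA = (G.attackerProblem πD).value πA := by
  refine tsum_congr fun n => congrArg _ ?_
  simp only [stageUtility, ControlProblem.stage, attackerProblem, ← mul_sum, ← sum_mul,
    FinDist.sum_eq_one, mul_one]
  have h1 : ∀ h : Hist SA AA O n, weight πA h * ∑ p : Play SD SA AD AA O n,
      ind (attackerHist p = h) * (weight πD (defenderHist p) * G.chance p) *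
        ∑ d, πD n (defenderHist p) d * G.u p.last.1 p.last.2 d
      = ∑ p : Play SD SA AD AA O n, weight πA h *
        (ind (attackerHist p = h) * (weight πD (defenderHist p) * G.chance p) *
          ∑ d, πD n (defenderHist p) d * G.u p.last.1 p.last.2 d) := fun h => mul_sum _ _ _
  rw [sum_congr rfl fun h _ => h1 h, sum_comm (s := (univ : Finset (Hist SA AA O n)))]
  refine sum_congr rfl fun p _ => ?_
  refine Eq.trans ?_ (sum_ind_mul (attackerHist p) fun h => weight πA h *
    (weight πD (defenderHist p) * G.chance p *
      ∑ d, πD n (defenderHist p) d * G.u p.last.1 p.last.2 d)).symm |>.trans ?_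
  · rw [prob_eq, mul_sum, mul_sum]
    exact sum_congr rfl fun d _ => by ring
  · exact sum_congr rfl fun h _ => by ring

theorem exists_bestResponseD (G : Game SD SA AD AA O) (πA : Strategy SA AA O)
    [Nonempty AD] : ∃ πD, G.IsBestResponseD πA πD := by
  obtain ⟨π, _, hπ⟩ := (G.defenderProblem πA).exists_maximizer (C := fun _ => Set.univ)
    fun _ => Set.univ_nonempty
  refine ⟨π, fun π' => ?_⟩
  rw [payoff_eq_defender, payoff_eq_defender]
  exact hπ π' fun _ _ _ _ => Set.mem_univ _

theorem exists_bestResponseA (G : Game SD SA AD AA O) (πD : Strategy SD AD O) :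
    ∃ πA, G.IsBestResponseA πD πA := by
  obtain ⟨π, hu, hπ⟩ := (G.attackerProblem πD).exists_minimizer G.adm_nonempty
  refine ⟨π, hu, fun π' hu' => ?_⟩
  rw [payoff_eq_attacker, payoff_eq_attacker]
  exact hπ π' hu'

end Game

/-- Pairs of families are families of pairs. -/
def prodPi {α β K : Type} {α' β' : K → Type} (e : α ≃ ∀ k, α' k) (f : β ≃ ∀ k, β' k) :
    α × β ≃ ∀ k, α' k × β' k where
  toFun x k := (e x.1 k, f x.2 k)
  invFun y := (e.symm fun k => (y k).1, f.symm fun k => (y k).2)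
  left_inv x := by simp
  right_inv y := by
    funext k
    simp

/-! ### Games that split into independent subgames -/

namespace Split

open Game

section Play

variable {SD SA AD AA O K : Type} {SD' SA' AD' AA' O' : K → Type}
  (e : Split SD SA AD AA O SD' SA' AD' AA' O') (n : ℕ)

/-- Plays of a game that splits are families of plays of the subgames. -/
def play : Play SD SA AD AA O n ≃ ∀ k, Play (SD' k) (SA' k) (AD' k) (AA' k) (O' k) n :=
  Hist.piEquiv (prodPi e.sD e.sA) (prodPi e.aD e.aA) e.o n

theorem defenderHist_play {n : ℕ} (p : Play SD SA AD AA O n) (k : K) :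
    defenderHist (e.play n p k) = Hist.piEquiv e.sD e.aD e.o n (defenderHist p) k := by
  rw [play, Hist.piEquiv_apply, Hist.piEquiv_apply, defenderHist, defenderHist, Hist.map_map,
    Hist.map_map]
  rfl

theorem attackerHist_play {n : ℕ} (p : Play SD SA AD AA O n) (k : K) :
    attackerHist (e.play n p k) = Hist.piEquiv e.sA e.aA e.o n (attackerHist p) k := by
  rw [play, Hist.piEquiv_apply, Hist.piEquiv_apply, attackerHist, attackerHist, Hist.map_map,
    Hist.map_map]
  rfl

theorem last_play {n : ℕ} (p : Play SD SA AD AA O n) (k : K) :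
    (e.play n p k).last = (e.sD p.last.1 k, e.sA p.last.2 k) := by
  rw [play, Hist.piEquiv_apply, Hist.last_map]
  rfl

theorem ind_defenderHist [Fintype K] {n : ℕ} (p : Play SD SA AD AA O n) (h : Hist SD AD O n) :
    ind (defenderHist p = h)
      = ∏ k, ind (defenderHist (e.play n p k) = Hist.piEquiv e.sD e.aD e.o n h k) := by
  rw [← ind_forall, ← (Hist.piEquiv e.sD e.aD e.o n).apply_eq_iff_eq, funext_iff]
  simp only [defenderHist_play]

theorem ind_attackerHist [Fintype K] {n : ℕ} (p : Play SD SA AD AA O n) (h : Hist SA AA O n) :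
    ind (attackerHist p = h)
      = ∏ k, ind (attackerHist (e.play n p k) = Hist.piEquiv e.sA e.aA e.o n h k) := by
  rw [← ind_forall, ← (Hist.piEquiv e.sA e.aA e.o n).apply_eq_iff_eq, funext_iff]
  simp only [attackerHist_play]

end Play

variable {SD SA AD AA O : Type}
  [Fintype SD] [Fintype SA] [Fintype AD] [Fintype AA] [Fintype O]
  {K : Type} [Fintype K] {SD' SA' AD' AA' O' : K → Type}
  [∀ k, Fintype (SD' k)] [∀ k, Fintype (SA' k)] [∀ k, Fintype (AD' k)]
  [∀ k, Fintype (AA' k)] [∀ k, Fintype (O' k)]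
  (e : Split SD SA AD AA O SD' SA' AD' AA' O')

variable {e} {G : Game SD SA AD AA O} {G' : ∀ k, Game (SD' k) (SA' k) (AD' k) (AA' k) (O' k)}

/-- Independence of observations, of transitions and of the initial states enters the optimal
substructure only through this factorization; the availability of actions is used separately. -/
theorem chance_play (hO : e.ObservationIndependent G G') (hT : e.TransitionIndependent G G') :
    ∀ {n : ℕ} (p : Play SD SA AD AA O n), G.chance p = ∏ k, (G' k).chance (e.play n p k)
  | 0, p => by
    obtain ⟨s, o, rfl⟩ := Hist.exists_eq_single p
    rw [chance_single, hO, hT.2.2.1, hT.2.2.2.1, ← prod_mul_distrib, ← prod_mul_distrib]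
    rfl
  | n + 1, p => by
    obtain ⟨p, a, s, o, rfl⟩ := Hist.exists_eq_snoc p
    have h1 : ∀ k, (G' k).chance (e.play (n + 1) (Hist.snoc p a s o) k)
        = (G' k).chance (e.play n p k) * (G' k).step (Hist.last (e.play n p k))
          (prodPi e.aD e.aA a k) (prodPi e.sD e.sA s k) (e.o o k) := fun k => rfl
    rw [chance_snoc, chance_play hO hT p, step, hO, hT.1, hT.2.1, ← prod_mul_distrib,
      ← prod_mul_distrib, ← prod_mul_distrib]
    refine prod_congr rfl fun k _ => ?_
    rw [h1, step, last_play]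
    rfl

variable [DecidableEq K]

/-- The sum of a separable function against a product. -/
theorem sum_prod_mul_sum {α : Type} [Fintype α] {β : K → Type} [∀ k, Fintype (β k)]
    (ε : α ≃ ∀ k, β k) (f g : ∀ k, β k → ℝ) :
    ∑ a, (∏ k, f k (ε a k)) * ∑ k, g k (ε a k)
      = ∑ k, (∑ b, f k b * g k b) * ∏ j ∈ univ.erase k, ∑ b, f j b := by
  simp only [← sum_mul_prod_erase_equiv ε]
  rw [sum_comm]
  refine sum_congr rfl fun a _ => ?_
  rw [mul_sum]
  refine sum_congr rfl fun k _ => ?_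
  rw [← mul_prod_erase univ _ (mem_univ k)]
  ring

/-- Indicator, weight and chance of a play are products over the subgames and the utility is a sum.
By `sum_prod_mul_sum`, summand `k` becomes the reward in subgame `k` times the masses of the others.
-/
theorem isProduct_defenderProblem (hO : e.ObservationIndependent G G')
    (hT : e.TransitionIndependent G G') (hU : e.UtilityIndependent G G')
    (πA : ∀ k, Strategy (SA' k) (AA' k) (O' k)) :
    ControlProblem.IsProduct e.sD e.aD e.o (G.defenderProblem (e.combineA πA))
      fun k => (G' k).defenderProblem (πA k) where
  γ_eq := hU.2
  reward_eq n h a := by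
    have h1 := sum_prod_mul_sum (e.play n)
      (fun k p => ind (defenderHist p = Hist.piEquiv e.sD e.aD e.o n h k) *
        (weight (πA k) (attackerHist p) * (G' k).chance p))
      (fun k p => (G' k).u p.last.1 p.last.2 (e.aD a k))
    refine Eq.trans (sum_congr rfl fun p _ => ?_) h1
    have h2 : weight (e.combineA πA) (attackerHist p)
        = ∏ k, weight (πA k) (Hist.piEquiv e.sA e.aA e.o n (attackerHist p) k) :=
      weight_combine πA _
    rw [ind_defenderHist e, h2, chance_play hO hT p, hU.1, ← prod_mul_distrib,
      ← prod_mul_distrib]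
    simp only [attackerHist_play, last_play]

theorem isProduct_attackerProblem (hO : e.ObservationIndependent G G')
    (hT : e.TransitionIndependent G G') (hU : e.UtilityIndependent G G')
    (πD : ∀ k, Strategy (SD' k) (AD' k) (O' k)) :
    ControlProblem.IsProduct e.sA e.aA e.o (G.attackerProblem (e.combineD πD))
      fun k => (G' k).attackerProblem (πD k) where
  γ_eq := hU.2
  reward_eq n h a := by
    have h1 := sum_prod_mul_sum (e.play n)
      (fun k p => ind (attackerHist p = Hist.piEquiv e.sA e.aA e.o n h k) *
        (weight (πD k) (defenderHist p) * (G' k).chance p))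
      (fun k p => ∑ d, πD k n (defenderHist p) d * (G' k).u p.last.1 p.last.2 d)
    refine Eq.trans (sum_congr rfl fun p _ => ?_) h1
    have h2 : weight (e.combineD πD) (defenderHist p)
        = ∏ k, weight (πD k) (Hist.piEquiv e.sD e.aD e.o n (defenderHist p) k) :=
      weight_combine πD _
    -- Since the defender randomizes independently, averaging the utility of subgame `k` involves
    -- only the action in that subgame.
    have h3 : ∑ d, e.combineD πD n (defenderHist p) d * G.u p.last.1 p.last.2 d
        = ∑ k, ∑ d, πD k n (Hist.piEquiv e.sD e.aD e.o n (defenderHist p) k) d *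
          (G' k).u (e.sD p.last.1 k) (e.sA p.last.2 k) d := by
      have h4 := sum_prod_mul_sum e.aD
        (fun k d => πD k n (Hist.piEquiv e.sD e.aD e.o n (defenderHist p) k) d)
        (fun k d => (G' k).u (e.sD p.last.1 k) (e.sA p.last.2 k) d)
      simp only [FinDist.sum_eq_one, prod_const_one, mul_one] at h4
      rw [← h4]
      refine sum_congr rfl fun d _ => ?_
      rw [hU.1]
      rfl
    rw [ind_attackerHist e, h2, chance_play hO hT p, h3, ← prod_mul_distrib,
      ← prod_mul_distrib]
    simp only [defenderHist_play, last_play]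

/-- Independent subgames have optimal substructure. -/
theorem optimalSubstructure_of_independent [∀ k, Nonempty (AD' k)]
    (hO : e.ObservationIndependent G G') (hT : e.TransitionIndependent G G')
    (hU : e.UtilityIndependent G G') : e.OptimalSubstructure G G' := by
  refine ⟨fun k πA _ => (G' k).exists_bestResponseD πA,
    fun k πD => (G' k).exists_bestResponseA πD, fun πD πA hA => ?_⟩
  have hadm : ∀ s a, a ∈ G.adm s ↔ ∀ k, e.aA a k ∈ (G' k).adm (e.sA s k) := hT.2.2.2.2
  have hcomb : ∀ x : ∀ k, Strategy (SA' k) (AA' k) (O' k), (∀ k, (G' k).Admissible (x k)) →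
      G.Admissible (e.combineA x) := fun x hx => uses_combine hadm hx
  refine ⟨hcomb πA hA, ?_, ?_⟩
  · have hP := isProduct_defenderProblem hO hT hU πA
    have h1 := forall_le_sum_iff (D := fun _ => True) (D' := fun _ _ => True)
      (f := (G.defenderProblem (e.combineA πA)).value)
      (f' := fun k => ((G' k).defenderProblem (πA k)).value) (c := e.combineD) (x := πD)
      (fun _ _ => trivial) hP.value_combine (fun y _ => by
        -- The defender has no forbidden actions; `πD` serves only as the default of the marginals
        -- at histories of weight zero.
        obtain ⟨x, _, hx⟩ := hP.exists_value_eq (C := fun _ => Set.univ)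
          (C' := fun _ _ => Set.univ) (fun _ _ => by simp) (ρ := πD)
          (fun _ _ _ _ _ => Set.mem_univ _) (π := y) (fun _ _ _ _ => Set.mem_univ _)
        exact ⟨x, fun _ => trivial, hx⟩) fun _ => trivial
    simpa only [IsBestResponseD, payoff_eq_defender, true_imp_iff] using h1
  · have hP := isProduct_attackerProblem hO hT hU πD
    -- The attacker minimizes, so the separable maximization is applied to negated values.
    have h1 := forall_le_sum_iff (D := G.Admissible) (D' := fun k => (G' k).Admissible)
      (f := fun x => -(G.attackerProblem (e.combineD πD)).value x)
      (f' := fun k x => -((G' k).attackerProblem (πD k)).value x) (c := e.combineA) (x := πA)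
      hcomb (fun x => by rw [sum_neg_distrib]; exact congrArg _ (hP.value_combine x))
      (fun y hy => by
        obtain ⟨x, hx, hv⟩ := hP.exists_value_eq hadm hA hy
        exact ⟨x, hx, by rw [hv, sum_neg_distrib]⟩) hA
    simp only [neg_le_neg_iff] at h1
    simp only [IsBestResponseA, payoff_eq_attacker, hA, hcomb πA hA, true_and]
    exact h1

end Split

end IntrusionResponse

end

noncomputable section

namespace IntrusionResponse

open Finset Strategy

/-! ### Workflow and node subgames -/

theorem FinDist.vertex_apply {α : Type} [Fintype α] [DecidableEq α] (a b : α) :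
    (stdSimplex.vertex a : FinDist α) b = ind (b = a) := by
  by_cases h : b = a
  · rw [ind_pos h]
    simp [stdSimplex.vertex, h]
  · rw [ind_neg h]
    simp [stdSimplex.vertex, h]

theorem ncard_eq_sum_ind {α : Type} [Fintype α] (p : α → Prop) :
    (Set.ncard {a | p a} : ℝ) = ∑ a, ind (p a) := by
  classical
  rw [Set.ncard_eq_toFinset_card']
  simp [ind]

namespace Model

set_option linter.unusedSectionVars false

variable {V W Zn AD AA O : Type} [Fintype V] [DecidableEq V] [Fintype W] [DecidableEq W]
  [Fintype Zn] [DecidableEq Zn] [Fintype AD] [DecidableEq AD] [Fintype AA] [Fintype O]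
  (M : Model V W Zn AD AA O)

/-- The subtree condition propagates along the path from `j` towards the gateway. Hence neither
subtrees nor sets of ancestors leave a workflow. -/
theorem wf_eq_of_isAncestor {j i : V} (h : M.IsAncestor j i) : M.wf j = M.wf i := by
  induction h with
  | refl => rfl
  | tail _ h ih => exact (M.wf_parent _ _ h).trans ih

theorem prod_fiber (f : V → ℝ) : ∏ i, f i = ∏ w, ∏ i : M.WNode w, f i := by
  rw [← Fintype.prod_sigma' fun w (i : M.WNode w) => f i]
  exact (Fintype.prod_equiv (Equiv.sigmaFiberEquiv M.wf) _ _ fun _ => rfl).symm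

theorem sum_fiber (f : V → ℝ) : ∑ i, f i = ∑ w, ∑ i : M.WNode w, f i := by
  rw [← Fintype.sum_sigma' fun w (i : M.WNode w) => f i]
  exact (Fintype.sum_equiv (Equiv.sigmaFiberEquiv M.wf) _ _ fun _ => rfl).symm

theorem sum_eq_sum_wnode {w : W} {f : V → ℝ} (hf : ∀ i, M.wf i ≠ w → f i = 0) :
    ∑ i, f i = ∑ i : M.WNode w, f i := by
  rw [M.sum_fiber f, sum_eq_single w]
  · intro w' _ hw
    exact sum_eq_zero fun i _ => hf i (by rw [i.2]; exact hw)
  · simp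

theorem workflow_observationIndependent :
    M.workflowSplit.ObservationIndependent M.game M.workflowGame := fun z s o =>
  M.prod_fiber fun i => M.Z i (z i) (s i) (o i)

theorem workflow_transitionIndependent :
    M.workflowSplit.TransitionIndependent M.game M.workflowGame := by
  refine ⟨fun s a s' => M.prod_fiber fun i => M.fD i (s i) (a i) (s' i),
    fun s a d s' => M.prod_fiber fun i => M.fA i (s i) (a i) (d i) (s' i), fun s => ?_,
    fun s => ?_, fun s a => ?_⟩
  · change (stdSimplex.vertex M.zone₁ : FinDist (V → Zn)) s
      = ∏ w, (stdSimplex.vertex fun i : M.WNode w => M.zone₁ i : FinDist (M.WNode w → Zn))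
        (fun i => s i)
    simp only [FinDist.vertex_apply, funext_iff, ind_forall]
    exact M.prod_fiber fun i => ind (s i = M.zone₁ i)
  · change (stdSimplex.vertex fun _ => (false, false) : FinDist (V → NodeAttState)) s
      = ∏ w, (stdSimplex.vertex fun _ : M.WNode w => (false, false) :
        FinDist (M.WNode w → NodeAttState)) (fun i => s i)
    simp only [FinDist.vertex_apply, funext_iff, ind_forall]
    exact M.prod_fiber fun i => ind (s i = (false, false))
  · exact ⟨fun h w i => h i, fun h i => h (M.wf i) ⟨i, rfl⟩⟩

/-- A subtree lies in the workflow of its root, so counting its active nodes in the whole tree or in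
the workflow gives the same number. -/
theorem workflow_utilityIndependent :
    M.workflowSplit.UtilityIndependent M.game M.workflowGame := by
  refine ⟨fun z s d => ?_, fun _ => rfl⟩
  refine (M.sum_fiber _).trans (sum_congr rfl fun w _ => sum_congr rfl fun i _ => ?_)
  congr 3
  rw [ncard_eq_sum_ind, ncard_eq_sum_ind]
  refine M.sum_eq_sum_wnode (w := w) fun j hj => ind_neg fun h => hj ?_
  exact (M.wf_eq_of_isAncestor h.1).symm.trans i.2

theorem node_observationIndependent (w : W) :
    (M.nodeSplit w).ObservationIndependent (M.workflowGame w) (fun i => M.nodeGame i) :=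
  fun _ _ _ => rfl

theorem node_transitionIndependent (w : W) :
    (M.nodeSplit w).TransitionIndependent (M.workflowGame w) (fun i => M.nodeGame i) := by
  refine ⟨fun _ _ _ => rfl, fun _ _ _ _ => rfl, fun s => ?_, fun s => ?_, fun _ _ => Iff.rfl⟩
  · change (stdSimplex.vertex fun i : M.WNode w => M.zone₁ i : FinDist (M.WNode w → Zn)) s
      = ∏ i : M.WNode w, (stdSimplex.vertex (M.zone₁ i) : FinDist Zn) (s i)
    simp only [FinDist.vertex_apply, funext_iff, ind_forall]
  · change (stdSimplex.vertex fun _ : M.WNode w => (false, false) :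
        FinDist (M.WNode w → NodeAttState)) s
      = ∏ i : M.WNode w, (stdSimplex.vertex (false, false) : FinDist NodeAttState) (s i)
    simp only [FinDist.vertex_apply, funext_iff, ind_forall]

theorem node_utilityIndependent (w : W) :
    (M.nodeSplit w).UtilityIndependent (M.workflowGame w) (fun i => M.nodeGame i) := by
  refine ⟨fun z s d => ?_, fun _ => rfl⟩
  change ∑ i : M.WNode w, (M.η * (M.κ * (Set.ncard {j : M.WNode w |
      M.IsAncestor i j ∧ M.active j (z j) = true} : ℝ)) - M.intrusionCost (s i) (d i))
    = ∑ i : M.WNode w, (M.η * (M.κ * ((Set.ncard {j : V | M.IsAncestor j i} : ℝ) *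
      (if M.active i (z i) = true then 1 else 0))) - M.intrusionCost (s i) (d i))
  rw [sum_sub_distrib, sum_sub_distrib, ← mul_sum, ← mul_sum, ← mul_sum, ← mul_sum]
  congr 3
  simp only [ncard_eq_sum_ind, ind_and]
  -- Double counting of pairs of a node and an active descendant: summing over descendants last,
  -- each active node is counted once for each of its ancestors.
  rw [sum_comm]
  refine sum_congr rfl fun i _ => ?_
  rw [← sum_mul, M.sum_eq_sum_wnode (w := w) (f := fun j => ind (M.IsAncestor j i))]
  · congr 1
    simp [ind]
  · exact fun j hj => ind_neg fun h => hj ((M.wf_eq_of_isAncestor h).trans i.2)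

theorem spaceComplexity_nodeGame (i : V) : (M.nodeGame i).spaceComplexity =
    4 * Fintype.card AA + Fintype.card Zn ^ 2 * Fintype.card AD
      + 16 * Fintype.card AA * Fintype.card AD + 4 * Fintype.card Zn * Fintype.card O
      + 4 * Fintype.card Zn * Fintype.card AD + Fintype.card Zn + 5 := by
  have h : Fintype.card NodeAttState = 4 := rfl
  rw [Game.spaceComplexity, h]
  ring

end Model

end IntrusionResponse

end

noncomputable section

namespace IntrusionResponse

open Finset Filter Topology

/-! ### Value functions of a hidden three-level state -/

/-- Monotone likelihood ratio order of nonnegative vectors. -/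
def MLR (a b : Fin 3 → ℝ) : Prop := ∀ k l : Fin 3, k ≤ l → a l * b k ≤ a k * b l

/-- The properties of value functions of unnormalized beliefs: they are sublinear, Lipschitz
continuous with constant `B`, and, relative to the total mass, decreasing in the monotone likelihood
ratio order. -/
structure IsValueLike (B : ℝ) (F : (Fin 3 → ℝ) → ℝ) : Prop where
  smul : ∀ c : ℝ, 0 ≤ c → ∀ m, F (c • m) = c * F m
  add_le : ∀ m m', F (m + m') ≤ F m + F m'
  lipschitz : ∀ m m', |F m - F m'| ≤ B * ∑ k, |m k - m' k|
  anti : ∀ m m' : Fin 3 → ℝ, (∀ k, 0 ≤ m k) → (∀ k, 0 ≤ m' k) → MLR m m' →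
    F m' * ∑ k, m k ≤ F m * ∑ k, m' k

/-- The share of the top level grows in the order; this is what makes the intrusion cost monotone.
-/
theorem MLR.apply_two_mul_sum_le {m m' : Fin 3 → ℝ} (h : MLR m m') :
    m 2 * ∑ k, m' k ≤ m' 2 * ∑ k, m k := by
  have h1 := h 0 2 (by decide)
  have h2 := h 1 2 (by decide)
  simp only [Fin.sum_univ_three]
  linarith

namespace IsValueLike

variable {B B' : ℝ} {F F' : (Fin 3 → ℝ) → ℝ}

theorem map_zero (h : IsValueLike B F) : F 0 = 0 := by
  simpa using h.smul 0 le_rfl 0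

theorem abs_le (h : IsValueLike B F) (m : Fin 3 → ℝ) : |F m| ≤ B * ∑ k, |m k| := by
  simpa [h.map_zero] using h.lipschitz m 0

theorem continuous (h : IsValueLike B F) : Continuous F := by
  rw [continuous_iff_continuousAt]
  intro m
  have h1 : Tendsto (fun m' : Fin 3 → ℝ => B * ∑ k, |m' k - m k|) (𝓝 m) (𝓝 0) := by
    have : Continuous fun m' : Fin 3 → ℝ => B * ∑ k, |m' k - m k| := by fun_prop
    simpa using this.tendsto m
  refine tendsto_iff_norm_sub_tendsto_zero.2 ?_
  exact squeeze_zero (fun _ => norm_nonneg _) (fun m' => h.lipschitz m' m) h1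

theorem mono (h : IsValueLike B F) (hB : B ≤ B') : IsValueLike B' F where
  smul := h.smul
  add_le := h.add_le
  lipschitz m m' := (h.lipschitz m m').trans
    (mul_le_mul_of_nonneg_right hB (sum_nonneg fun _ _ => abs_nonneg _))
  anti := h.anti

theorem zero : IsValueLike 0 fun _ => 0 where
  smul := by simp
  add_le := by simp
  lipschitz := by simp
  anti := by simp

theorem linear {c : Fin 3 → ℝ} (hc : ∀ k, |c k| ≤ B)
    (hanti : ∀ m m' : Fin 3 → ℝ, (∀ k, 0 ≤ m k) → (∀ k, 0 ≤ m' k) → MLR m m' →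
      (∑ k, m' k * c k) * ∑ k, m k ≤ (∑ k, m k * c k) * ∑ k, m' k) :
    IsValueLike B fun m => ∑ k, m k * c k where
  smul a _ m := by simp [mul_sum, mul_assoc]
  add_le m m' := by simp [add_mul, sum_add_distrib]
  lipschitz m m' := by
    rw [← sum_sub_distrib, mul_sum]
    refine (abs_sum_le_sum_abs _ _).trans (sum_le_sum fun k _ => ?_)
    rw [← sub_mul, abs_mul, mul_comm]
    exact mul_le_mul_of_nonneg_right (hc k) (abs_nonneg _)
  anti := hanti

theorem add (h : IsValueLike B F) (h' : IsValueLike B' F') :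
    IsValueLike (B + B') fun m => F m + F' m where
  smul c hc m := by rw [h.smul c hc, h'.smul c hc, mul_add]
  add_le m m' := by linarith [h.add_le m m', h'.add_le m m']
  lipschitz m m' := by
    have h1 := h.lipschitz m m'
    have h2 := h'.lipschitz m m'
    rw [add_mul, add_sub_add_comm]
    exact (abs_add_le _ _).trans (add_le_add h1 h2)
  anti m m' hm hm' hl := by
    have h1 := h.anti m m' hm hm' hl
    have h2 := h'.anti m m' hm hm' hl
    linarith

theorem const_mul (h : IsValueLike B F) {c : ℝ} (hc : 0 ≤ c) :
    IsValueLike (c * B) fun m => c * F m where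
  smul a ha m := by rw [h.smul a ha]; ring
  add_le m m' := by
    rw [← mul_add]
    exact mul_le_mul_of_nonneg_left (h.add_le m m') hc
  lipschitz m m' := by
    rw [← mul_sub, abs_mul, abs_of_nonneg hc, mul_assoc]
    exact mul_le_mul_of_nonneg_left (h.lipschitz m m') hc
  anti m m' hm hm' hl := by
    rw [mul_assoc, mul_assoc]
    exact mul_le_mul_of_nonneg_left (h.anti m m' hm hm' hl) hc

theorem sum {ι : Type} (s : Finset ι) {w : ι → ℝ} (hw : ∀ i, 0 ≤ w i)
    {F : ι → (Fin 3 → ℝ) → ℝ} (h : ∀ i, IsValueLike B (F i)) :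
    IsValueLike ((∑ i ∈ s, w i) * B) fun m => ∑ i ∈ s, w i * F i m := by
  classical
  induction s using Finset.induction_on with
  | empty => simpa using zero
  | insert i s hi ih =>
    have := ((h i).const_mul (hw i)).add ih
    simpa [sum_insert hi, add_mul] using this

theorem average {ι : Type} [Fintype ι] (p : FinDist ι) {F : ι → (Fin 3 → ℝ) → ℝ}
    (h : ∀ i, IsValueLike B (F i)) : IsValueLike B fun m => ∑ i, p i * F i m := by
  simpa [FinDist.sum_eq_one] using sum univ p.nonneg h

theorem sup' {ι : Type} {s : Finset ι} (hs : s.Nonempty) {F : ι → (Fin 3 → ℝ) → ℝ}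
    (h : ∀ i, IsValueLike B (F i)) : IsValueLike B fun m => s.sup' hs fun i => F i m where
  smul c hc m := by
    simp only [(h _).smul c hc]
    refine le_antisymm (sup'_le _ _ fun i hi => ?_) ?_
    · exact mul_le_mul_of_nonneg_left (le_sup' (fun i => F i m) hi) hc
    · obtain ⟨i, hi, e⟩ := exists_mem_eq_sup' hs fun i => F i m
      rw [e]
      exact le_sup' (fun i => c * F i m) hi
  add_le m m' := sup'_le _ _ fun i hi => ((h i).add_le m m').trans
    (add_le_add (le_sup' (fun i => F i m) hi) (le_sup' (fun i => F i m') hi))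
  lipschitz m m' := by
    have key : ∀ m m', s.sup' hs (fun i => F i m) - s.sup' hs (fun i => F i m')
        ≤ B * ∑ k, |m k - m' k| := by
      intro m m'
      rw [sub_le_iff_le_add]
      refine sup'_le _ _ fun i hi => ?_
      have h1 := (le_abs_self _).trans ((h i).lipschitz m m')
      have h2 := le_sup' (fun i => F i m') hi
      linarith
    rw [abs_le']
    refine ⟨key m m', ?_⟩
    rw [neg_sub]
    simpa only [abs_sub_comm] using key m' m
  anti m m' hm hm' hl := by
    -- An index that is optimal at `m'` is a competitor at `m`.
    obtain ⟨i, hi, e⟩ := exists_mem_eq_sup' hs fun i => F i m'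
    rw [e]
    refine ((h i).anti m m' hm hm' hl).trans ?_
    exact mul_le_mul_of_nonneg_right (le_sup' (fun i => F i m) hi) (sum_nonneg fun k _ => hm' k)

/-- The defining properties are equations and weak inequalities, so they survive pointwise limits as
long as `B` does not depend on `n`. -/
theorem of_tendsto {F : ℕ → (Fin 3 → ℝ) → ℝ} {G : (Fin 3 → ℝ) → ℝ} (h : ∀ n, IsValueLike B (F n))
    (hG : ∀ m, Tendsto (fun n => F n m) atTop (𝓝 (G m))) : IsValueLike B G where
  smul c hc m := tendsto_nhds_unique (hG _)
    (((hG m).const_mul c).congr fun n => ((h n).smul c hc m).symm)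
  add_le m m' := le_of_tendsto_of_tendsto' (hG _) ((hG m).add (hG m')) fun n => (h n).add_le m m'
  lipschitz m m' := le_of_tendsto' ((hG m).sub (hG m')).abs fun n => (h n).lipschitz m m'
  anti a b ha hb hl := le_of_tendsto_of_tendsto' ((hG b).mul_const _) ((hG a).mul_const _)
    fun n => (h n).anti a b ha hb hl

/-- A transition of the state that preserves the monotone likelihood ratio order. -/
theorem comp_transition (h : IsValueLike B F) (hB : 0 ≤ B) {P : Fin 3 → FinDist (Fin 3)}
    (hP : ∀ m m' : Fin 3 → ℝ, (∀ k, 0 ≤ m k) → (∀ k, 0 ≤ m' k) → MLR m m' →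
      MLR (fun k => ∑ j, m j * P j k) (fun k => ∑ j, m' j * P j k)) :
    IsValueLike B fun m => F fun k => ∑ j, m j * P j k where
  smul c hc m := by
    rw [← h.smul c hc]
    congr 1
    funext k
    simp [mul_sum, mul_assoc]
  add_le m m' := by
    refine le_trans (le_of_eq ?_) (h.add_le _ _)
    congr 1
    funext k
    simp [add_mul, sum_add_distrib]
  lipschitz m m' := by
    refine (h.lipschitz _ _).trans (mul_le_mul_of_nonneg_left ?_ hB)
    calc ∑ k, |∑ j, m j * P j k - ∑ j, m' j * P j k|
        ≤ ∑ k, ∑ j, |m j - m' j| * P j k := by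
          refine sum_le_sum fun k _ => ?_
          rw [← sum_sub_distrib]
          refine (abs_sum_le_sum_abs _ _).trans (sum_le_sum fun j _ => ?_)
          rw [← sub_mul, abs_mul, abs_of_nonneg ((P j).nonneg k)]
      _ = ∑ j, |m j - m' j| := by
          rw [sum_comm]
          simp only [← mul_sum, FinDist.sum_eq_one, mul_one]
  anti m m' hm hm' hl := by
    have hs : ∀ m : Fin 3 → ℝ, ∑ k, ∑ j, m j * P j k = ∑ j, m j := by
      intro m
      rw [sum_comm]
      simp only [← mul_sum, FinDist.sum_eq_one, mul_one]
    have := h.anti _ _ (fun k => sum_nonneg fun j _ => mul_nonneg (hm j) ((P j).nonneg k))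
      (fun k => sum_nonneg fun j _ => mul_nonneg (hm' j) ((P j).nonneg k)) (hP m m' hm hm' hl)
    rwa [hs, hs] at this

/-- Total positivity makes the likelihoods of the observations ordered. -/
theorem sum_mul_sum_le {m m' a b : Fin 3 → ℝ} (hl : MLR m m') (hab : MLR a b) :
    (∑ k, m k * b k) * ∑ k, m' k * a k ≤ (∑ k, m k * a k) * ∑ k, m' k * b k := by
  -- By the Binet–Cauchy identity, the difference of the two sides is the sum over `k < l` of
  -- products of second-order minors.
  have h1 := mul_nonneg (sub_nonneg.2 (hl 0 1 (by decide))) (sub_nonneg.2 (hab 0 1 (by decide)))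
  have h2 := mul_nonneg (sub_nonneg.2 (hl 0 2 (by decide))) (sub_nonneg.2 (hab 0 2 (by decide)))
  have h3 := mul_nonneg (sub_nonneg.2 (hl 1 2 (by decide))) (sub_nonneg.2 (hab 1 2 (by decide)))
  simp only [Fin.sum_univ_three]
  linarith

/-- With positive masses, `x ≥ p * (y / q)` and `y' ≤ q' * (x' / p')` bound the sum below by `(p' *
q - p * q') * (x' / p' - y / q)`, a product of nonnegative factors. If `p` or `q'` vanishes, the
first difference is zero and `hc` suffices. In the application, unprimed and primed letters belong
to two observations, `x, p` to the first prior and `y, q` to the second. -/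
theorem pair_nonneg {x x' y y' p p' q q' : ℝ} (hp : 0 ≤ p) (hp' : 0 ≤ p') (hq : 0 ≤ q)
    (hq' : 0 ≤ q') (hx : p = 0 → x = 0) (hy' : q' = 0 → y' = 0) (hxy : y * p ≤ x * q)
    (hxy' : y' * p' ≤ x' * q') (hc : y * p' ≤ x' * q) (hd : p * q' ≤ p' * q) :
    0 ≤ x * q' - y' * p + (x' * q - y * p') := by
  rcases hp.eq_or_lt with hp0 | hp0
  · rw [hx hp0.symm, ← hp0]
    linarith
  rcases hq'.eq_or_lt with hq0 | hq0
  · rw [hy' hq0.symm, ← hq0]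
    linarith
  have h1 : 0 < p' * q := (mul_pos hp0 hq0).trans_le hd
  have hp0' : 0 < p' := by
    rcases hp'.eq_or_lt with h | h
    · rw [← h, zero_mul] at h1
      exact absurd h1 (lt_irrefl _)
    · exact h
  have hq0' : 0 < q := by
    rcases hq.eq_or_lt with h | h
    · rw [← h, mul_zero] at h1
      exact absurd h1 (lt_irrefl _)
    · exact h
  have e1 : y / q * p ≤ x := by
    rw [div_mul_eq_mul_div, div_le_iff₀ hq0']
    exact hxy
  have e2 : y' ≤ x' / p' * q' := by
    rw [div_mul_eq_mul_div, le_div_iff₀ hp0']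
    exact hxy'
  have e3 : y / q ≤ x' / p' := by
    rw [div_le_div_iff₀ hq0' hp0']
    exact hc
  have f1 := mul_le_mul_of_nonneg_right e1 hq'
  have f2 := mul_le_mul_of_nonneg_right e2 hp
  have f3 := mul_nonneg (sub_nonneg.2 e3) (sub_nonneg.2 hd)
  have g1 : x' = x' / p' * p' := (div_mul_cancel₀ _ hp0'.ne').symm
  have g2 : y = y / q * q := (div_mul_cancel₀ _ hq0'.ne').symm
  have g3 : x' * q - y * p' = (x' / p' - y / q) * (p' * q) := by
    rw [sub_mul, ← mul_assoc, ← g1, mul_comm p', ← mul_assoc, ← g2]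
  rw [g3]
  nlinarith [f1, f2, f3]

/-- An observation whose likelihoods are totally positive of order 2. -/
theorem comp_observation {O : Type} [Fintype O] [LinearOrder O] (h : IsValueLike B F)
    {L : Fin 3 → FinDist O} (hL : ∀ o o', o ≤ o' → MLR (fun k => L k o) (fun k => L k o')) :
    IsValueLike B fun m => ∑ o, F fun k => m k * L k o where
  smul c hc m := by
    rw [mul_sum]
    refine sum_congr rfl fun o _ => ?_
    rw [← h.smul c hc]
    congr 1
    funext k
    simp [mul_assoc]
  add_le m m' := by
    rw [← sum_add_distrib]
    refine sum_le_sum fun o _ => le_trans (le_of_eq ?_) (h.add_le _ _)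
    congr 1
    funext k
    simp [add_mul]
  lipschitz m m' := by
    rw [← sum_sub_distrib]
    calc |∑ o, ((F fun k => m k * L k o) - F fun k => m' k * L k o)|
        ≤ ∑ o, B * ∑ k, |m k - m' k| * L k o := by
          refine (abs_sum_le_sum_abs _ _).trans (sum_le_sum fun o _ => ?_)
          refine (h.lipschitz _ _).trans (le_of_eq ?_)
          congr 1
          refine sum_congr rfl fun k _ => ?_
          rw [← sub_mul, abs_mul, abs_of_nonneg ((L k).nonneg o)]
      _ = B * ∑ k, |m k - m' k| := by
          rw [← mul_sum, sum_comm]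
          simp only [← mul_sum, FinDist.sum_eq_one, mul_one]
  anti m m' hm hm' hl := by
    have hs : ∀ m : Fin 3 → ℝ, ∑ k, m k = ∑ o, ∑ k, m k * L k o := by
      intro m
      rw [sum_comm]
      simp only [← mul_sum, FinDist.sum_eq_one, mul_one]
    have hnn : ∀ m : Fin 3 → ℝ, (∀ k, 0 ≤ m k) → ∀ o k, 0 ≤ m k * L k o :=
      fun m hm o k => mul_nonneg (hm k) ((L k).nonneg o)
    have h0 : ∀ m : Fin 3 → ℝ, (∀ k, 0 ≤ m k) → ∀ o, ∑ k, m k * L k o = 0 →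
        (F fun k => m k * L k o) = 0 := by
      intro m hm o ho
      rw [sum_eq_zero_iff_of_nonneg fun k _ => hnn m hm o k] at ho
      rw [← h.map_zero]
      congr 1
      funext k
      exact ho k (mem_univ k)
    have hlo : ∀ o o', o ≤ o' → MLR (fun k => m k * L k o) (fun k => m' k * L k o') := by
      intro o o' ho k l hkl
      have h1 := mul_le_mul (hl k l hkl) (hL o o' ho k l hkl)
        (mul_nonneg ((L l).nonneg o) ((L k).nonneg o')) (mul_nonneg (hm k) (hm' l))
      simp only
      linarith
    have ha : ∀ o o', o ≤ o' → (F fun k => m' k * L k o') * (∑ k, m k * L k o)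
        ≤ (F fun k => m k * L k o) * ∑ k, m' k * L k o' :=
      fun o o' ho => h.anti _ _ (hnn m hm o) (hnn m' hm' o') (hlo o o' ho)
    rw [hs m, hs m', sum_mul_sum, sum_mul_sum]
    rw [sum_comm, ← sub_nonneg, ← sum_sub_distrib]
    simp only [← sum_sub_distrib]
    -- Both sides are double sums over the observation under `m` and the one under `m'`. The term `D
    -- o o'` is nonnegative for `o ≤ o'` but may be negative otherwise, so it is paired with its
    -- mirror image.
    set D : O → O → ℝ := fun o o' => (F fun k => m k * L k o) * ∑ k, m' k * L k o'
      - (F fun k => m' k * L k o') * ∑ k, m k * L k o with hD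
    have hpair : ∀ o o', o' ≤ o → 0 ≤ D o o' + D o' o := by
      intro o o' ho
      exact pair_nonneg (sum_nonneg fun k _ => hnn m hm o k) (sum_nonneg fun k _ => hnn m hm o' k)
        (sum_nonneg fun k _ => hnn m' hm' o k) (sum_nonneg fun k _ => hnn m' hm' o' k)
        (h0 m hm o) (h0 m' hm' o') (ha o o le_rfl) (ha o' o' le_rfl) (ha o' o ho)
        (sum_mul_sum_le hl (hL o' o ho))
    have h2 : 0 ≤ ∑ o, ∑ o', (D o o' + D o' o) := sum_nonneg fun o _ => sum_nonneg fun o' _ => by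
      rcases le_total o' o with ho | ho
      · exact hpair o o' ho
      · rw [add_comm]
        exact hpair o' o ho
    have h3 : ∑ o, ∑ o', (D o o' + D o' o) = 2 * ∑ o, ∑ o', D o o' := by
      simp only [sum_add_distrib]
      rw [sum_comm (f := fun o o' => D o' o)]
      ring
    change 0 ≤ ∑ o, ∑ o', D o o'
    linarith

end IsValueLike

end IntrusionResponse

end

noncomputable section

namespace IntrusionResponse

open Finset Filter Topology

/-! ### Switching curves -/

theorem sum_ray (x ε : ℝ) : ∑ k, ray x ε k = 1 := by
  simp only [ray, Fin.sum_univ_three, Matrix.cons_val_zero, Matrix.cons_val_one, Matrix.cons_val]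
  ring

theorem ray_nonneg {x ε : ℝ} (hx : x ∈ Set.Icc (0 : ℝ) 1) (hε : ε ∈ Set.Icc (0 : ℝ) 1)
    (k : Fin 3) : 0 ≤ ray x ε k := by
  fin_cases k
  · exact sub_nonneg.2 hε.2
  · exact mul_nonneg hε.1 (sub_nonneg.2 hx.2)
  · exact mul_nonneg hε.1 hx.1

theorem ray_mem_stdSimplex {x ε : ℝ} (hx : x ∈ Set.Icc (0 : ℝ) 1) (hε : ε ∈ Set.Icc (0 : ℝ) 1) :
    ray x ε ∈ stdSimplex ℝ (Fin 3) := ⟨ray_nonneg hx hε, sum_ray x ε⟩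

theorem exists_eq_ray {b : Fin 3 → ℝ} (hb : b ∈ stdSimplex ℝ (Fin 3)) :
    ∃ x ∈ Set.Icc (0 : ℝ) 1, ∃ ε ∈ Set.Icc (0 : ℝ) 1, b = ray x ε := by
  have h0 := hb.1 0
  have h1 := hb.1 1
  have h2 := hb.1 2
  have hs := hb.2
  rw [Fin.sum_univ_three] at hs
  by_cases hε : b 1 + b 2 = 0
  -- At `e₁` the direction `x` is arbitrary.
  · refine ⟨0, by simp, 0, by simp, ?_⟩
    funext k
    fin_cases k <;> simp [ray] <;> linarith
  · have hpos : 0 < b 1 + b 2 := lt_of_le_of_ne (by linarith) (Ne.symm hε)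
    refine ⟨b 2 / (b 1 + b 2), ⟨by positivity, ?_⟩, b 1 + b 2, ⟨hpos.le, by linarith⟩, ?_⟩
    · rw [div_le_one hpos]
      linarith
    · funext k
      fin_cases k
      · simp [ray]
        linarith
      · simp [ray]
        field_simp
        ring
      · simp [ray]
        field_simp

/-- Moving away from `e₁` keeps the proportion of the levels 1 and 2 fixed and only shifts mass to
them from level 0. -/
theorem mlr_ray {x ε ε' : ℝ} (hx : x ∈ Set.Icc (0 : ℝ) 1) (h : ε ≤ ε') :
    MLR (ray x ε) (ray x ε') := by
  have h1 := mul_nonneg (sub_nonneg.2 hx.2) (sub_nonneg.2 h)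
  have h2 := mul_nonneg hx.1 (sub_nonneg.2 h)
  intro k l hkl
  fin_cases k <;> fin_cases l <;> simp [ray] at hkl ⊢ <;> nlinarith [h1, h2]

theorem continuous_ray : Continuous fun p : ℝ × ℝ => ray p.1 p.2 := by
  refine continuous_pi fun k => ?_
  fin_cases k <;> simp [ray] <;> fun_prop

/-! ### Sublevel sets of value-like functions -/

namespace IsValueLike

variable {B : ℝ} {F : (Fin 3 → ℝ) → ℝ}

theorem ray_antitone (h : IsValueLike B F) {x ε ε' : ℝ} (hx : x ∈ Set.Icc (0 : ℝ) 1)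
    (hε : ε ∈ Set.Icc (0 : ℝ) 1) (hε' : ε' ∈ Set.Icc (0 : ℝ) 1) (hle : ε ≤ ε') :
    F (ray x ε') ≤ F (ray x ε) := by
  simpa [sum_ray] using h.anti _ _ (ray_nonneg hx hε) (ray_nonneg hx hε') (mlr_ray hx hle)

theorem combo_nonpos (h : IsValueLike B F) {b b' : Fin 3 → ℝ} (hb : F b ≤ 0) (hb' : F b' ≤ 0)
    {t t' : ℝ} (ht : 0 ≤ t) (ht' : 0 ≤ t') : F (t • b + t' • b') ≤ 0 := by
  refine (h.add_le _ _).trans ?_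
  rw [h.smul t ht, h.smul t' ht']
  exact add_nonpos (mul_nonpos_of_nonneg_of_nonpos ht hb) (mul_nonpos_of_nonneg_of_nonpos ht' hb')

open Classical in
/-- The point where the segment from `e₁` in direction `x` enters the set `F ≤ 0`, and `2` if it
misses that set. -/
def curve (F : (Fin 3 → ℝ) → ℝ) (x : ℝ) : ℝ :=
  if F (ray x 1) ≤ 0 then sInf {ε | ε ∈ Set.Icc (0 : ℝ) 1 ∧ F (ray x ε) ≤ 0} else 2

/-- By continuity of `F` the infimum is over a compact set and is attained. -/
theorem curve_mem (h : IsValueLike B F) {x : ℝ} (hx : F (ray x 1) ≤ 0) :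
    curve F x ∈ Set.Icc (0 : ℝ) 1 ∧ F (ray x (curve F x)) ≤ 0 := by
  rw [curve, if_pos hx]
  have hc : IsCompact {ε | ε ∈ Set.Icc (0 : ℝ) 1 ∧ F (ray x ε) ≤ 0} := by
    have e : {ε | ε ∈ Set.Icc (0 : ℝ) 1 ∧ F (ray x ε) ≤ 0}
        = Set.Icc 0 1 ∩ {ε | F (ray x ε) ≤ 0} := Set.ext fun _ => Iff.rfl
    rw [e]
    refine isCompact_Icc.inter_right (isClosed_le ?_ continuous_const)
    exact h.continuous.comp (continuous_ray.comp (by fun_prop : Continuous fun ε : ℝ => (x, ε)))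
  exact hc.sInf_mem ⟨1, by simp, hx⟩

theorem curve_le_of_nonpos {x ε : ℝ} (hx : F (ray x 1) ≤ 0) (hε : ε ∈ Set.Icc (0 : ℝ) 1)
    (hF : F (ray x ε) ≤ 0) : curve F x ≤ ε := by
  rw [curve, if_pos hx]
  exact csInf_le ⟨0, fun _ hy => hy.1.1⟩ ⟨hε, hF⟩

theorem nonpos_iff_curve_le (h : IsValueLike B F) {x ε : ℝ} (hx : x ∈ Set.Icc (0 : ℝ) 1)
    (hε : ε ∈ Set.Icc (0 : ℝ) 1) : F (ray x ε) ≤ 0 ↔ curve F x ≤ ε := by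
  constructor
  · intro hF
    exact curve_le_of_nonpos ((h.ray_antitone hx hε (by simp) hε.2).trans hF) hε hF
  · intro hle
    by_cases h1 : F (ray x 1) ≤ 0
    · obtain ⟨h2, h3⟩ := h.curve_mem h1
      exact (h.ray_antitone hx h2 hε hle).trans h3
    · rw [curve, if_neg h1] at hle
      linarith [hε.2]

/-- Seen from `e₁`, the set `F ≤ 0` lies above the chord from the curve at `x₀` to the side
opposite to `e₁` at `x₁`. -/
theorem curve_le_chord (h : IsValueLike B F) {x₀ x₁ s : ℝ} (hx₀ : x₀ ∈ Set.Icc (0 : ℝ) 1)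
    (hx₁ : x₁ ∈ Set.Icc (0 : ℝ) 1) (h₀ : F (ray x₀ 1) ≤ 0) (h₁ : F (ray x₁ 1) ≤ 0)
    (hs : s ∈ Set.Icc (0 : ℝ) 1) (hpos : 0 < curve F x₀) :
    curve F ((1 - s) * x₀ + s * x₁) ≤ curve F x₀ / ((1 - s) + s * curve F x₀) := by
  obtain ⟨hc, hF⟩ := h.curve_mem h₀
  set c := curve F x₀ with hcdef
  have hden : 0 < (1 - s) + s * c := by
    rcases hs.2.eq_or_lt with h1 | h1
    · rw [h1]
      linarith
    · have := mul_nonneg hs.1 hpos.le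
      linarith
  have hx : (1 - s) * x₀ + s * x₁ ∈ Set.Icc (0 : ℝ) 1 := by
    have a1 := sub_nonneg.2 hs.2
    constructor
    · exact add_nonneg (mul_nonneg a1 hx₀.1) (mul_nonneg hs.1 hx₁.1)
    · nlinarith [mul_nonneg a1 (sub_nonneg.2 hx₀.2), mul_nonneg hs.1 (sub_nonneg.2 hx₁.2)]
  have hε : c / ((1 - s) + s * c) ∈ Set.Icc (0 : ℝ) 1 := by
    refine ⟨by positivity, ?_⟩
    rw [div_le_one hden]
    nlinarith [mul_nonneg (sub_nonneg.2 hs.2) (sub_nonneg.2 hc.2)]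
  rw [← h.nonpos_iff_curve_le hx hε]
  -- The mass off `e₁` is `c` at one endpoint and `1` at the other, so the weights must be in the
  -- ratio `(1 - s) : s * c` for the directions to mix as `(1 - s) : s`.
  have key : ray ((1 - s) * x₀ + s * x₁) (c / ((1 - s) + s * c))
      = ((1 - s) / ((1 - s) + s * c)) • ray x₀ c + (s * c / ((1 - s) + s * c)) • ray x₁ 1 := by
    obtain ⟨D, hD⟩ : ∃ D, D = (1 - s) + s * c := ⟨_, rfl⟩
    rw [← hD] at hden ⊢
    have hne := hden.ne'
    funext k
    fin_cases k
    · simp [ray]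
      field_simp
      linear_combination hD
    · simp [ray]
      field_simp
      ring
    · simp [ray]
      field_simp
  rw [key]
  exact h.combo_nonpos hF h₁ (div_nonneg (sub_nonneg.2 hs.2) hden.le)
    (div_nonneg (mul_nonneg hs.1 hpos.le) hden.le)

/-- The curve is upper semicontinuous along segments. -/
theorem eventually_curve_lt (h : IsValueLike B F) {x₀ x₁ e : ℝ} (hx₀ : x₀ ∈ Set.Icc (0 : ℝ) 1)
    (hx₁ : x₁ ∈ Set.Icc (0 : ℝ) 1) (h₀ : F (ray x₀ 1) ≤ 0) (h₁ : F (ray x₁ 1) ≤ 0)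
    (hpos : 0 < curve F x₀) (hne : x₀ ≠ x₁) (he : curve F x₀ < e) :
    ∀ᶠ x in 𝓝 x₀, (x - x₀) / (x₁ - x₀) ∈ Set.Icc (0 : ℝ) 1 → curve F x < e := by
  have hd : x₁ - x₀ ≠ 0 := sub_ne_zero.2 hne.symm
  set c := curve F x₀ with hcdef
  have hcont : ContinuousAt (fun x => c / ((1 - (x - x₀) / (x₁ - x₀)) +
      (x - x₀) / (x₁ - x₀) * c)) x₀ := by
    refine ContinuousAt.div continuousAt_const (by fun_prop) ?_
    simp
  have h2 : ∀ᶠ x in 𝓝 x₀, c / ((1 - (x - x₀) / (x₁ - x₀)) + (x - x₀) / (x₁ - x₀) * c) < e := by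
    refine hcont.eventually_lt continuousAt_const ?_
    simpa using he
  filter_upwards [h2] with x hx hs
  have h3 := h.curve_le_chord hx₀ hx₁ h₀ h₁ hs hpos
  have h4 : (1 - (x - x₀) / (x₁ - x₀)) * x₀ + (x - x₀) / (x₁ - x₀) * x₁ = x := by
    field_simp
    ring
  rw [h4] at h3
  exact h3.trans_lt hx

/-- Lower semicontinuity comes from the continuity of `F`, upper semicontinuity from the chord
bound, applied on each side of `x₀` separately. The chord bound needs a positive curve, so zeros are
treated first. -/
theorem continuousOn_curve (h : IsValueLike B F) :
    ContinuousOn (curve F) {x | x ∈ Set.Icc (0 : ℝ) 1 ∧ curve F x ≤ 1} := by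
  have hiff : ∀ x ∈ Set.Icc (0 : ℝ) 1, curve F x ≤ 1 → F (ray x 1) ≤ 0 :=
    fun x hx h1 => (h.nonpos_iff_curve_le hx (by simp)).2 h1
  rintro x₀ ⟨hx₀, hc₀⟩
  have h₀ := hiff x₀ hx₀ hc₀
  obtain ⟨hmem, hF⟩ := h.curve_mem h₀
  rcases hmem.1.eq_or_lt with hzero | hpos
  -- The curve reaches 0 only if `e₁` itself satisfies `F ≤ 0`, and all segments start at `e₁`.
  · have hall : ∀ x ∈ Set.Icc (0 : ℝ) 1, curve F x = 0 := by
      intro x hx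
      have e : ray x 0 = ray x₀ 0 := by
        funext k
        fin_cases k <;> simp [ray]
      have h1 : F (ray x 0) ≤ 0 := by
        rw [e]
        rwa [← hzero] at hF
      have h2 := (h.ray_antitone hx (by simp) (by simp) zero_le_one).trans h1
      exact le_antisymm (curve_le_of_nonpos h2 (by simp) h1) (h.curve_mem h2).1.1
    have : ContinuousOn (fun _ : ℝ => (0 : ℝ)) {x | x ∈ Set.Icc (0 : ℝ) 1 ∧ curve F x ≤ 1} :=
      continuousOn_const
    exact (this.congr fun x hx => hall x hx.1) x₀ ⟨hx₀, hc₀⟩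
  · refine tendsto_order.2 ⟨fun e he => ?_, fun e he => ?_⟩
    -- A segment has parameters in `[0, 1]` only, hence `max e 0` in place of `e`.
    · have hmax : max e 0 < curve F x₀ := max_lt he hpos
      have he01 : max e 0 ∈ Set.Icc (0 : ℝ) 1 := ⟨le_max_right _ _, (hmax.trans_le hc₀).le⟩
      have h1 : 0 < F (ray x₀ (max e 0)) := by
        by_contra hcon
        exact absurd ((h.nonpos_iff_curve_le hx₀ he01).1 (not_lt.1 hcon)) (not_le.2 hmax)
      have h2 : Continuous fun x => F (ray x (max e 0)) :=
        h.continuous.comp (continuous_ray.comp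
          (by fun_prop : Continuous fun x : ℝ => (x, max e 0)))
      have h3 : ∀ᶠ x in 𝓝 x₀, 0 < F (ray x (max e 0)) :=
        continuousAt_const.eventually_lt h2.continuousAt h1
      filter_upwards [nhdsWithin_le_nhds h3, self_mem_nhdsWithin] with x hx hxI
      by_contra hcon
      exact absurd ((h.nonpos_iff_curve_le hxI.1 he01).2 ((not_lt.1 hcon).trans (le_max_left _ _)))
        (not_le.2 hx)
    -- `T` is one side of `x₀`. If it contains a point `x₁` of the domain, the chord towards `x₁`
    -- bounds the curve near `x₀`; if not, there is nothing to show.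
    · have side : ∀ T : Set ℝ,
          (∀ x₁ ∈ T, ∀ᶠ x in 𝓝 x₀, x ∈ T → (x - x₀) / (x₁ - x₀) ∈ Set.Icc (0 : ℝ) 1) →
          x₀ ∉ T →
          ∀ᶠ x in 𝓝 x₀, x ∈ T → x ∈ Set.Icc (0 : ℝ) 1 ∧ curve F x ≤ 1 → curve F x < e := by
        intro T hT hx₀T
        by_cases hex : ∃ x₁ ∈ T, x₁ ∈ Set.Icc (0 : ℝ) 1 ∧ curve F x₁ ≤ 1
        · obtain ⟨x₁, hx₁T, hx₁, hc₁⟩ := hex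
          filter_upwards [hT x₁ hx₁T, h.eventually_curve_lt hx₀ hx₁ h₀ (hiff x₁ hx₁ hc₁) hpos
            (fun hh => hx₀T (hh ▸ hx₁T)) he] with x hx1 hx2 hxT _
          exact hx2 (hx1 hxT)
        · exact Eventually.of_forall fun x hxT hxI => absurd ⟨x, hxT, hxI⟩ hex
      have hr := side (Set.Ioi x₀) (fun x₁ hx₁ => by
        filter_upwards [Iio_mem_nhds (Set.mem_Ioi.1 hx₁)] with x hx hxT
        have d : 0 < x₁ - x₀ := sub_pos.2 hx₁
        exact ⟨div_nonneg (sub_nonneg.2 (le_of_lt hxT)) d.le,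
          (div_le_one d).2 (by linarith [Set.mem_Iio.1 hx])⟩) (by simp)
      have hl := side (Set.Iio x₀) (fun x₁ hx₁ => by
        filter_upwards [Ioi_mem_nhds (Set.mem_Iio.1 hx₁)] with x hx hxT
        have d : x₁ - x₀ < 0 := sub_neg.2 hx₁
        exact ⟨div_nonneg_of_nonpos (sub_nonpos.2 (le_of_lt hxT)) d.le,
          (div_le_one_of_neg d).2 (by linarith [Set.mem_Ioi.1 hx])⟩) (by simp)
      filter_upwards [nhdsWithin_le_nhds hr, nhdsWithin_le_nhds hl, self_mem_nhdsWithin]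
        with x h1 h2 hxI
      rcases lt_trichotomy x x₀ with hlt | heq | hgt
      · exact h2 hlt hxI
      · rw [heq]
        exact he
      · exact h1 hgt hxI

/-- The set of beliefs where a value-like function is not positive has a switching curve. -/
theorem hasSwitchingCurve (h : IsValueLike B F) :
    HasSwitchingCurve {b | b ∈ stdSimplex ℝ (Fin 3) ∧ F b ≤ 0} (curve F) := by
  refine ⟨fun b hb => hb.1, fun x hx ε hε => ?_, h.continuousOn_curve, ?_, ?_⟩
  · rw [← h.nonpos_iff_curve_le hx hε]
    exact and_iff_right (ray_mem_stdSimplex hx hε)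
  · apply Convex.isPreconnected
    intro b hb b' hb' t t' ht ht' htt
    exact ⟨convex_stdSimplex ℝ (Fin 3) hb.1 hb'.1 ht ht' htt, h.combo_nonpos hb.2 hb'.2 ht ht'⟩
  · rcases Set.eq_empty_or_nonempty
      (stdSimplex ℝ (Fin 3) \ {b | b ∈ stdSimplex ℝ (Fin 3) ∧ F b ≤ 0}) with he | hne
    · rw [he]
      exact isPreconnected_empty
    -- Sliding a belief towards `e₁` can only increase `F`, so the complement is star-shaped about
    -- `e₁`.
    have hstar : StarConvex ℝ (ray 0 0)
        (stdSimplex ℝ (Fin 3) \ {b | b ∈ stdSimplex ℝ (Fin 3) ∧ F b ≤ 0}) := by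
      rintro b ⟨hb, hFb⟩ t t' ht ht' htt
      obtain ⟨x, hx, ε, hε, rfl⟩ := exists_eq_ray hb
      have hε' : t' * ε ∈ Set.Icc (0 : ℝ) 1 :=
        ⟨mul_nonneg ht' hε.1, mul_le_one₀ (by linarith) hε.1 hε.2⟩
      have e : t • ray 0 0 + t' • ray x ε = ray x (t' * ε) := by
        have ht1 : t = 1 - t' := by linarith
        funext k
        fin_cases k <;> simp [ray, ht1] <;> ring
      rw [e]
      refine ⟨ray_mem_stdSimplex hx hε', fun hcon => hFb ⟨hb, ?_⟩⟩
      exact (h.ray_antitone hx hε' hε (mul_le_of_le_one_left hε.1 (by linarith))).trans hcon.2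
    exact (hstar.isPathConnected (hstar.mem hne)).isConnected.isPreconnected

end IsValueLike

theorem hasSwitchingCurve_empty : HasSwitchingCurve ∅ fun _ => 2 := by
  refine ⟨Set.empty_subset _, fun x _ ε hε => ?_, ?_, isPreconnected_empty, ?_⟩
  · exact ⟨fun h => absurd h (Set.notMem_empty _), fun h => by linarith [hε.2]⟩
  · exact continuousOn_const
  · rw [Set.sdiff_empty]
    exact (convex_stdSimplex ℝ (Fin 3)).isPreconnected

end IntrusionResponse

end

noncomputable section

namespace IntrusionResponse

open Finset Filter Topology

/-! ### Control of a hidden three-level state -/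

theorem FinDist.eq_zero_of_apply_eq_one {α : Type} [Fintype α] (p : FinDist α) {a b : α}
    (ha : p a = 1) (hb : b ≠ a) : p b = 0 := by
  classical
  have h1 := p.sum_eq_one
  rw [← add_sum_erase univ _ (mem_univ a), ha] at h1
  have h2 : ∑ x ∈ univ.erase a, p x = 0 := by linarith
  exact (sum_eq_zero_iff_of_nonneg fun x _ => p.nonneg x).1 h2 b (mem_erase.2 ⟨hb, mem_univ _⟩)

/-- A control problem with an observed zone and a hidden level, which every action other than the
null action resets and which otherwise increases at most by one step. -/
structure LevelProblem (Zn AD O : Type) [Fintype Zn] [Fintype AD] [Fintype O] [LinearOrder O] where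
  null : AD
  f : Zn → AD → FinDist Zn
  P : AD → Fin 3 → FinDist (Fin 3)
  L : Zn → Fin 3 → FinDist O
  base : Zn → ℝ
  cost : AD → ℝ
  γ : ℝ
  γ_nonneg : 0 ≤ γ
  γ_lt_one : γ < 1
  reset : ∀ d k, d ≠ null → P d k 0 = 1
  no_jump : P null 0 2 = 0
  no_return : P null 1 0 = 0
  stays : P null 2 2 = 1
  tp2 : ∀ z o o', o ≤ o' → MLR (fun k => L z k o) (fun k => L z k o')

namespace LevelProblem

variable {Zn AD O : Type} [Fintype Zn] [Fintype AD] [Fintype O] [LinearOrder O]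
  (R : LevelProblem Zn AD O)

/-- The reward at level `k`. -/
def reward (z : Zn) (d : AD) (k : Fin 3) : ℝ := R.base z - ind (k = 2) - R.cost d

/-- The unnormalized posterior distribution after the action `d`. -/
def update (d : AD) (z : Zn) (o : O) (m : Fin 3 → ℝ) : Fin 3 → ℝ :=
  fun k => (∑ j, m j * R.P d j k) * R.L z k o

/-- The expected value of the continuation after the action `d`. -/
def future (V : Zn → (Fin 3 → ℝ) → ℝ) (z : Zn) (d : AD) (m : Fin 3 → ℝ) : ℝ :=
  ∑ y, R.f z d y * ∑ o, V y (R.update d y o m)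

/-- The value of the action `d`. -/
def actionValue (V : Zn → (Fin 3 → ℝ) → ℝ) (z : Zn) (d : AD) (m : Fin 3 → ℝ) : ℝ :=
  ∑ k, m k * R.reward z d k + R.γ * R.future V z d m

/-- The Bellman operator. -/
def bellman (V : Zn → (Fin 3 → ℝ) → ℝ) (z : Zn) (m : Fin 3 → ℝ) : ℝ :=
  univ.sup' ⟨R.null, mem_univ _⟩ fun d => R.actionValue V z d m

/-- A bound of the rewards. -/
def rewardBound : ℝ := ∑ z, |R.base z| + 1 + ∑ d, |R.cost d|

/-- A bound of the values. -/
def valueBound : ℝ := R.rewardBound / (1 - R.γ)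

theorem rewardBound_nonneg : 0 ≤ R.rewardBound := by
  unfold rewardBound
  positivity

theorem valueBound_nonneg : 0 ≤ R.valueBound :=
  div_nonneg R.rewardBound_nonneg (sub_nonneg.2 R.γ_lt_one.le)

/-- As the fixed point of `B ↦ rewardBound + γ * B`, this constant is reproduced by a Bellman step,
which keeps the Lipschitz bound uniform along value iteration. -/
theorem rewardBound_add : R.rewardBound + R.γ * R.valueBound = R.valueBound := by
  have : 1 - R.γ ≠ 0 := (sub_pos.2 R.γ_lt_one).ne'
  unfold valueBound
  field_simp
  ring

theorem abs_reward_le (z : Zn) (d : AD) (k : Fin 3) : |R.reward z d k| ≤ R.rewardBound := by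
  have h1 := single_le_sum (f := fun z => |R.base z|) (fun _ _ => abs_nonneg _) (mem_univ z)
  have h2 := single_le_sum (f := fun d => |R.cost d|) (fun _ _ => abs_nonneg _) (mem_univ d)
  have h3 : |ind (k = 2)| ≤ 1 := by
    by_cases h : k = 2
    · simp [ind_pos h]
    · simp [ind_neg h]
  have h4 := abs_sub (R.base z - ind (k = 2)) (R.cost d)
  have h5 := abs_sub (R.base z) (ind (k = 2))
  unfold reward rewardBound
  linarith

theorem sum_mul_reward (z : Zn) (d : AD) (m : Fin 3 → ℝ) :
    ∑ k, m k * R.reward z d k = (R.base z - R.cost d) * ∑ k, m k - m 2 := by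
  simp [reward, Fin.sum_univ_three, ind]
  ring

theorem isValueLike_reward (z : Zn) (d : AD) :
    IsValueLike R.rewardBound fun m => ∑ k, m k * R.reward z d k := by
  refine IsValueLike.linear (R.abs_reward_le z d) fun m m' _ _ hl => ?_
  have := hl.apply_two_mul_sum_le
  rw [R.sum_mul_reward, R.sum_mul_reward]
  nlinarith [this]

theorem sum_mul_reset {d : AD} (hd : d ≠ R.null) (m : Fin 3 → ℝ) (k : Fin 3) :
    ∑ j, m j * R.P d j k = if k = 0 then ∑ j, m j else 0 := by
  split_ifs with hk
  · simp [hk, R.reset d _ hd]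
  · exact sum_eq_zero fun j _ => by
      rw [(R.P d j).eq_zero_of_apply_eq_one (R.reset d j hd) hk, mul_zero]

/-- Under the null action the transition matrix is upper bidiagonal with nonnegative entries, hence
has nonnegative second-order minors and preserves the order. A reset sends both vectors to multiples
of `e₁`. -/
theorem mlr_transition (d : AD) (m m' : Fin 3 → ℝ) (hl : MLR m m') :
    MLR (fun k => ∑ j, m j * R.P d j k) (fun k => ∑ j, m' j * R.P d j k) := by
  by_cases hd : d = R.null
  · subst hd
    have a20 := (R.P R.null 2).eq_zero_of_apply_eq_one R.stays (b := 0) (by decide)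
    have a21 := (R.P R.null 2).eq_zero_of_apply_eq_one R.stays (b := 1) (by decide)
    have n00 := (R.P R.null 0).nonneg 0
    have n01 := (R.P R.null 0).nonneg 1
    have n11 := (R.P R.null 1).nonneg 1
    have n12 := (R.P R.null 1).nonneg 2
    have m01 := sub_nonneg.2 (hl 0 1 (by decide))
    have m02 := sub_nonneg.2 (hl 0 2 (by decide))
    have m12 := sub_nonneg.2 (hl 1 2 (by decide))
    have p1 := mul_nonneg (mul_nonneg n00 n11) m01
    have p2 := mul_nonneg (mul_nonneg n00 n12) m01
    have p3 := mul_nonneg n00 m02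
    have p4 := mul_nonneg (mul_nonneg n01 n12) m01
    have p5 := mul_nonneg n01 m02
    have p6 := mul_nonneg n11 m12
    intro k l hkl
    simp only [Fin.sum_univ_three]
    fin_cases k <;> fin_cases l <;>
      first
      | exact absurd hkl (by decide)
      | (simp only [Fin.zero_eta, Fin.mk_one, Fin.reduceFinMk, a20, a21, R.stays, R.no_jump,
          R.no_return]; linarith)
  · intro k l hkl
    simp only [R.sum_mul_reset hd]
    by_cases hk : k = 0 <;> by_cases hl : l = 0 <;> simp [hk, hl, mul_comm]

theorem isValueLike_future {B : ℝ} (hB : 0 ≤ B) {V : Zn → (Fin 3 → ℝ) → ℝ}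
    (hV : ∀ z, IsValueLike B (V z)) (z : Zn) (d : AD) : IsValueLike B (R.future V z d) := by
  refine IsValueLike.average (R.f z d) fun z' => ?_
  exact ((hV z').comp_observation (R.tp2 z')).comp_transition hB fun m m' _ _ hl =>
    R.mlr_transition d m m' hl

theorem isValueLike_actionValue {V : Zn → (Fin 3 → ℝ) → ℝ}
    (hV : ∀ z, IsValueLike R.valueBound (V z)) (z : Zn) (d : AD) :
    IsValueLike R.valueBound (R.actionValue V z d) := by
  rw [← R.rewardBound_add]
  exact (R.isValueLike_reward z d).add
    ((R.isValueLike_future R.valueBound_nonneg hV z d).const_mul R.γ_nonneg)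

/-! ### Value iteration and the optimal value -/

/-- Value iteration. -/
def valueIter : ℕ → Zn → (Fin 3 → ℝ) → ℝ
  | 0 => fun _ _ => 0
  | n + 1 => R.bellman (valueIter n)

theorem isValueLike_valueIter : ∀ n z, IsValueLike R.valueBound (R.valueIter n z)
  | 0, _ => IsValueLike.zero.mono R.valueBound_nonneg
  | n + 1, z => IsValueLike.sup' ⟨R.null, mem_univ _⟩ fun d =>
      R.isValueLike_actionValue (isValueLike_valueIter n) z d

/-- Homogeneous functions are unbounded, so distances are taken relative to the `ℓ¹` norm of `m`.
For each next zone, the updates of `m` over all observations have total `ℓ¹` norm at most that of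
`m`. -/
theorem abs_future_sub_le {V V' : Zn → (Fin 3 → ℝ) → ℝ} {c : ℝ} (hc : 0 ≤ c)
    (h : ∀ z m, |V z m - V' z m| ≤ c * ∑ k, |m k|) (z : Zn) (d : AD) (m : Fin 3 → ℝ) :
    |R.future V z d m - R.future V' z d m| ≤ c * ∑ k, |m k| := by
  unfold future
  rw [← sum_sub_distrib]
  calc |∑ z', (R.f z d z' * ∑ o, V z' (R.update d z' o m)
        - R.f z d z' * ∑ o, V' z' (R.update d z' o m))|
      ≤ ∑ z', R.f z d z' * (c * ∑ k, |m k|) := by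
        refine (abs_sum_le_sum_abs _ _).trans (sum_le_sum fun z' _ => ?_)
        rw [← mul_sub, abs_mul, abs_of_nonneg ((R.f z d).nonneg z'), ← sum_sub_distrib]
        refine mul_le_mul_of_nonneg_left ?_ ((R.f z d).nonneg z')
        calc |∑ o, (V z' (R.update d z' o m) - V' z' (R.update d z' o m))|
            ≤ ∑ o, c * ∑ k, |∑ j, m j * R.P d j k| * R.L z' k o := by
              refine (abs_sum_le_sum_abs _ _).trans (sum_le_sum fun o _ => ?_)
              refine (h _ _).trans (le_of_eq ?_)
              congr 1
              refine sum_congr rfl fun k _ => ?_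
              rw [update, abs_mul, abs_of_nonneg ((R.L z' k).nonneg o)]
          _ = c * ∑ k, |∑ j, m j * R.P d j k| := by
              rw [← mul_sum, sum_comm]
              simp only [← mul_sum, FinDist.sum_eq_one, mul_one]
          _ ≤ c * ∑ k, ∑ j, |m j| * R.P d j k := by
              refine mul_le_mul_of_nonneg_left (sum_le_sum fun k _ => ?_) hc
              refine (abs_sum_le_sum_abs _ _).trans (sum_le_sum fun j _ => ?_)
              rw [abs_mul, abs_of_nonneg ((R.P d j).nonneg k)]
          _ = c * ∑ k, |m k| := by
              rw [sum_comm]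
              simp only [← mul_sum, FinDist.sum_eq_one, mul_one]
    _ = c * ∑ k, |m k| := by rw [← sum_mul, FinDist.sum_eq_one, one_mul]

/-- The Bellman operator is a contraction. -/
theorem abs_bellman_sub_le {V V' : Zn → (Fin 3 → ℝ) → ℝ} {c : ℝ} (hc : 0 ≤ c)
    (h : ∀ z m, |V z m - V' z m| ≤ c * ∑ k, |m k|) (z : Zn) (m : Fin 3 → ℝ) :
    |R.bellman V z m - R.bellman V' z m| ≤ R.γ * c * ∑ k, |m k| := by
  have key : ∀ V V' : Zn → (Fin 3 → ℝ) → ℝ, (∀ z m, |V z m - V' z m| ≤ c * ∑ k, |m k|) →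
      R.bellman V z m - R.bellman V' z m ≤ R.γ * c * ∑ k, |m k| := by
    intro V V' h
    rw [sub_le_iff_le_add]
    refine sup'_le _ _ fun d hd => ?_
    have h1 := mul_le_mul_of_nonneg_left
      ((le_abs_self _).trans (R.abs_future_sub_le hc h z d m)) R.γ_nonneg
    have h2 : R.actionValue V' z d m ≤ R.bellman V' z m :=
      le_sup' (fun d => R.actionValue V' z d m) hd
    unfold actionValue at h2 ⊢
    linarith
  rw [abs_le']
  refine ⟨key V V' h, ?_⟩
  rw [neg_sub]
  exact key V' V fun z m => by
    rw [abs_sub_comm]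
    exact h z m

theorem abs_valueIter_succ_sub_le : ∀ n z m,
    |R.valueIter (n + 1) z m - R.valueIter n z m| ≤ R.γ ^ n * R.valueBound * ∑ k, |m k|
  | 0, z, m => by
    have := (R.isValueLike_valueIter 1 z).abs_le m
    simpa [valueIter] using this
  | n + 1, z, m => by
    have := R.abs_bellman_sub_le (mul_nonneg (pow_nonneg R.γ_nonneg n) R.valueBound_nonneg)
      (abs_valueIter_succ_sub_le n) z m
    rwa [← mul_assoc, ← pow_succ'] at this

theorem exists_tendsto_valueIter (z : Zn) (m : Fin 3 → ℝ) :
    ∃ v, Tendsto (fun n => R.valueIter n z m) atTop (𝓝 v) := by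
  refine cauchySeq_tendsto_of_complete (cauchySeq_of_le_geometric R.γ
    (R.valueBound * ∑ k, |m k|) R.γ_lt_one fun n => ?_)
  rw [dist_comm, Real.dist_eq]
  refine (R.abs_valueIter_succ_sub_le n z m).trans (le_of_eq ?_)
  ring

/-- The value function. -/
def value (z : Zn) (m : Fin 3 → ℝ) : ℝ := (R.exists_tendsto_valueIter z m).choose

theorem tendsto_valueIter (z : Zn) (m : Fin 3 → ℝ) :
    Tendsto (fun n => R.valueIter n z m) atTop (𝓝 (R.value z m)) :=
  (R.exists_tendsto_valueIter z m).choose_spec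

theorem isValueLike_value (z : Zn) : IsValueLike R.valueBound (R.value z) :=
  IsValueLike.of_tendsto (fun n => R.isValueLike_valueIter n z) (R.tendsto_valueIter z)

theorem bellman_value (z : Zn) (m : Fin 3 → ℝ) : R.bellman R.value z m = R.value z m := by
  refine tendsto_nhds_unique ?_ ((tendsto_add_atTop_iff_nat 1).2 (R.tendsto_valueIter z m))
  refine Tendsto.finset_sup'_nhds_apply _ fun d _ => ?_
  refine tendsto_const_nhds.add (tendsto_const_nhds.mul (tendsto_finsetSum _ fun z' _ => ?_))
  exact tendsto_const_nhds.mul (tendsto_finsetSum _ fun o _ => R.tendsto_valueIter _ _)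

theorem actionValue_le_value (z : Zn) (d : AD) (m : Fin 3 → ℝ) :
    R.actionValue R.value z d m ≤ R.value z m := by
  rw [← R.bellman_value z m]
  exact le_sup' (fun d => R.actionValue R.value z d m) (mem_univ d)

theorem value_eq_of_forall_le {z : Zn} {d : AD} {m : Fin 3 → ℝ}
    (h : ∀ d', R.actionValue R.value z d' m ≤ R.actionValue R.value z d m) :
    R.actionValue R.value z d m = R.value z m := by
  refine le_antisymm (R.actionValue_le_value z d m) ?_
  rw [← R.bellman_value z m]
  exact sup'_le _ _ fun b _ => h b

/-- The part of the value of an action other than the null action that depends on the action. -/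
def resetValue (z : Zn) (d : AD) : ℝ :=
  -R.cost d + R.γ * ∑ z', R.f z d z' * R.value z' (Pi.single 0 1)

/-- After a reset every posterior is a multiple of `e₁`, so by homogeneity the continuation is
proportional to the total mass. Defensive actions therefore differ only by a coefficient of that
mass, and their ranking does not depend on the belief. -/
theorem actionValue_reset {d : AD} (hd : d ≠ R.null) (z : Zn) {m : Fin 3 → ℝ}
    (hm : ∀ k, 0 ≤ m k) :
    R.actionValue R.value z d m = (R.base z + R.resetValue z d) * ∑ k, m k - m 2 := by
  have h1 : R.future R.value z d m
      = (∑ z', R.f z d z' * R.value z' (Pi.single 0 1)) * ∑ k, m k := by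
    rw [future, sum_mul]
    refine sum_congr rfl fun z' _ => ?_
    rw [mul_assoc]
    congr 1
    have h2 : ∀ o, R.value z' (R.update d z' o m)
        = R.L z' 0 o * (R.value z' (Pi.single 0 1) * ∑ k, m k) := by
      intro o
      have h3 : R.update d z' o m = (R.L z' 0 o * ∑ k, m k) • Pi.single 0 1 := by
        funext k
        rw [update, R.sum_mul_reset hd]
        by_cases hk : k = 0
        · subst hk
          simp [mul_comm]
        · simp [hk]
      rw [h3, (R.isValueLike_value z').smul _
        (mul_nonneg ((R.L z' 0).nonneg o) (sum_nonneg fun k _ => hm k))]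
      ring
    rw [sum_congr rfl fun o _ => h2 o, ← sum_mul, FinDist.sum_eq_one, one_mul]
  rw [actionValue, R.sum_mul_reward, h1, resetValue]
  ring

/-- The gain of the null action compared with the action `a`. -/
def gain (z : Zn) (a : AD) (m : Fin 3 → ℝ) : ℝ :=
  ∑ k, m k * (-R.cost R.null - R.resetValue z a) + R.γ * R.future R.value z R.null m

/-- The base reward and the intrusion cost are common to both actions and cancel. What is left is a
multiple of the mass plus a discounted continuation; a difference of value-like functions would not
be value-like in general. -/
theorem exists_isValueLike_gain (z : Zn) (a : AD) : ∃ B, IsValueLike B (R.gain z a) := by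
  refine ⟨_, (IsValueLike.linear (c := fun _ => -R.cost R.null - R.resetValue z a)
    (fun _ => le_rfl) fun m m' _ _ _ => ?_).add
    ((R.isValueLike_future R.valueBound_nonneg R.isValueLike_value z R.null).const_mul
      R.γ_nonneg)⟩
  rw [← sum_mul, ← sum_mul]
  exact le_of_eq (by ring)

theorem gain_eq {a : AD} (ha : a ≠ R.null) (z : Zn) {m : Fin 3 → ℝ} (hm : ∀ k, 0 ≤ m k) :
    R.gain z a m = R.actionValue R.value z R.null m - R.actionValue R.value z a m := by
  rw [R.actionValue_reset ha z hm, actionValue, R.sum_mul_reward, gain, ← sum_mul]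
  ring

/-- There are stopping sets with switching curves such that it is optimal to take a certain action
if the belief lies in the stopping set, and the null action otherwise. -/
theorem exists_stopping_sets : ∃ (act : Zn → AD) (stopSet : Zn → Set (Fin 3 → ℝ))
    (curve : Zn → ℝ → ℝ), (∀ z, HasSwitchingCurve (stopSet z) (curve z)) ∧
      (∀ z, (stopSet z).Nonempty → act z ≠ R.null) ∧
      ∀ z (m : Fin 3 → ℝ), (∀ k, 0 ≤ m k) →
        ((fun k => m k / ∑ j, m j) ∈ stopSet z →
          R.actionValue R.value z (act z) m = R.value z m) ∧
        ((fun k => m k / ∑ j, m j) ∉ stopSet z →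
          R.actionValue R.value z R.null m = R.value z m) := by
  classical
  suffices H : ∀ z, ∃ (a : AD) (S : Set (Fin 3 → ℝ)) (c : ℝ → ℝ), HasSwitchingCurve S c ∧
      (S.Nonempty → a ≠ R.null) ∧ ∀ m : Fin 3 → ℝ, (∀ k, 0 ≤ m k) →
        ((fun k => m k / ∑ j, m j) ∈ S → R.actionValue R.value z a m = R.value z m) ∧
        ((fun k => m k / ∑ j, m j) ∉ S → R.actionValue R.value z R.null m = R.value z m) by
    choose act stopSet curve h1 h2 h3 using H
    exact ⟨act, stopSet, curve, h1, h2, h3⟩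
  intro z
  by_cases hex : ∃ d, d ≠ R.null
  · obtain ⟨d₀, hd₀⟩ := hex
    -- One defensive action is best for all beliefs in zone `z`, so it only has to be compared with
    -- the null action.
    obtain ⟨a, ha, hmax⟩ := (univ.filter (· ≠ R.null)).exists_max_image (R.resetValue z)
      ⟨d₀, by simpa using hd₀⟩
    have ha' : a ≠ R.null := by simpa using ha
    obtain ⟨B, hB⟩ := R.exists_isValueLike_gain z a
    refine ⟨a, _, _, hB.hasSwitchingCurve, fun _ => ha', fun m hm => ?_⟩
    have hle : ∀ d, d ≠ R.null →
        R.actionValue R.value z d m ≤ R.actionValue R.value z a m := by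
      intro d hd
      rw [R.actionValue_reset hd z hm, R.actionValue_reset ha' z hm]
      have h1 := hmax d (by simpa using hd)
      have h2 := mul_le_mul_of_nonneg_right h1 (sum_nonneg fun k (_ : k ∈ univ) => hm k)
      linarith
    have hgain := R.gain_eq ha' z hm
    -- At zero mass the normalized belief is the default `0 / 0 = 0`, outside the simplex; every
    -- action value is zero there and any choice is optimal.
    by_cases hs : ∑ j, m j = 0
    · have hm0 : m = 0 := by
        funext k
        exact (sum_eq_zero_iff_of_nonneg fun k _ => hm k).1 hs k (mem_univ k)
      have h0 : ∀ d, R.actionValue R.value z d m = R.value z m := by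
        intro d
        rw [hm0, (R.isValueLike_actionValue R.isValueLike_value z d).map_zero,
          (R.isValueLike_value z).map_zero]
      exact ⟨fun _ => h0 a, fun _ => h0 R.null⟩
    have hpos : 0 < ∑ j, m j := lt_of_le_of_ne (sum_nonneg fun k _ => hm k) (Ne.symm hs)
    have hb : (fun k => m k / ∑ j, m j) ∈ stdSimplex ℝ (Fin 3) :=
      ⟨fun k => div_nonneg (hm k) hpos.le, by rw [← sum_div, div_self hs]⟩
    have hscale : R.gain z a m = (∑ j, m j) * R.gain z a (fun k => m k / ∑ j, m j) := by
      rw [← hB.smul _ hpos.le]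
      congr 1
      funext k
      simp [mul_div_cancel₀ _ hs]
    constructor
    · intro hS
      have h1 : R.gain z a m ≤ 0 := by
        rw [hscale]
        exact mul_nonpos_of_nonneg_of_nonpos hpos.le hS.2
      refine R.value_eq_of_forall_le fun d => ?_
      by_cases hd : d = R.null
      · rw [hd]
        linarith
      · exact hle d hd
    · intro hS
      have h1 : 0 < R.gain z a m := by
        rw [hscale]
        refine mul_pos hpos (not_le.1 fun h => hS ⟨hb, h⟩)
      refine R.value_eq_of_forall_le fun d => ?_
      by_cases hd : d = R.null
      · rw [hd]
      · have := hle d hd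
        linarith
  -- Without defensive actions the stopping set is empty.
  · push Not at hex
    refine ⟨R.null, ∅, _, hasSwitchingCurve_empty, fun h => absurd h Set.not_nonempty_empty,
      fun m _ => ⟨fun h => absurd h (Set.notMem_empty _), fun _ => ?_⟩⟩
    exact R.value_eq_of_forall_le fun d => by rw [hex d]

end LevelProblem

end IntrusionResponse

end

noncomputable section

namespace IntrusionResponse

open Finset Strategy Game

/-! ### Best responses in a node subgame -/

theorem sum_nodeAttState (g : NodeAttState → ℝ) :
    ∑ s, g s = ∑ k, g (level k) + g (false, true) := by
  simp only [Fintype.sum_prod_type, Fintype.sum_bool, Fin.sum_univ_three, level,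
    Matrix.cons_val_zero, Matrix.cons_val_one, Matrix.cons_val]
  ring

namespace Model

set_option linter.unusedSectionVars false

variable {V W Zn AD AA O : Type} [Fintype V] [DecidableEq V] [Fintype W] [DecidableEq W]
  [Fintype Zn] [DecidableEq Zn] [Fintype AD] [DecidableEq AD] [Fintype AA] [Fintype O]
  (M : Model V W Zn AD AA O) (i : V)

/-- The fourth attacker state is unreachable from the three levels, which makes a three-point belief
sufficient. -/
theorem fA_compromised_undiscovered {j : Fin 3} {a : AA} (ha : a ∈ M.adm i (level j)) (d : AD) :
    M.fA i (level j) a d (false, true) = 0 := by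
  by_cases hd : d = M.nullD
  · subst hd
    by_contra h
    fin_cases j
    · exact absurd (M.discover_first i a _ _ ha h) (by decide)
    · exact absurd (M.persist i _ a _ rfl ha h).1 (by decide)
    · exact absurd (M.persist i _ a _ rfl ha h).1 (by decide)
  · exact FinDist.eq_zero_of_apply_eq_one _ (M.reset i _ a d hd) (by decide)

variable (σ : NodeAttState → FinDist AA)

/-- The transition probabilities of the attacker state under a stationary strategy. -/
def trans (d : AD) (s s' : NodeAttState) : ℝ := ∑ a, σ s a * M.fA i s a d s'

theorem sum_trans (d : AD) (s : NodeAttState) : ∑ s', M.trans i σ d s s' = 1 := by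
  simp only [trans]
  rw [sum_comm]
  simp only [← mul_sum, FinDist.sum_eq_one, mul_one]

theorem trans_nonneg (d : AD) (s s' : NodeAttState) : 0 ≤ M.trans i σ d s s' :=
  sum_nonneg fun _ _ => mul_nonneg (FinDist.nonneg _ _) (FinDist.nonneg _ _)

section

variable {σ}

theorem trans_eq_zero (hσ : ∀ s a, σ s a ≠ 0 → a ∈ M.adm i s) {d : AD} {s s' : NodeAttState}
    (h : ∀ a ∈ M.adm i s, M.fA i s a d s' = 0) : M.trans i σ d s s' = 0 := by
  refine sum_eq_zero fun a _ => ?_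
  by_cases ha : σ s a = 0
  · rw [ha, zero_mul]
  · rw [h a (hσ s a ha), mul_zero]

theorem trans_compromised_undiscovered (hσ : ∀ s a, σ s a ≠ 0 → a ∈ M.adm i s)
    (d : AD) (j : Fin 3) :
    M.trans i σ d (level j) (false, true) = 0 :=
  M.trans_eq_zero i hσ fun _ ha => M.fA_compromised_undiscovered i ha d

theorem sum_trans_level (hσ : ∀ s a, σ s a ≠ 0 → a ∈ M.adm i s) (d : AD)
    (j : Fin 3) : ∑ k, M.trans i σ d (level j) (level k) = 1 := by
  have := M.sum_trans i σ d (level j)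
  rwa [sum_nodeAttState, M.trans_compromised_undiscovered i hσ, add_zero] at this

end

/-- The defender's control problem in a node subgame against a stationary strategy. -/
def levelProblem [LinearOrder O] {σ : NodeAttState → FinDist AA}
    (hσ : ∀ s a, σ s a ≠ 0 → a ∈ M.adm i s) (hi : M.TP2 i) : LevelProblem Zn AD O where
  null := M.nullD
  f := M.fD i
  P d j := ⟨fun k => M.trans i σ d (level j) (level k), fun _ => M.trans_nonneg i σ d _ _,
    M.sum_trans_level i hσ d j⟩
  L z k := M.Z i z (level k)
  base z := M.η * (M.κ * ((Set.ncard {j : V | M.IsAncestor j i} : ℝ) *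
      (if M.active i z = true then 1 else 0)))
  cost := M.cost
  γ := M.γ
  γ_nonneg := M.γ_nonneg
  γ_lt_one := M.γ_lt_one
  reset d k hd := by
    change ∑ a, σ (level k) a * M.fA i (level k) a d (false, false) = 1
    simp only [M.reset i _ _ d hd, mul_one, FinDist.sum_eq_one]
  no_jump := M.trans_eq_zero i hσ fun a ha => by
    by_contra h
    exact absurd (M.discover_first i a _ _ ha h) (by decide)
  no_return := M.trans_eq_zero i hσ fun a ha => by
    by_contra h
    exact absurd (M.persist i _ a _ rfl ha h).1 (by decide)
  stays := by
    have h := M.sum_trans_level i hσ M.nullD 2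
    have h0 : M.trans i σ M.nullD (level 2) (level 0) = 0 := M.trans_eq_zero i hσ fun a ha => by
      by_contra h
      exact absurd (M.persist i _ a _ rfl ha h).1 (by decide)
    have h1 : M.trans i σ M.nullD (level 2) (level 1) = 0 := M.trans_eq_zero i hσ fun a ha => by
      by_contra h
      exact absurd ((M.persist i _ a _ rfl ha h).2 rfl) (by decide)
    rw [Fin.sum_univ_three, h0, h1, zero_add, zero_add] at h
    exact h
  tp2 z o o' ho k l hkl := by
    have := hi z k l o o' hkl ho
    linarith

variable {σ} (μ : FinDist NodeAttState)

theorem filter_single (z : Zn) (o : O) (s : NodeAttState) :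
    M.filter i σ μ (Hist.single z o : Hist Zn AD O 0) s = μ s * M.Z i z s o := rfl

theorem filter_snoc {n : ℕ} (h : Hist Zn AD O n) (d : AD) (z : Zn) (o : O) (s' : NodeAttState) :
    M.filter i σ μ (h.snoc d z o) s'
      = (∑ s, M.filter i σ μ h s * M.trans i σ d s s') * M.Z i z s' o := by
  have : M.filter i σ μ (h.snoc d z o) s'
      = (∑ s, ∑ a, M.filter i σ μ h s * σ s a * M.fA i s a d s') * M.Z i z s' o := rfl
  rw [this]
  simp only [trans, mul_sum, mul_assoc]

theorem filter_nonneg : ∀ {n : ℕ} (h : Hist Zn AD O n) (s : NodeAttState), 0 ≤ M.filter i σ μ h s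
  | 0, h, s => by
    obtain ⟨z, o, rfl⟩ := h.exists_eq_single
    exact mul_nonneg (FinDist.nonneg _ _) (FinDist.nonneg _ _)
  | n + 1, h, s => by
    obtain ⟨h, d, z, o, rfl⟩ := h.exists_eq_snoc
    rw [filter_snoc]
    exact mul_nonneg (sum_nonneg fun s _ => mul_nonneg (filter_nonneg h s)
      (M.trans_nonneg i σ d _ _)) (FinDist.nonneg _ _)

theorem filter_compromised_undiscovered (hσ : ∀ s a, σ s a ≠ 0 → a ∈ M.adm i s)
    (hμ : μ (false, true) = 0) :
    ∀ {n : ℕ} (h : Hist Zn AD O n), M.filter i σ μ h (false, true) = 0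
  | 0, h => by
    obtain ⟨z, o, rfl⟩ := h.exists_eq_single
    rw [filter_single, hμ, zero_mul]
  | n + 1, h => by
    obtain ⟨h, d, z, o, rfl⟩ := h.exists_eq_snoc
    rw [filter_snoc, sum_nodeAttState, filter_compromised_undiscovered hσ hμ h, zero_mul,
      add_zero, sum_eq_zero, zero_mul]
    intro k _
    rw [M.trans_compromised_undiscovered i hσ, mul_zero]

/-! ### The law of the defender's history and the attacker state -/

/-- The probability that the zones of a history occur if its actions are taken. -/
def zoneProb (z₀ : Zn) : ∀ {n : ℕ}, Hist Zn AD O n → ℝ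
  | 0, (z, _) => ind (z = z₀)
  | _ + 1, (h, d, z, _) => zoneProb z₀ h * M.fD i h.last d z

theorem zoneProb_snoc (z₀ : Zn) {n : ℕ} (h : Hist Zn AD O n) (d : AD) (z : Zn) (o : O) :
    M.zoneProb i z₀ (h.snoc d z o) = M.zoneProb i z₀ h * M.fD i h.last d z := rfl

theorem zoneProb_nonneg (z₀ : Zn) : ∀ {n : ℕ} (h : Hist Zn AD O n), 0 ≤ M.zoneProb i z₀ h
  | 0, _ => ind_nonneg _
  | _ + 1, (h, _, _, _) => mul_nonneg (zoneProb_nonneg z₀ h) (FinDist.nonneg _ _)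

/-- The joint distribution of the defender's history and the attacker state. -/
theorem sum_play_eq (z₀ : Zn) : ∀ {n : ℕ} (h : Hist Zn AD O n) (φ : NodeAttState → ℝ),
    ∑ p : Play Zn NodeAttState AD AA O n, ind (defenderHist p = h) *
      (weight (stationary σ) (attackerHist p) * (M.nodeGameFrom i z₀ μ).chance p) * φ p.last.2
      = M.zoneProb i z₀ h * ∑ s, M.filter i σ μ h s * φ s
  | 0, h, φ => by
    obtain ⟨z, o, rfl⟩ := h.exists_eq_single
    rw [Hist.sum_zero]
    have h1 : ∀ (s : Zn × NodeAttState) (o' : O),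
        ind (defenderHist (Hist.single s o' : Play Zn NodeAttState AD AA O 0) = Hist.single z o) *
          (weight (stationary σ) (attackerHist (Hist.single s o' : Play Zn NodeAttState AD AA O 0))
            * (M.nodeGameFrom i z₀ μ).chance (Hist.single s o')) *
          φ (Hist.last (Hist.single s o' : Play Zn NodeAttState AD AA O 0)).2
        = ind (z = s.1) * (ind (o = o') * (ind (s.1 = z₀) * μ s.2 * M.Z i s.1 s.2 o' * φ s.2)) := by
      intro s o'
      have e1 : (M.nodeGameFrom i z₀ μ).chance (Hist.single s o')
          = ind (s.1 = z₀) * μ s.2 * M.Z i s.1 s.2 o' := by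
        rw [chance_single, ← FinDist.vertex_apply]
        rfl
      have e2 : ind (defenderHist (Hist.single s o' : Play Zn NodeAttState AD AA O 0)
          = Hist.single z o) = ind (z = s.1) * ind (o = o') := by
        rw [← ind_and, defenderHist, Hist.map_single, Hist.single_inj, eq_comm (a := s.1), id,
          eq_comm (a := o')]
      rw [e1, e2, weight_zero, Hist.last_single]
      ring
    simp only [h1, ← mul_sum, sum_ind_mul]
    rw [Fintype.sum_prod_type]
    simp only [← mul_sum, sum_ind_mul]
    change _ = ind (z = z₀) * _
    rw [mul_sum]
    refine sum_congr rfl fun s _ => ?_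
    rw [filter_single]
    ring
  | n + 1, h, φ => by
    obtain ⟨h, d, z, o, rfl⟩ := h.exists_eq_snoc
    -- The test function `φ` is arbitrary so that the induction hypothesis applies to its one-step
    -- average. The zone factor splits off because zones move independently of the attacker.
    have ih := sum_play_eq z₀ h fun t =>
      ∑ s', M.trans i σ d t s' * M.Z i z s' o * φ s'
    rw [Hist.sum_succ, zoneProb_snoc]
    have h1 : ∀ (p : Play Zn NodeAttState AD AA O n) (a : AD × AA) (s : Zn × NodeAttState) (o' : O),
        ind (defenderHist (Hist.snoc p a s o') = h.snoc d z o) *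
          (weight (stationary σ) (attackerHist (Hist.snoc p a s o')) *
            (M.nodeGameFrom i z₀ μ).chance (Hist.snoc p a s o')) *
          φ (Hist.last (Hist.snoc p a s o')).2
        = ind (d = a.1) * (ind (z = s.1) * (ind (o = o') * (ind (defenderHist p = h) *
          (weight (stationary σ) (attackerHist p) * (M.nodeGameFrom i z₀ μ).chance p) *
          M.fD i h.last a.1 s.1 *
          (σ (Hist.last p).2 a.2 * M.fA i (Hist.last p).2 a.2 a.1 s.2 *
            M.Z i s.1 s.2 o' * φ s.2)))) := by
      intro p a s o'
      rw [defenderHist_snoc, Hist.snoc_inj, ind_and, ind_and, ind_and, attackerHist_snoc,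
        weight_succ, chance_snoc, Hist.last_snoc, eq_comm (a := a.1), eq_comm (a := s.1),
        eq_comm (a := o')]
      by_cases hp : defenderHist p = h
      · have e1 : (Hist.last p).1 = h.last := by rw [← hp, defenderHist, Hist.last_map]
        have e2 : (stationary σ : Strategy NodeAttState AA O) n (attackerHist p)
            = σ (Hist.last p).2 := by
          rw [stationary, attackerHist, Hist.last_map]
        have e3 : (M.nodeGameFrom i z₀ μ).step (Hist.last p) a s o'
            = M.fD i h.last a.1 s.1 * M.fA i (Hist.last p).2 a.2 a.1 s.2 * M.Z i s.1 s.2 o' := by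
          rw [← e1]
          rfl
        rw [e2, e3]
        ring
      · rw [ind_neg hp]
        ring
    have hz : ∀ g : Zn × NodeAttState → ℝ, ∑ x, g x = ∑ z, ∑ s, g (z, s) :=
      fun g => Fintype.sum_prod_type g
    have ha : ∀ g : AD × AA → ℝ, ∑ x, g x = ∑ d, ∑ a, g (d, a) :=
      fun g => Fintype.sum_prod_type g
    have h2 : ∀ p : Play Zn NodeAttState AD AA O n, ∑ a : AD × AA, ∑ s, ∑ o',
        ind (defenderHist (Hist.snoc p a s o') = h.snoc d z o) *
          (weight (stationary σ) (attackerHist (Hist.snoc p a s o')) *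
            (M.nodeGameFrom i z₀ μ).chance (Hist.snoc p a s o')) *
          φ (Hist.last (Hist.snoc p a s o')).2
        = ind (defenderHist p = h) *
          (weight (stationary σ) (attackerHist p) * (M.nodeGameFrom i z₀ μ).chance p) *
          (∑ s', M.trans i σ d (Hist.last p).2 s' * M.Z i z s' o * φ s') *
          M.fD i h.last d z := by
      intro p
      simp only [h1, ← mul_sum, sum_ind_mul, hz, ha]
      rw [sum_comm, mul_right_comm]
      congr 2
      exact sum_congr rfl fun s' _ => by simp only [trans, sum_mul]
    rw [sum_congr rfl fun p _ => h2 p, ← sum_mul, ih, mul_right_comm]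
    congr 1
    simp only [filter_snoc, mul_sum, sum_mul]
    rw [sum_comm]
    exact sum_congr rfl fun s' _ => sum_congr rfl fun s _ => by ring

section

variable {μ} (z₀ : Zn)

theorem mass_eq {n : ℕ} (h : Hist Zn AD O n) :
    ((M.nodeGameFrom i z₀ μ).defenderProblem (stationary σ)).mass n h
      = M.zoneProb i z₀ h * ∑ s, M.filter i σ μ h s := by
  have := M.sum_play_eq (σ := σ) i μ z₀ h fun _ => 1
  simp only [mul_one] at this
  exact this

theorem reward_eq {n : ℕ} (h : Hist Zn AD O n) (d : AD) :
    ((M.nodeGameFrom i z₀ μ).defenderProblem (stationary σ)).reward n h d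
      = M.zoneProb i z₀ h * ∑ s, M.filter i σ μ h s * (M.nodeGameFrom i z₀ μ).u h.last s d := by
  rw [← M.sum_play_eq i μ z₀ h fun s => (M.nodeGameFrom i z₀ μ).u h.last s d]
  refine sum_congr rfl fun p _ => ?_
  by_cases hp : defenderHist p = h
  · have e1 : (Hist.last p).1 = h.last := by rw [← hp, defenderHist, Hist.last_map]
    rw [e1]
  · rw [ind_neg hp]
    ring

theorem sum_filter_mul (hσ : ∀ s a, σ s a ≠ 0 → a ∈ M.adm i s)
    (hμ : μ (false, true) = 0) {n : ℕ} (h : Hist Zn AD O n) (g : NodeAttState → ℝ) :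
    ∑ s, M.filter i σ μ h s * g s = ∑ k, M.filter i σ μ h (level k) * g (level k) := by
  rw [sum_nodeAttState, M.filter_compromised_undiscovered i μ hσ hμ, zero_mul, add_zero]

theorem sum_filter (hσ : ∀ s a, σ s a ≠ 0 → a ∈ M.adm i s)
    (hμ : μ (false, true) = 0) {n : ℕ} (h : Hist Zn AD O n) :
    ∑ s, M.filter i σ μ h s = ∑ k, M.filter i σ μ h (level k) := by
  simpa using M.sum_filter_mul i hσ hμ h fun _ => 1

variable [LinearOrder O]

theorem filter_snoc_level (hσ : ∀ s a, σ s a ≠ 0 → a ∈ M.adm i s)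
    (hμ : μ (false, true) = 0) (hi : M.TP2 i) {n : ℕ} (h : Hist Zn AD O n) (d : AD)
    (z : Zn) (o : O) :
    (fun k => M.filter i σ μ (h.snoc d z o) (level k))
      = (M.levelProblem i hσ hi).update d z o fun k => M.filter i σ μ h (level k) := by
  funext k
  rw [filter_snoc, M.sum_filter_mul i hσ hμ]
  rfl

/-- The Bellman equation of the node subgame in terms of the value function of the level
problem. -/
theorem reward_add_eq (hσ : ∀ s a, σ s a ≠ 0 → a ∈ M.adm i s)
    (hμ : μ (false, true) = 0) (hi : M.TP2 i) {n : ℕ} (h : Hist Zn AD O n) (d : AD) :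
    ((M.nodeGameFrom i z₀ μ).defenderProblem (stationary σ)).reward n h d
      + M.γ * ∑ z, ∑ o, M.zoneProb i z₀ (h.snoc d z o) * (M.levelProblem i hσ hi).value z
        (fun k => M.filter i σ μ (h.snoc d z o) (level k))
      = M.zoneProb i z₀ h * (M.levelProblem i hσ hi).actionValue (M.levelProblem i hσ hi).value
        h.last d fun k => M.filter i σ μ h (level k) := by
  rw [M.reward_eq, M.sum_filter_mul i hσ hμ, LevelProblem.actionValue, mul_add]
  congr 1
  · congr 1
    refine sum_congr rfl fun k _ => ?_
    congr 1
    fin_cases k <;> simp [level, nodeGameFrom, LevelProblem.reward, levelProblem, intrusionCost,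
      ind]
    ring
  · have h1 : ∀ z o, M.zoneProb i z₀ (h.snoc d z o) * (M.levelProblem i hσ hi).value z
        (fun k => M.filter i σ μ (h.snoc d z o) (level k))
        = M.zoneProb i z₀ h * (M.fD i h.last d z * (M.levelProblem i hσ hi).value z
          ((M.levelProblem i hσ hi).update d z o fun k => M.filter i σ μ h (level k))) := by
      intro z o
      rw [zoneProb_snoc, M.filter_snoc_level i hσ hμ hi, mul_assoc]
    simp only [h1, ← mul_sum]
    rw [mul_left_comm]
    rfl

/-- The Bellman function is the probability of the zones times the value of the unnormalized
posterior. No division by the probability of a history occurs, so histories of probability zero need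
no separate treatment. -/
theorem isBestResponseD_stoppingStrategy (hσ : ∀ s a, σ s a ≠ 0 → a ∈ M.adm i s)
    (hμ : μ (false, true) = 0) (hi : M.TP2 i)
    {act : Zn → AD} {stopSet : Zn → Set (Fin 3 → ℝ)}
    (hact : ∀ z (m : Fin 3 → ℝ), (∀ k, 0 ≤ m k) →
        ((fun k => m k / ∑ j, m j) ∈ stopSet z →
          (M.levelProblem i hσ hi).actionValue (M.levelProblem i hσ hi).value z (act z) m
            = (M.levelProblem i hσ hi).value z m) ∧
        ((fun k => m k / ∑ j, m j) ∉ stopSet z →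
          (M.levelProblem i hσ hi).actionValue (M.levelProblem i hσ hi).value z M.nullD m
            = (M.levelProblem i hσ hi).value z m)) :
    (M.nodeGameFrom i z₀ μ).IsBestResponseD (stationary σ)
      (M.stoppingStrategy i σ μ act stopSet) := by
  intro πD'
  rw [payoff_eq_defender, payoff_eq_defender]
  refine ControlProblem.value_le_of_bellman _
    (J := fun n h => M.zoneProb i z₀ h * (M.levelProblem i hσ hi).value h.last
      fun k => M.filter i σ μ h (level k)) (B := (M.levelProblem i hσ hi).valueBound)
    (fun n h => ?_) (fun n h d => ?_) (fun n h d hd => ?_) πD'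
  · rw [abs_mul, abs_of_nonneg (M.zoneProb_nonneg i z₀ h), M.mass_eq, M.sum_filter i hσ hμ,
      mul_left_comm]
    refine mul_le_mul_of_nonneg_left ?_ (M.zoneProb_nonneg i z₀ h)
    refine (((M.levelProblem i hσ hi).isValueLike_value h.last).abs_le _).trans (le_of_eq ?_)
    simp only [abs_of_nonneg (M.filter_nonneg i μ h _)]
  · refine (M.reward_add_eq i z₀ hσ hμ hi h d).le.trans ?_
    exact mul_le_mul_of_nonneg_left ((M.levelProblem i hσ hi).actionValue_le_value _ _ _)
      (M.zoneProb_nonneg i z₀ h)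
  · refine (M.reward_add_eq i z₀ hσ hμ hi h d).trans ?_
    congr 1
    have hm : ∀ k, 0 ≤ M.filter i σ μ h (level k) := fun k => M.filter_nonneg i μ h _
    have hb : M.belief i σ μ h
        = fun k => M.filter i σ μ h (level k) / ∑ j, M.filter i σ μ h (level j) := by
      funext k
      rw [belief, M.sum_filter i hσ hμ]
    obtain ⟨h1, h2⟩ := hact h.last _ hm
    rw [← hb] at h1 h2
    by_cases hS : M.belief i σ μ h ∈ stopSet h.last
    · rw [stoppingStrategy, if_pos hS, FinDist.vertex_apply] at hd
      have e : d = act h.last := by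
        by_contra hne
        exact hd (ind_neg hne)
      rw [e]
      exact h1 hS
    · rw [stoppingStrategy, if_neg hS, FinDist.vertex_apply] at hd
      have e : d = M.nullD := by
        by_contra hne
        exact hd (ind_neg hne)
      rw [e]
      exact h2 hS

end

/-- Histories without actions already realize every attacker state; an observation to complete them
exists because `Z` is a distribution on `O`. -/
theorem mem_adm_of_admissible (hσ : (M.nodeGame i).Admissible (stationary σ)) (s : NodeAttState)
    (a : AA) (ha : σ s a ≠ 0) : a ∈ M.adm i s := by
  have : Nonempty O := by
    by_contra hO
    rw [not_nonempty_iff] at hO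
    have := (M.Z i (M.zone₁ i) s).sum_eq_one
    simp at this
  obtain ⟨o⟩ := this
  exact hσ 0 (Hist.single s o) a ha

end Model

end IntrusionResponse

end

theorem theorem2 {V W Zn AD AA O : Type} [Fintype V] [DecidableEq V] [Fintype W] [DecidableEq W]
    [Fintype Zn] [DecidableEq Zn] [Fintype AD] [DecidableEq AD] [Fintype AA] [Fintype O]
    [LinearOrder O] (M : Model V W Zn AD AA O) :
    -- (A) independent workflow subgames with optimal substructure
    (M.workflowSplit.ObservationIndependent M.game M.workflowGame ∧
      M.workflowSplit.TransitionIndependent M.game M.workflowGame ∧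
      M.workflowSplit.UtilityIndependent M.game M.workflowGame ∧
      M.workflowSplit.OptimalSubstructure M.game M.workflowGame) ∧
    -- (B) node subgames with optimal substructure and of a size that does not depend on `V`
    ((∀ w : W,
      (M.nodeSplit w).ObservationIndependent (M.workflowGame w) (fun i => M.nodeGame i) ∧
      (M.nodeSplit w).TransitionIndependent (M.workflowGame w) (fun i => M.nodeGame i) ∧
      (M.nodeSplit w).UtilityIndependent (M.workflowGame w) (fun i => M.nodeGame i) ∧
      (M.nodeSplit w).OptimalSubstructure (M.workflowGame w) (fun i => M.nodeGame i)) ∧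
      ∀ i : V, (M.nodeGame i).spaceComplexity =
        4 * Fintype.card AA + Fintype.card Zn ^ 2 * Fintype.card AD
          + 16 * Fintype.card AA * Fintype.card AD + 4 * Fintype.card Zn * Fintype.card O
          + 4 * Fintype.card Zn * Fintype.card AD + Fintype.card Zn + 5) ∧
    -- (C) best responses of the defender given by switching curves
    ∀ i : V, M.TP2 i → ∀ σ : NodeAttState → FinDist AA,
      (M.nodeGame i).Admissible (Model.stationary σ) →
      ∃ (act : Zn → AD) (stopSet : Zn → Set (Fin 3 → ℝ)) (curve : Zn → ℝ → ℝ),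
        (∀ z, HasSwitchingCurve (stopSet z) (curve z)) ∧
        (∀ z, (stopSet z).Nonempty → act z ≠ M.nullD) ∧
        (M.nodeGame i).IsBestResponseD (Model.stationary σ)
          (M.stoppingStrategy i σ (stdSimplex.vertex (false, false)) act stopSet) ∧
        ∀ (z : Zn) (μ : FinDist NodeAttState), μ (false, true) = 0 →
          (M.nodeGameFrom i z μ).IsBestResponseD (Model.stationary σ)
            (M.stoppingStrategy i σ μ act stopSet) := by
  have : Nonempty AD := ⟨M.nullD⟩
  refine ⟨⟨M.workflow_observationIndependent, M.workflow_transitionIndependent,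
      M.workflow_utilityIndependent, Split.optimalSubstructure_of_independent
        M.workflow_observationIndependent M.workflow_transitionIndependent
        M.workflow_utilityIndependent⟩,
    ⟨fun w => ⟨M.node_observationIndependent w, M.node_transitionIndependent w,
      M.node_utilityIndependent w, Split.optimalSubstructure_of_independent
        (M.node_observationIndependent w) (M.node_transitionIndependent w)
        (M.node_utilityIndependent w)⟩, M.spaceComplexity_nodeGame⟩, fun i hi σ hσ => ?_⟩
  have hσ' := M.mem_adm_of_admissible i hσ
  -- The level problem involves neither the initial zone nor the initial distribution, so one choice
  -- of stopping sets serves every start.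
  obtain ⟨act, stopSet, curve, h1, h2, h3⟩ := (M.levelProblem i hσ' hi).exists_stopping_sets
  have h4 : ∀ (z : Zn) (μ : FinDist NodeAttState), μ (false, true) = 0 →
      (M.nodeGameFrom i z μ).IsBestResponseD (Model.stationary σ)
        (M.stoppingStrategy i σ μ act stopSet) :=
    fun z μ hμ => M.isBestResponseD_stoppingStrategy i z hσ' hμ hi h3
  refine ⟨act, stopSet, curve, h1, h2, h4 _ _ ?_, h4⟩
  rw [FinDist.vertex_apply]
  exact ind_neg (by decide)
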